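/- Let $a, b \geq 2$ be relatively prime integers and let $m \geq 1$. Call an integer a sum of $a$'s and $b$'s if it can be written as $ai+bj$ with integers $i, j \geq 0$. Let $\Sigma(a,b,m)$ be the subcomplex of the simplex $\Delta^{m-1}$ with vertices $v_0, \ldots, v_{m-1}$ whose simplices are the faces $[v_{r_0}, \ldots, v_{r_e}]$, $r_0 < \cdots < r_e$, such that each $r_i - r_{i-1}$ ($1 \leq i \leq e$) as well as $r_0 + m - r_e$ is a sum of $a$'s and $b$'s. The cyclic group $C_m$ of order $m$ acts on $\Sigma(a,b,m)$ by cyclically permuting the vertices, so the reduced integral homology groups $\widetilde{H}_q(\Sigma(a,b,m))$ are $\mathbb{Z}[C_m]$-modules. For $n \mid m$ let $C_n \subseteq C_m$ be the subgroup of order $n$; maps between the permutation modules $\mathbb{Z}[C_m/C_n]$ below are the ones induced by the canonical projections of coset spaces. Let $\ell(a,b,m)$ be the number of ways to write $m = ai+bj$ with integers $i, j > 0$. Suppose that $m$ is a sum of $a$'s and $b$'s. Then $\Sigma(a,b,m) \neq \varnothing$, and as $\mathbb{Z}[C_m]$-modules the reduced homology groups are as follows. 1. If $a \nmid m$ and $b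 \nmid m$, then $\widetilde{H}_q(\Sigma(a,b,m))$ is isomorphic to $\mathbb{Z}[C_m/C_m]$ (the trivial module $\mathbb{Z}$) for $q = 2\ell(a,b,m)-1$ and is zero for all other $q$. 2. If $a \mid m$ and $b \nmid m$, then $\widetilde{H}_q(\Sigma(a,b,m))$ is isomorphic to the kernel of $\mathbb{Z}[C_m/C_{m/a}] \to \mathbb{Z}[C_m/C_m]$ for $q = 2\ell(a,b,m)$ and is zero for all other $q$. 3. If $a \nmid m$ and $b \mid m$, then $\widetilde{H}_q(\Sigma(a,b,m))$ is isomorphic to the kernel of $\mathbb{Z}[C_m/C_{m/b}] \to \mathbb{Z}[C_m/C_m]$ for $q = 2\ell(a,b,m)$ and is zero for all other $q$. 4. If $a \mid m$ and $b \mid m$, then $\widetilde{H}_q(\Sigma(a,b,m))$ is, for $q = 2\ell(a,b,m)+1$, isomorphic to the iterated kernel of the square $$\begin{array}{ccc} \mathbb{Z}[C_m/C_{m/ab}] & \to & \mathbb{Z}[C_m/C_{m/a}] \\ \downarrow & & \downarrow \\ \mathbb{Z}[C_m/C_{m/b}] & \to & \mathbb{Z}[C_m/C_m], \end{array}$$ that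 is, to the kernel of the induced map $\ker(\mathbb{Z}[C_m/C_{m/ab}] \to \mathbb{Z}[C_m/C_{m/a}]) \to \ker(\mathbb{Z}[C_m/C_{m/b}] \to \mathbb{Z}[C_m/C_m])$, and it is zero for all other $q$. -/

import Mathlib

open CategoryTheory
open scoped MonoidAlgebra Pointwise

noncomputable section

namespace CuspHomology

/-! ### Oriented simplicial chains of a complex with a group action

`V` is a totally ordered vertex set on which a group `G` acts (not necessarily monotonically), and
`K` is a simplicial complex on `V` (not every element of `V` has to be a vertex of `K`). -/

section Oriented

variable {V : Type} [LinearOrder V] {G : Type} [Group G] [MulAction G V]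

/-- The sign of the permutation that sorts `g • v₀, …, g • v_q`, where `v₀ < … < v_q` are the
elements of `s`: the parity of the number of inversions. -/
def orientSign (g : G) (s : Finset V) : ℤ :=
  ∏ u ∈ s, ∏ v ∈ s, if u < v ∧ g • v < g • u then -1 else 1

/-- The incidence sign `(-1)^i` of the face of `s = {v₀ < … < v_q}` opposite to `v = v_i`. -/
def faceSign (s : Finset V) (v : V) : ℤ :=
  (-1) ^ (s.filter (· < v)).card

/-- `1` if `g` preserves the order of `u` and `v`, and `-1` otherwise. -/
def pairSign (g : G) (u v : V) : ℤ := if (u < v ↔ g • u < g • v) then 1 else -1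

lemma orientSign_insert (g : G) {t : Finset V} {v : V} (hv : v ∉ t) :
    orientSign g (insert v t) = orientSign g t * ∏ u ∈ t, pairSign g u v := by
  unfold orientSign
  simp only [Finset.prod_insert hv, lt_irrefl, false_and, if_false, one_mul,
    Finset.prod_mul_distrib]
  rw [← mul_assoc, ← Finset.prod_mul_distrib, mul_comm]
  congr 1
  refine Finset.prod_congr rfl fun u hu => ?_
  have huv : u ≠ v := fun h => hv (h ▸ hu)
  have hguv : g • u ≠ g • v := fun h => huv (MulAction.injective g h)
  unfold pairSign
  rcases lt_or_gt_of_ne huv with h | h <;> rcases lt_or_gt_of_ne hguv with h' | h' <;>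
    simp [h, h', h.not_gt, h'.not_gt]

lemma pairSign_mul (g h : G) (u v : V) :
    pairSign (g * h) u v = pairSign g (h • u) (h • v) * pairSign h u v := by
  unfold pairSign
  rw [mul_smul, mul_smul]
  by_cases h1 : u < v <;> by_cases h2 : h • u < h • v <;>
    by_cases h3 : g • h • u < g • h • v <;> simp [h1, h2, h3]

lemma orientSign_mul (g h : G) (s : Finset V) :
    orientSign (g * h) s = orientSign g (h • s) * orientSign h s := by
  induction s using Finset.induction_on with
  | empty => simp [orientSign]
  | insert v t hv ih =>
    have hv' : h • v ∉ h • t := by simpa [Finset.smul_mem_smul_finset_iff] using hv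
    have hp : ∏ u ∈ h • t, pairSign g u (h • v) = ∏ u ∈ t, pairSign g (h • u) (h • v) := by
      rw [Finset.smul_finset_def, Finset.prod_image]
      exact fun x _ y _ e => MulAction.injective h e
    rw [Finset.smul_finset_insert, orientSign_insert _ hv, orientSign_insert _ hv,
      orientSign_insert _ hv', ih, hp,
      Finset.prod_congr rfl fun u _ => pairSign_mul g h u v,
      Finset.prod_mul_distrib]
    ring

lemma orientSign_one (s : Finset V) : orientSign (1 : G) s = 1 := by
  unfold orientSign
  refine Finset.prod_eq_one fun u _ => Finset.prod_eq_one fun v _ => ?_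
  rw [if_neg]
  rintro ⟨h1, h2⟩
  rw [one_smul, one_smul] at h2
  exact lt_asymm h1 h2

lemma faceSign_eq_prod (s : Finset V) (v : V) :
    faceSign s v = ∏ u ∈ s, if u < v then -1 else 1 := by
  unfold faceSign
  rw [← Finset.prod_filter, Finset.prod_const]

lemma faceSign_erase (s : Finset V) (v : V) : faceSign (s.erase v) v = faceSign s v := by
  unfold faceSign
  congr 2
  ext u
  simp only [Finset.mem_filter, Finset.mem_erase]
  exact ⟨fun h => ⟨h.1.2, h.2⟩, fun h => ⟨⟨h.2.ne, h.1⟩, h.2⟩⟩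

lemma faceSign_sq (s : Finset V) (v : V) : faceSign s v * faceSign s v = 1 := by
  unfold faceSign
  rw [← mul_pow]
  simp

lemma orientSign_face (g : G) {s : Finset V} {v : V} (hv : v ∈ s) :
    orientSign g s * faceSign (g • s) (g • v) = faceSign s v * orientSign g (s.erase v) := by
  have hge : (g • s).erase (g • v) = g • s.erase v := by
    rw [Finset.smul_finset_def, Finset.smul_finset_def,
      Finset.image_erase (MulAction.injective g)]
  have key : ∏ u ∈ s.erase v, pairSign g u v =
      faceSign s v * faceSign (g • s) (g • v) := by
    rw [← faceSign_erase s v, ← faceSign_erase (g • s), hge, faceSign_eq_prod,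
      faceSign_eq_prod, Finset.smul_finset_def, Finset.prod_image, ← Finset.prod_mul_distrib]
    · refine Finset.prod_congr rfl fun u _ => ?_
      unfold pairSign
      by_cases h1 : u < v <;> by_cases h2 : g • u < g • v <;> simp [h1, h2]
    · exact fun x _ y _ e => MulAction.injective g e
  conv_lhs => rw [← Finset.insert_erase hv, orientSign_insert g (Finset.notMem_erase v s),
    Finset.insert_erase hv, key]
  linear_combination (orientSign g (s.erase v) * faceSign s v) * faceSign_sq (g • s) (g • v)

variable (K : PreAbstractSimplicialComplex V)

/-- The `q`-simplices of `K`; the empty simplex is included, in dimension `-1`. -/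
def Simplex (q : ℤ) : Type :=
  {s : Finset V // (s = ∅ ∨ s ∈ K) ∧ (s.card : ℤ) = q + 1}

variable {K}

/-- The translate of a simplex by a group element that acts on `K`. -/
def Simplex.translate (hK : ∀ (g : G), ∀ s ∈ K, g • s ∈ K) {q : ℤ} (g : G) (s : Simplex K q) :
    Simplex K q :=
  ⟨g • s.1, s.2.1.imp (fun h => by rw [h, Finset.smul_finset_empty]) (hK g s.1),
    by rw [Finset.card_smul_finset]; exact s.2.2⟩

/-- The face of a simplex opposite to one of its vertices. -/
def Simplex.face {q : ℤ} (s : Simplex K (q + 1)) (v : V) (hv : v ∈ s.1) : Simplex K q :=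
  ⟨s.1.erase v, by
    refine ⟨?_, ?_⟩
    · rcases (s.1.erase v).eq_empty_or_nonempty with h | h
      · exact Or.inl h
      · refine Or.inr ?_
        rcases s.2.1 with h0 | h0
        · rw [h0] at hv
          exact absurd hv (Finset.notMem_empty v)
        · exact (K.isRelLowerSet_faces h0).2 (Finset.erase_subset v s.1) h
    · have h1 := Finset.card_erase_add_one hv
      have h2 := s.2.2
      omega⟩

/-- The action of `G` on the oriented `q`-chains of `K`: the free abelian group on the simplices
`[v₀, …, v_q]`, `v₀ < … < v_q`, with `g [v₀, …, v_q] = [g v₀, …, g v_q]` and the convention that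
`[v_{π 0}, …, v_{π q}] = sgn(π) [v₀, …, v_q]`. -/
def chainRep (hK : ∀ (g : G), ∀ s ∈ K, g • s ∈ K) (q : ℤ) :
    Representation ℤ G (Simplex K q →₀ ℤ) where
  toFun g := Finsupp.linearCombination ℤ fun s =>
    Finsupp.single (s.translate hK g) (orientSign g s.1)
  map_one' := by
    ext s : 2
    have h : s.translate hK (1 : G) = s := Subtype.ext (one_smul G s.1)
    simp [orientSign_one, h]
  map_mul' g h := by
    ext s : 2
    have e : s.translate hK (g * h) = (s.translate hK h).translate hK g :=
      Subtype.ext (mul_smul g h s.1)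
    have e' : (s.translate hK h).1 = h • s.1 := rfl
    simp [orientSign_mul, e, e', mul_comm]

variable (K) in
/-- The boundary map `[v₀, …, v_{q+1}] ↦ ∑ i, (-1)^i [v₀, …, v̂_i, …, v_{q+1}]`. In the lowest
degree `q + 1 = 0` this is the augmentation. -/
def boundary (q : ℤ) : (Simplex K (q + 1) →₀ ℤ) →ₗ[ℤ] (Simplex K q →₀ ℤ) :=
  Finsupp.linearCombination ℤ fun s =>
    ∑ v : {v // v ∈ s.1}, Finsupp.single (s.face v.1 v.2) (faceSign s.1 v.1)

lemma boundary_comm (hK : ∀ (g : G), ∀ s ∈ K, g • s ∈ K) (q : ℤ) (g : G) :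
    boundary K q ∘ₗ chainRep hK (q + 1) g = chainRep hK q g ∘ₗ boundary K q := by
  ext s : 2
  simp only [LinearMap.comp_apply, Finsupp.lsingle_apply, chainRep, MonoidHom.coe_mk,
    OneHom.coe_mk, Finsupp.linearCombination_single, boundary, map_sum, one_smul,
    Finset.smul_sum, Finsupp.smul_single, smul_eq_mul]
  refine (Fintype.sum_equiv
    (Equiv.subtypeEquiv (MulAction.toPerm g) fun v =>
      (Finset.smul_mem_smul_finset_iff g).symm) _ _ fun v => ?_).symm
  have e : (s.translate hK g).face (g • v.1) ((Finset.smul_mem_smul_finset_iff g).2 v.2) =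
      (s.face v.1 v.2).translate hK g := by
    refine Subtype.ext ?_
    change (g • s.1).erase (g • v.1) = g • s.1.erase v.1
    rw [Finset.smul_finset_def, Finset.smul_finset_def,
      Finset.image_erase (MulAction.injective g)]
  change Finsupp.single _ (_ * orientSign g (s.1.erase v.1)) =
    Finsupp.single ((s.translate hK g).face (g • v.1) _) (_ * faceSign (g • s.1) (g • v.1))
  rw [e, orientSign_face g v.2]

lemma faceSign_swap {s : Finset V} {v w : V} (hv : v ∈ s) (hw : w ∈ s) (h : v ≠ w) :
    faceSign s v * faceSign (s.erase v) w = - (faceSign s w * faceSign (s.erase w) v) := by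
  have a (x y : V) (hx : x ∈ s) :
      faceSign s y = (if x < y then -1 else 1) * faceSign (s.erase x) y := by
    rw [faceSign_eq_prod, faceSign_eq_prod,
      Finset.mul_prod_erase s (fun u => if u < y then (-1 : ℤ) else 1) hx]
  rw [a w v hw, a v w hv]
  rcases lt_or_gt_of_ne h with h' | h' <;> simp only [h', h'.not_gt, if_true, if_false] <;> ring

lemma boundary_boundary (q : ℤ) : boundary K q ∘ₗ boundary K (q + 1) = 0 := by
  ext s : 2
  simp only [LinearMap.comp_apply, Finsupp.lsingle_apply, Finsupp.linearCombination_single,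
    boundary, map_sum, one_smul, Finset.smul_sum, Finsupp.smul_single, smul_eq_mul,
    LinearMap.zero_apply]
  rw [← Finset.sum_sigma' Finset.univ (fun _ => Finset.univ)
    (fun (v : {v // v ∈ s.1}) (w : {w // w ∈ (s.face v.1 v.2).1}) =>
      Finsupp.single ((s.face v.1 v.2).face w.1 w.2)
        (faceSign s.1 v.1 * faceSign (s.face v.1 v.2).1 w.1)) |>.symm]
  refine Finset.sum_involution
    (fun p _ => ⟨⟨p.2.1, Finset.mem_of_mem_erase p.2.2⟩,
      ⟨p.1.1, Finset.mem_erase.2 ⟨(Finset.ne_of_mem_erase p.2.2).symm, p.1.2⟩⟩⟩) ?_ ?_ ?_ ?_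
  · rintro ⟨v, w⟩ -
    have hw := Finset.mem_of_mem_erase w.2
    have hne := Finset.ne_of_mem_erase w.2
    have e : (s.face w.1 hw).face v.1 (Finset.mem_erase.2 ⟨hne.symm, v.2⟩) =
        (s.face v.1 v.2).face w.1 w.2 := Subtype.ext (Finset.erase_right_comm)
    change Finsupp.single _ (_ * faceSign (s.1.erase v.1) w.1) +
      Finsupp.single ((s.face w.1 hw).face v.1 _) (_ * faceSign (s.1.erase w.1) v.1) = 0
    rw [e, ← Finsupp.single_add, faceSign_swap v.2 hw hne.symm, neg_add_cancel,
      Finsupp.single_zero]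
  · rintro ⟨v, w⟩ - - h
    exact Finset.ne_of_mem_erase w.2 (congrArg (fun p => p.1.1) h)
  · intros
    exact Finset.mem_univ _
  · intros
    rfl

/-- The oriented `q`-chains of `K` as a `ℤ[G]`-module. -/
abbrev chainModule (hK : ∀ (g : G), ∀ s ∈ K, g • s ∈ K) (q : ℤ) : ModuleCat.{0} ℤ[G] :=
  ModuleCat.of ℤ[G] (chainRep hK q).asModule

/-- The boundary map as a `ℤ[G]`-linear map. -/
def boundaryHom (hK : ∀ (g : G), ∀ s ∈ K, g • s ∈ K) (q : ℤ) :
    chainModule hK (q + 1) ⟶ chainModule hK q :=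
  ModuleCat.ofHom (Representation.IntertwiningMap.equivLinearMapAsModule _ _
    { toLinearMap := boundary K q, isIntertwining' := boundary_comm hK q })

/-- The augmented oriented simplicial chain complex of `K`, as a complex of `ℤ[G]`-modules. -/
def augmentedComplex (hK : ∀ (g : G), ∀ s ∈ K, g • s ∈ K) : ChainComplex (ModuleCat.{0} ℤ[G]) ℤ :=
  ChainComplex.of (chainModule hK) (boundaryHom hK) fun q => by
    ext x
    exact LinearMap.congr_fun (boundary_boundary (K := K) q) x

/-- The reduced homology `H̃_q(K)` with integer coefficients, as a `ℤ[G]`-module. -/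
abbrev reducedHomology (hK : ∀ (g : G), ∀ s ∈ K, g • s ∈ K) (q : ℤ) : ModuleCat.{0} ℤ[G] :=
  (augmentedComplex hK).homology q

end Oriented

/-! ### The complex `Σ(a,b,m)` with its cyclic symmetry -/

/-- `n` is a sum of `a`'s and `b`'s. -/
def IsSum (a b n : ℕ) : Prop := ∃ i j : ℕ, n = a * i + b * j

lemma IsSum.add {a b k n : ℕ} (hk : IsSum a b k) (hn : IsSum a b n) : IsSum a b (k + n) := by
  obtain ⟨i, j, rfl⟩ := hk
  obtain ⟨i', j', rfl⟩ := hn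
  exact ⟨i + i', j + j', by ring⟩

lemma IsSum.zero (a b : ℕ) : IsSum a b 0 := ⟨0, 0, by simp⟩

/-- `ℓ(a,b,m)`: the number of ways to write `m = a i + b j` with `i, j > 0`. -/
def ell (a b m : ℕ) : ℕ :=
  Set.ncard {p : ℕ × ℕ | 0 < p.1 ∧ 0 < p.2 ∧ m = a * p.1 + b * p.2}

/-- The condition for `v_{r₀}, …, v_{r_e}`, `r₀ < … < r_e`, to span a simplex of `Σ(a,b,m)`: each
`r_i - r_{i-1}` as well as `r₀ + m - r_e` is a sum of `a`'s and `b`'s. -/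
def IsFace (a b m : ℕ) (s : Finset (Fin m)) : Prop :=
  s.Nonempty ∧
  (∀ u ∈ s, ∀ v ∈ s, u < v → (∀ w ∈ s, w ≤ u ∨ v ≤ w) → IsSum a b ((v : ℕ) - u)) ∧
  (∀ u ∈ s, ∀ v ∈ s, (∀ w ∈ s, u ≤ w ∧ w ≤ v) → IsSum a b (u + m - v))

lemma IsFace.sub {a b m : ℕ} {s : Finset (Fin m)} (hs : IsFace a b m s) (n : ℕ) :
    ∀ u ∈ s, ∀ v ∈ s, u ≤ v → (v : ℕ) - u ≤ n → IsSum a b ((v : ℕ) - u) := by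
  induction n with
  | zero =>
    intro u _ v _ huv h
    rw [Nat.le_zero.1 h]
    exact IsSum.zero a b
  | succ n ih =>
    intro u hu v hv huv h
    by_cases hc : ∃ w ∈ s, u < w ∧ w < v
    · obtain ⟨w, hw, h1, h2⟩ := hc
      have h1' : (u : ℕ) < w := h1
      have h2' : (w : ℕ) < v := h2
      have := (ih u hu w hw h1.le (by omega)).add (ih w hw v hv h2.le (by omega))
      convert this using 1
      omega
    · rcases huv.eq_or_lt with rfl | huv
      · rw [Nat.sub_self]
        exact IsSum.zero a b
      · refine hs.2.1 u hu v hv huv fun w hw => ?_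
        by_contra! hcon
        exact hc ⟨w, hw, hcon⟩

lemma isFace_iff {a b m : ℕ} {s : Finset (Fin m)} :
    IsFace a b m s ↔ s.Nonempty ∧ ∀ u ∈ s, ∀ v ∈ s, u ≤ v →
      IsSum a b ((v : ℕ) - u) ∧ IsSum a b (u + m - v) := by
  constructor
  · intro hs
    refine ⟨hs.1, fun u hu v hv huv => ⟨hs.sub _ u hu v hv huv le_rfl, ?_⟩⟩
    have hx := s.min'_mem hs.1
    have hy := s.max'_mem hs.1
    have hxu : s.min' hs.1 ≤ u := s.min'_le u hu
    have hvy : v ≤ s.max' hs.1 := s.le_max' v hv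
    have h := ((hs.sub _ _ hx u hu hxu le_rfl).add
      (hs.2.2 _ hx _ hy fun w hw => ⟨s.min'_le w hw, s.le_max' w hw⟩)).add
      (hs.sub _ v hv _ hy hvy le_rfl)
    have h1 : (s.min' hs.1 : ℕ) ≤ u := hxu
    have h2 : (v : ℕ) ≤ s.max' hs.1 := hvy
    have h3 := (s.max' hs.1).isLt
    have h4 : (u : ℕ) ≤ v := huv
    convert h using 1
    omega
  · rintro ⟨h0, h⟩
    exact ⟨h0, fun u hu v hv huv _ => (h u hu v hv huv.le).1,
      fun u hu v hv huv => (h u hu v hv (huv u hu).2).2⟩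

/-- The simplicial complex `Σ(a,b,m) ⊆ Δ^{m-1}`; the vertices of `Δ^{m-1}` are `0, …, m-1`. -/
def SigmaComplex (a b m : ℕ) : PreAbstractSimplicialComplex (Fin m) where
  faces := {s | IsFace a b m s}
  isRelLowerSet_faces := fun _ hs => ⟨hs.1, fun _ ht h0 =>
    isFace_iff.2 ⟨h0, fun u hu v hv => (isFace_iff.1 hs).2 u (ht hu) v (ht hv)⟩⟩

/-- The cyclic group `C_m` of order `m`. -/
abbrev Cyc (m : ℕ) : Type := Multiplicative (ZMod m)

/-- `C_m` acts on the vertices by rotation: the class of `k` sends `v_r` to `v_{r+k}`, with indices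
modulo `m`. -/
instance rotation (m : ℕ) [NeZero m] : MulAction (Cyc m) (Fin m) where
  smul g r := ⟨(g.toAdd + ((r : ℕ) : ZMod m)).val, ZMod.val_lt _⟩
  one_smul r := Fin.ext (by
    change ((0 : ZMod m) + ((r : ℕ) : ZMod m)).val = r
    rw [zero_add, ZMod.val_natCast_of_lt r.isLt])
  mul_smul g h r := Fin.ext (by
    change ((g.toAdd + h.toAdd) + ((r : ℕ) : ZMod m)).val =
      (g.toAdd + (((h.toAdd + ((r : ℕ) : ZMod m)).val : ℕ) : ZMod m)).val
    rw [ZMod.natCast_zmod_val, add_assoc])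

lemma rotation_val {m : ℕ} [NeZero m] (g : Cyc m) (r : Fin m) :
    ((g • r : Fin m) : ℕ) = (g.toAdd.val + r) % m := by
  change (g.toAdd + ((r : ℕ) : ZMod m)).val = _
  rw [ZMod.val_add, ZMod.val_natCast_of_lt r.isLt]

lemma SigmaComplex_invariant (a b m : ℕ) [NeZero m] (g : Cyc m) (s : Finset (Fin m))
    (hs : s ∈ SigmaComplex a b m) : g • s ∈ SigmaComplex a b m := by
  have hs' : IsFace a b m s := hs
  rw [isFace_iff] at hs'
  change IsFace a b m (g • s)
  rw [isFace_iff]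
  refine ⟨hs'.1.smul_finset, fun u' hu v' hv huv => ?_⟩
  obtain ⟨u, hu₀, rfl⟩ := Finset.mem_smul_finset.1 hu
  obtain ⟨v, hv₀, rfl⟩ := Finset.mem_smul_finset.1 hv
  have huv' : ((g • u : Fin m) : ℕ) ≤ (g • v : Fin m) := huv
  have hk := ZMod.val_lt g.toAdd
  have hul := u.isLt
  have hvl := v.isLt
  have hmod : ∀ x : ℕ, x < m → (g.toAdd.val + x) % m = g.toAdd.val + x ∧ g.toAdd.val + x < m ∨
      (g.toAdd.val + x) % m + m = g.toAdd.val + x := by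
    intro x hx
    rcases lt_or_ge (g.toAdd.val + x) m with h | h
    · exact Or.inl ⟨Nat.mod_eq_of_lt h, h⟩
    · refine Or.inr ?_
      rw [Nat.mod_eq_sub_mod h, Nat.mod_eq_of_lt (by omega)]
      omega
  rw [rotation_val, rotation_val] at huv' ⊢
  have h1 := hmod u hul
  have h2 := hmod v hvl
  have hlt := Nat.mod_lt (g.toAdd.val + v) (NeZero.pos m)
  rcases le_total u v with h | h
  · have h' : (u : ℕ) ≤ v := h
    obtain ⟨h3, h4⟩ := hs'.2 u hu₀ v hv₀ h
    rcases eq_or_lt_of_le h' with he | hl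
    · rw [he] at h4 ⊢
      refine ⟨by rw [Nat.sub_self]; exact IsSum.zero a b, ?_⟩
      convert h4 using 1
      omega
    · constructor
      · convert h3 using 1
        omega
      · convert h4 using 1
        omega
  · have h' : (v : ℕ) ≤ u := h
    obtain ⟨h3, h4⟩ := hs'.2 v hv₀ u hu₀ h
    rcases eq_or_lt_of_le h' with he | hl
    · rw [he] at h4 ⊢
      refine ⟨by rw [Nat.sub_self]; exact IsSum.zero a b, ?_⟩
      convert h4 using 1
      omega
    · constructor
      · convert h4 using 1
        omega
      · convert h3 using 1
        omega

/-- `H̃_q(Σ(a,b,m))` as a `ℤ[C_m]`-module. -/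
abbrev homologySigma (a b m : ℕ) [NeZero m] (q : ℤ) : ModuleCat.{0} ℤ[Cyc m] :=
  reducedHomology (SigmaComplex_invariant a b m) q

/-! ### Permutation modules and their kernels -/

section Permutation

variable {G : Type} [Group G]

/-- The permutation module `ℤ[G/H]`. -/
abbrev PermModule (H : Subgroup G) : Type := (Representation.ofMulAction ℤ G (G ⧸ H)).asModule

/-- The canonical `ℤ[G]`-linear map `ℤ[G/H] → ℤ[G/L]`, `gH ↦ gL`, for `H ≤ L`. -/
def permMap {H L : Subgroup G} (h : H ≤ L) : PermModule H →ₗ[ℤ[G]] PermModule L :=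
  Representation.IntertwiningMap.equivLinearMapAsModule _ _
    { toLinearMap := MonoidAlgebra.mapDomainLinearMap ℤ ℤ (Subgroup.quotientMapOfLE h)
      isIntertwining' := fun g => by
        ext x : 3
        induction x using QuotientGroup.induction_on
        simp [Representation.ofMulAction_single, MonoidAlgebra.mapDomainLinearMap] }

lemma permMap_permMap {H L M : Subgroup G} (h : H ≤ L) (h' : L ≤ M) (x : PermModule H) :
    permMap h' (permMap h x) = permMap (h.trans h') x := by
  change MonoidAlgebra.mapDomain _ (MonoidAlgebra.mapDomain _ (show ℤ[G ⧸ H] from x)) =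
    MonoidAlgebra.mapDomain _ (show ℤ[G ⧸ H] from x)
  unfold MonoidAlgebra.mapDomain
  rw [← Finsupp.mapDomain_comp]
  congr 2
  funext y
  induction y using QuotientGroup.induction_on
  rfl

/-- The iterated kernel of the commutative square
`ℤ[G/H] → ℤ[G/L₁]`, `ℤ[G/H] → ℤ[G/L₂]`, `ℤ[G/L₁] → ℤ[G/M]`, `ℤ[G/L₂] → ℤ[G/M]`:
the kernel of the map `ker(ℤ[G/H] → ℤ[G/L₁]) → ker(ℤ[G/L₂] → ℤ[G/M])` that the square induces. -/
def iteratedKernel {H L₁ L₂ M : Subgroup G} (h₁ : H ≤ L₁) (h₂ : H ≤ L₂) (h₁' : L₁ ≤ M)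
    (h₂' : L₂ ≤ M) : Submodule ℤ[G] (LinearMap.ker (permMap h₁)) :=
  LinearMap.ker ((permMap h₂).restrict (p := LinearMap.ker (permMap h₁))
    (q := LinearMap.ker (permMap h₂')) fun x hx => by
      rw [LinearMap.mem_ker] at hx ⊢
      rw [permMap_permMap, ← permMap_permMap h₁ h₁', hx, map_zero])

end Permutation

/-- The subgroup `C_n ⊆ C_m` for `n ∣ m`: the elements `g` with `g ^ n = 1`. -/
def cyc (m n : ℕ) : Subgroup (Cyc m) := (powMonoidHom n).ker

lemma mem_cyc {m n : ℕ} {g : Cyc m} : g ∈ cyc m n ↔ g ^ n = 1 := Iff.rfl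

lemma cyc_le (m : ℕ) {k n : ℕ} (h : k ∣ n) : cyc m k ≤ cyc m n := fun g hg => by
  obtain ⟨c, rfl⟩ := h
  rw [mem_cyc] at hg ⊢
  rw [pow_mul, hg, one_pow]

/-- For `n ∣ m` the subgroup `cyc m n` indeed has order `n`. -/
lemma card_cyc (m : ℕ) [NeZero m] {n : ℕ} (h : n ∣ m) : Nat.card (cyc m n) = n := by
  have h1 := IsCyclic.card_powMonoidHom_ker (G := Cyc m) n
  have h2 : Nat.card (Cyc m) = m := Nat.card_zmod m
  rw [h2, Nat.gcd_eq_right h] at h1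
  exact h1

lemma div_mul_dvd_div_left {a b m : ℕ} (hab : a.Coprime b) (ha : a ∣ m) (hb : b ∣ m) :
    m / (a * b) ∣ m / a := by
  rw [← Nat.div_div_eq_div_mul]
  exact Nat.div_dvd_of_dvd (Nat.Coprime.dvd_of_dvd_mul_left hab.symm
    (by rwa [Nat.mul_div_cancel' ha]))

lemma div_mul_dvd_div_right {a b m : ℕ} (hab : a.Coprime b) (ha : a ∣ m) (hb : b ∣ m) :
    m / (a * b) ∣ m / b := by
  rw [mul_comm a b]
  exact div_mul_dvd_div_left hab.symm hb ha

/-- The kernel of `ℤ[C_m/C_{m/d}] → ℤ[C_m/C_m]`, for `d ∣ m`. -/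
abbrev permKernel {d m : ℕ} (hd : d ∣ m) :
    Submodule ℤ[Cyc m] (PermModule (cyc m (m / d))) :=
  LinearMap.ker (permMap (cyc_le m (Nat.div_dvd_of_dvd hd) : cyc m (m / d) ≤ cyc m m))

/-- The iterated kernel of the square with top row `ℤ[C_m/C_{m/ab}] → ℤ[C_m/C_{m/a}]` and bottom
row `ℤ[C_m/C_{m/b}] → ℤ[C_m/C_m]`, for coprime divisors `a` and `b` of `m`. -/
abbrev squareKernel {a b m : ℕ} (hab : a.Coprime b) (ha : a ∣ m) (hb : b ∣ m) :=
  iteratedKernel (cyc_le m (div_mul_dvd_div_left hab ha hb))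
    (cyc_le m (div_mul_dvd_div_right hab ha hb))
    (cyc_le m (Nat.div_dvd_of_dvd ha) : cyc m (m / a) ≤ cyc m m)
    (cyc_le m (Nat.div_dvd_of_dvd hb) : cyc m (m / b) ≤ cyc m m)

end CuspHomology

end

/-!
Order the integers by letting `x` lie below `y` if `y - x` is a sum of `a`'s and `b`'s. The finite
sets of integers that are contained in some interval `[x, x + m]` and that are chains for this order
form a simplicial complex, the cover (`coverFaces`); its simplices between `0` and `m - 1` are those
of `Σ(a,b,m)`. In the cover, a highest vertex `v ≥ m` is dominated by `v - m` and a lowest vertex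
`v < 0` is dominated by `v + m`, so that `Σ(a,b,m)` and the cover have the same homology
(`exists_push`), and rotating a cycle of `Σ(a,b,m)` amounts to translating it in the cover
(`exists_rotation`).

The cover is the part over the intervals of length `m` of the order complex of `ℤ`, which is
filtered by the intervals. A much smaller complex with such a filtration is the Koszul-Tate
resolution of `ℤ` over the ring of the semigroup generated by `a` and `b` (`koszulComplex`): its
cells are `γ_k`, `γ_k dx`, `γ_k dy`, `γ_k dx dy`, and they occupy intervals of lengths `k a b`,
`k a b + a`, `k a b + b` and `k a b + a + b`. The subcomplexes over single intervals are acyclic in both cases,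
so acyclic carriers provide filtered chain maps that are inverse to each other and commute with the
translations, up to filtered homotopies. Therefore both complexes have the same homology over the
intervals of length `m` (`hasTopHomology_coverChains`).

The cells of the small complex that fit into an interval of length `m` have degrees bounded in terms
of `ℓ(a,b,m)`. By the coprimality of geometric sums in `ℤ[T, T⁻¹]` the small complex is exact except
at its upper end, where the homology is `ℤ[T, T⁻¹]` modulo one element `θ`, namely `T - 1`,
`(T ^ a - 1) / (T - 1)`, `(T ^ b - 1) / (T - 1)` or
`(T ^ (a b) - 1) (T - 1) / ((T ^ a - 1) (T ^ b - 1))` (`KCell.isTopHomology_neither`,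
`KCell.isTopHomology_left`, `KCell.isTopHomology_right`, `KCell.isTopHomology_both`). On the other
hand `ℤ[C_m/C_{m/n}]` is `ℤ[T, T⁻¹]` modulo `T ^ n - 1`, so that the kernels of the statement are
principal as well, with the same annihilators `θ` (`isQuotientBy_permKernel`,
`isQuotientBy_squareKernel`).
-/

noncomputable section

namespace CuspHomology

/-! ### Simplicial chains on all finite sets of vertices -/

section Finset

variable {V : Type} [LinearOrder V]

/-- To show that a linear map sends the chains supported on `S` into a submodule, it suffices to
look at the basis elements in `S`. -/
lemma map_mem_of_single {I M : Type} [AddCommGroup M] {S : Set I} {N : Submodule ℤ M}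
    (f : (I →₀ ℤ) →ₗ[ℤ] M) (h : ∀ i ∈ S, f (Finsupp.single i 1) ∈ N)
    {x : I →₀ ℤ} (hx : x ∈ Finsupp.supported ℤ ℤ S) : f x ∈ N := by
  rw [Finsupp.supported_eq_span_single] at hx
  induction hx using Submodule.span_induction with
  | mem x hx => obtain ⟨i, hi, rfl⟩ := hx; exact h i hi
  | zero => simp
  | add x y _ _ hx hy => rw [map_add]; exact N.add_mem hx hy
  | smul r x _ hx => rw [map_smul]; exact N.smul_mem r hx

/-- Two linear maps that agree on the basis elements in `S` agree on the chains supported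
on `S`. -/
lemma map_eq_of_single {I M : Type} [AddCommGroup M] {S : Set I}
    (f g : (I →₀ ℤ) →ₗ[ℤ] M) (h : ∀ i ∈ S, f (Finsupp.single i 1) = g (Finsupp.single i 1))
    {x : I →₀ ℤ} (hx : x ∈ Finsupp.supported ℤ ℤ S) : f x = g x := by
  have := map_mem_of_single (N := ⊥) (f - g) (S := S)
    (fun i hi => by simp [h i hi]) hx
  simpa [sub_eq_zero] using this

/-- The simplicial boundary on the free abelian group on all finite subsets of `V`; the boundary
of a vertex is the empty simplex. -/
def finsetBoundary : (Finset V →₀ ℤ) →ₗ[ℤ] (Finset V →₀ ℤ) :=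
  Finsupp.linearCombination ℤ fun s => ∑ v ∈ s, Finsupp.single (s.erase v) (faceSign s v)

lemma finsetBoundary_single (s : Finset V) (r : ℤ) :
    finsetBoundary (Finsupp.single s r) =
      r • ∑ v ∈ s, Finsupp.single (s.erase v) (faceSign s v) := by
  simp [finsetBoundary]

lemma finsetBoundary_mem {S S' : Set (Finset V)} (h : ∀ s ∈ S, ∀ v ∈ s, s.erase v ∈ S')
    {x : Finset V →₀ ℤ} (hx : x ∈ Finsupp.supported ℤ ℤ S) :
    finsetBoundary x ∈ Finsupp.supported ℤ ℤ S' := by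
  refine map_mem_of_single _ (fun s hs => ?_) hx
  rw [finsetBoundary_single, one_smul]
  exact Submodule.sum_mem _ fun v hv => Finsupp.single_mem_supported ℤ _ (h s hs v hv)

lemma finsetBoundary_finsetBoundary (x : Finset V →₀ ℤ) :
    finsetBoundary (finsetBoundary x) = 0 := by
  suffices h : finsetBoundary ∘ₗ finsetBoundary = (0 : (Finset V →₀ ℤ) →ₗ[ℤ] _) from
    LinearMap.congr_fun h x
  ext s : 2
  simp only [LinearMap.comp_apply, Finsupp.lsingle_apply, finsetBoundary_single, one_smul,
    map_sum, LinearMap.zero_apply, Finset.smul_sum, Finsupp.smul_single, smul_eq_mul]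
  rw [Finset.sum_sigma']
  refine Finset.sum_involution (fun p _ => ⟨p.2, p.1⟩) ?_ ?_ ?_ ?_
  · rintro ⟨v, w⟩ h
    simp only [Finset.mem_sigma, Finset.mem_erase] at h
    simp only
    rw [Finset.erase_right_comm, ← Finsupp.single_add, faceSign_swap h.1 h.2.2 h.2.1.symm,
      neg_add_cancel, Finsupp.single_zero]
  · rintro ⟨v, w⟩ h - e
    simp only [Finset.mem_sigma, Finset.mem_erase] at h
    exact h.2.1 (congrArg (fun p => p.1) e)
  · rintro ⟨v, w⟩ h
    simp only [Finset.mem_sigma, Finset.mem_erase] at h ⊢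
    exact ⟨h.2.2, h.2.1.symm, h.1⟩
  · intros
    rfl

/-- The cone operator with apex `w`: it sends a simplex `s` to the join `w * s`, which is `0` if `w`
already is a vertex of `s`. -/
def coneOp (w : V) : (Finset V →₀ ℤ) →ₗ[ℤ] (Finset V →₀ ℤ) :=
  Finsupp.linearCombination ℤ fun s =>
    if w ∈ s then 0 else Finsupp.single (insert w s) (faceSign s w)

lemma coneOp_single_of_mem {w : V} {s : Finset V} (h : w ∈ s) (r : ℤ) :
    coneOp w (Finsupp.single s r) = 0 := by
  simp [coneOp, h]

lemma coneOp_single_of_notMem {w : V} {s : Finset V} (h : w ∉ s) (r : ℤ) :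
    coneOp w (Finsupp.single s r) = Finsupp.single (insert w s) (r * faceSign s w) := by
  simp [coneOp, h]

lemma coneOp_mem {w : V} {S S' : Set (Finset V)} (h : ∀ s ∈ S, w ∉ s → insert w s ∈ S')
    {x : Finset V →₀ ℤ} (hx : x ∈ Finsupp.supported ℤ ℤ S) :
    coneOp w x ∈ Finsupp.supported ℤ ℤ S' := by
  refine map_mem_of_single _ (fun s hs => ?_) hx
  by_cases hw : w ∈ s
  · rw [coneOp_single_of_mem hw]
    exact Submodule.zero_mem _
  · rw [coneOp_single_of_notMem hw]
    exact Finsupp.single_mem_supported ℤ _ (h s hs hw)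

lemma faceSign_insert_self (s : Finset V) (w : V) : faceSign (insert w s) w = faceSign s w := by
  rw [← faceSign_erase (insert w s) w, Finset.erase_insert_eq_erase, faceSign_erase]

/-- The cone operator is a contraction of the chains on all finite sets. -/
lemma finsetBoundary_coneOp (w : V) (x : Finset V →₀ ℤ) :
    finsetBoundary (coneOp w x) + coneOp w (finsetBoundary x) = x := by
  suffices h : finsetBoundary ∘ₗ coneOp w + coneOp w ∘ₗ finsetBoundary =
      (LinearMap.id : (Finset V →₀ ℤ) →ₗ[ℤ] _) from LinearMap.congr_fun h x
  ext s : 2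
  simp only [LinearMap.add_apply, LinearMap.comp_apply, Finsupp.lsingle_apply, LinearMap.id_apply,
    finsetBoundary_single, one_smul, map_sum]
  by_cases hw : w ∈ s
  · rw [coneOp_single_of_mem hw, map_zero, zero_add, Finset.sum_eq_single w]
    · rw [coneOp_single_of_notMem (Finset.notMem_erase w s), Finset.insert_erase hw,
        faceSign_erase, faceSign_sq]
    · intro v _ hvw
      exact coneOp_single_of_mem (Finset.mem_erase.2 ⟨hvw.symm, hw⟩) _
    · exact fun h => absurd hw h
  · rw [coneOp_single_of_notMem hw, finsetBoundary_single, Finset.sum_insert hw,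
      Finset.erase_insert hw, smul_add, add_assoc, one_mul, faceSign_insert_self,
      Finsupp.smul_single, smul_eq_mul, faceSign_sq, Finset.smul_sum, ← Finset.sum_add_distrib,
      Finset.sum_eq_zero, add_zero]
    intro v hv
    have hvw : v ≠ w := fun h => hw (h ▸ hv)
    have hw' : w ∉ s.erase v := fun h => hw (Finset.mem_of_mem_erase h)
    rw [coneOp_single_of_notMem hw', Finset.erase_insert_of_ne hvw.symm, Finsupp.smul_single,
      smul_eq_mul, ← Finsupp.single_add]
    have h := faceSign_swap (Finset.mem_insert_of_mem hv) (Finset.mem_insert_self w s) hvw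
    rw [Finset.erase_insert_of_ne hvw.symm, Finset.erase_insert hw, faceSign_insert_self,
      faceSign_insert_self] at h
    have h1 := faceSign_sq s w
    have h2 := faceSign_sq (s.erase v) w
    have : faceSign s w * faceSign (insert w s) v + faceSign s v * faceSign (s.erase v) w = 0 := by
      linear_combination (faceSign s w * faceSign (s.erase v) w) * h -
        (faceSign s w * faceSign (insert w s) v) * h2 -
        (faceSign (s.erase v) w * faceSign s v) * h1
    rw [this, Finsupp.single_zero]

/-- The part of a chain that consists of the simplices with vertex `v`. -/
abbrev vertexPart (v : V) (x : Finset V →₀ ℤ) : Finset V →₀ ℤ := x.filter (v ∈ ·)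

lemma vertexPart_mem {v : V} {S : Set (Finset V)} {x : Finset V →₀ ℤ}
    (hx : x ∈ Finsupp.supported ℤ ℤ S) :
    vertexPart v x ∈ Finsupp.supported ℤ ℤ {s ∈ S | v ∈ s} := by
  rw [Finsupp.mem_supported] at hx ⊢
  intro s hs
  simp only [Finset.mem_coe, Finsupp.support_filter, Finset.mem_filter] at hs
  exact ⟨hx hs.1, hs.2⟩

lemma sub_vertexPart_mem {v : V} {S : Set (Finset V)} {x : Finset V →₀ ℤ}
    (hx : x ∈ Finsupp.supported ℤ ℤ S) :
    x - vertexPart v x ∈ Finsupp.supported ℤ ℤ {s ∈ S | v ∉ s} := by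
  have : x - vertexPart v x = x.filter (v ∉ ·) := by
    rw [sub_eq_iff_eq_add', Finsupp.filter_add_filter_not]
  rw [this, Finsupp.mem_supported]
  rw [Finsupp.mem_supported] at hx
  intro s hs
  simp only [Finset.mem_coe, Finsupp.support_filter, Finset.mem_filter] at hs
  exact ⟨hx hs.1, hs.2⟩

lemma finsetBoundary_vertexPart_mem {v : V} {x : Finset V →₀ ℤ}
    (hd : finsetBoundary x ∈ Finsupp.supported ℤ ℤ {s : Finset V | v ∉ s}) :
    finsetBoundary (vertexPart v x) ∈ Finsupp.supported ℤ ℤ {s : Finset V | v ∉ s} := by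
  have h : finsetBoundary (vertexPart v x) =
      finsetBoundary x - finsetBoundary (x - vertexPart v x) := by
    rw [map_sub, sub_sub_cancel]
  rw [h]
  refine Submodule.sub_mem _ hd (finsetBoundary_mem (S := {s | v ∉ s}) ?_ ?_)
  · exact fun s hs u _ h => hs (Finset.mem_of_mem_erase h)
  · exact Finsupp.supported_mono (fun s hs => hs.2) (sub_vertexPart_mem (S := Set.univ) (by simp))

/-- Subtracting the boundary of the cone over the part of a chain that contains `v`. -/
lemma sub_finsetBoundary_coneOp (v w : V) (x : Finset V →₀ ℤ) :
    x - finsetBoundary (coneOp w (vertexPart v x)) =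
      (x - vertexPart v x) + coneOp w (finsetBoundary (vertexPart v x)) := by
  have h := finsetBoundary_coneOp w (vertexPart v x)
  rw [← eq_sub_iff_add_eq] at h
  rw [h]
  abel

/-- If the vertex `w` dominates `v` in the family `S`, then every chain on `S` whose boundary avoids
`v` can be changed by a boundary so as to avoid `v`. -/
lemma sub_finsetBoundary_coneOp_mem {v w : V} (hvw : v ≠ w) {S : Set (Finset V)}
    (hS : ∀ s ∈ S, ∀ u ∈ s, s.erase u ∈ S) (hdom : ∀ s ∈ S, v ∈ s → insert w s ∈ S)
    {x : Finset V →₀ ℤ} (hx : x ∈ Finsupp.supported ℤ ℤ S)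
    (hd : finsetBoundary x ∈ Finsupp.supported ℤ ℤ {s : Finset V | v ∉ s}) :
    x - finsetBoundary (coneOp w (vertexPart v x)) ∈ Finsupp.supported ℤ ℤ {s ∈ S | v ∉ s} := by
  rw [sub_finsetBoundary_coneOp]
  refine Submodule.add_mem _ (sub_vertexPart_mem hx) ?_
  have h1 : finsetBoundary (vertexPart v x) ∈
      Finsupp.supported ℤ ℤ {s : Finset V | w ∉ s → insert w s ∈ S} := by
    refine finsetBoundary_mem (S := {s ∈ S | v ∈ s}) ?_ (vertexPart_mem hx)
    intro s hs u hu hw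
    have hw' : insert w (s.erase u) ∈ S := by
      rcases eq_or_ne u w with rfl | huw
      · rw [Finset.insert_erase hu]
        exact hs.1
      · rw [← Finset.erase_insert_of_ne huw.symm]
        exact hS _ (hdom s hs.1 hs.2) u (Finset.mem_insert_of_mem hu)
    exact hw'
  have h2 := finsetBoundary_vertexPart_mem hd
  have h3 : finsetBoundary (vertexPart v x) ∈ Finsupp.supported ℤ ℤ
      ({s : Finset V | w ∉ s → insert w s ∈ S} ∩ {s : Finset V | v ∉ s}) := by
    rw [Finsupp.mem_supported] at h1 h2 ⊢
    exact Set.subset_inter h1 h2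
  refine coneOp_mem (S' := {s ∈ S | v ∉ s}) (fun s hs hw => ⟨hs.1 hw, ?_⟩) h3
  rw [Finset.mem_insert, not_or]
  exact ⟨hvw, hs.2⟩

end Finset

/-! ### Acyclic carriers -/

section Carrier

/-- A linear map out of a graded free module can be built one basis element at a time, by induction
on the degree: if the condition on the value at `c` only involves the value on `d c`, it suffices
that it can be satisfied. -/
lemma exists_linearMap_of_degree {I M : Type} [AddCommGroup M] (deg : I → ℕ)
    (d : (I →₀ ℤ) →ₗ[ℤ] (I →₀ ℤ))
    (hd : ∀ c, d (Finsupp.single c 1) ∈ Finsupp.supported ℤ ℤ {c' | deg c' + 1 = deg c})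
    (P : I → M → M → Prop) :
    ∃ F : (I →₀ ℤ) →ₗ[ℤ] M, ∀ c, (∃ y, P c (F (d (Finsupp.single c 1))) y) →
      P c (F (d (Finsupp.single c 1))) (F (Finsupp.single c 1)) := by
  classical
  let pick : I → M → M := fun c z => if h : ∃ y, P c z y then h.choose else 0
  let step : ∀ c : I, (∀ c' : I, deg c' < deg c → M) → M := fun c f =>
    pick c (∑ c' ∈ (d (Finsupp.single c 1)).support.attach,
      d (Finsupp.single c 1) c' • f c' (by
        have h1 := (Finsupp.mem_supported ℤ _).1 (hd c) c'.2
        have h2 : deg c' + 1 = deg c := h1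
        omega))
  let wf : WellFounded fun c' c : I => deg c' < deg c := InvImage.wf deg Nat.lt_wfRel.wf
  let F0 : I → M := wf.fix step
  let F : (I →₀ ℤ) →ₗ[ℤ] M := Finsupp.linearCombination ℤ F0
  have hF : ∀ c, F (Finsupp.single c 1) = pick c (F (d (Finsupp.single c 1))) := by
    intro c
    have h1 : F (Finsupp.single c 1) = F0 c := by simp [F]
    have h2 : F (d (Finsupp.single c 1)) = ∑ c' ∈ (d (Finsupp.single c 1)).support.attach,
        d (Finsupp.single c 1) c' • F0 c' := by
      rw [Finset.sum_attach _ (fun c' => d (Finsupp.single c 1) c' • F0 c')]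
      rfl
    rw [h1, h2]
    exact wf.fix_eq step c
  refine ⟨F, fun c hc => ?_⟩
  rw [hF c]
  have : pick c (F (d (Finsupp.single c 1))) = hc.choose := dif_pos hc
  rw [this]
  exact hc.choose_spec

/-- An augmented complex of free abelian groups with a basis of cells, which is filtered by a
preorder `Λ` through acyclic subcomplexes: `inside l` are the cells that lie in `l`, and each cell
that lies in some `l` lies in a smallest one. The degree of a cell is its dimension plus one, so
that the unique cell of degree `0` generates the augmentation. -/
structure CellComplex (Λ : Type) [Preorder Λ] where
  /-- The cells, including an empty one. -/
  Cell : Type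
  /-- The dimension of a cell, plus one. -/
  deg : Cell → ℕ
  /-- The boundary map. -/
  d : (Cell →₀ ℤ) →ₗ[ℤ] (Cell →₀ ℤ)
  /-- The cells that lie in a given element of `Λ`. -/
  inside : Λ → Set Cell
  /-- The empty cell. -/
  empty : Cell
  d_deg : ∀ c, d (Finsupp.single c 1) ∈ Finsupp.supported ℤ ℤ {c' | deg c' + 1 = deg c}
  d_inside : ∀ l, ∀ c ∈ inside l, d (Finsupp.single c 1) ∈ Finsupp.supported ℤ ℤ (inside l)
  d_d : ∀ x, d (d x) = 0
  deg_empty : deg empty = 0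
  empty_inside : ∀ l, empty ∈ inside l
  eq_empty : ∀ l, ∀ c ∈ inside l, deg c = 0 → c = empty
  inside_mono : ∀ {l l'}, l ≤ l' → inside l ⊆ inside l'
  hull : ∀ l, ∀ c ∈ inside l, deg c ≠ 0 → ∃ l', c ∈ inside l' ∧ ∀ l'', c ∈ inside l'' → l' ≤ l''
  exact : ∀ l, ∀ x ∈ Finsupp.supported ℤ ℤ (inside l), d x = 0 →
    ∃ y ∈ Finsupp.supported ℤ ℤ (inside l), d y = x

namespace CellComplex

variable {Λ : Type} [Preorder Λ]

/-- The chains of degree `n` on the cells that lie in some element of the set `A`. -/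
def chains (X : CellComplex Λ) (A : Set Λ) (n : ℕ) : Submodule ℤ (X.Cell →₀ ℤ) :=
  Finsupp.supported ℤ ℤ {c | (∃ l ∈ A, c ∈ X.inside l) ∧ X.deg c = n}

variable {X Y : CellComplex Λ}

lemma chains_mono {A B : Set Λ} (h : A ⊆ B) (n : ℕ) : X.chains A n ≤ X.chains B n :=
  Finsupp.supported_mono fun _ hc => ⟨hc.1.imp fun _ hl => ⟨h hl.1, hl.2⟩, hc.2⟩

lemma chains_le {l l' : Λ} (h : l ≤ l') (n : ℕ) : X.chains {l} n ≤ X.chains {l'} n :=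
  Finsupp.supported_mono fun c hc => by
    obtain ⟨⟨_, rfl, hc⟩, hn⟩ := hc
    exact ⟨⟨l', rfl, X.inside_mono h hc⟩, hn⟩

lemma single_mem_chains {l : Λ} {c : X.Cell} (h : c ∈ X.inside l) :
    Finsupp.single c 1 ∈ X.chains {l} (X.deg c) :=
  Finsupp.single_mem_supported ℤ _ ⟨⟨l, rfl, h⟩, rfl⟩

lemma d_mem_chains {A : Set Λ} {n : ℕ} {x : X.Cell →₀ ℤ} (hx : x ∈ X.chains A (n + 1)) :
    X.d x ∈ X.chains A n := by
  refine map_mem_of_single _ (fun c hc => ?_) hx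
  obtain ⟨⟨l, hl, hc⟩, hn⟩ := hc
  have h1 := X.d_deg c
  have h2 := X.d_inside l c hc
  rw [Finsupp.mem_supported] at h1 h2
  unfold chains
  rw [Finsupp.mem_supported]
  intro c' hc'
  have h3 : X.deg c' + 1 = X.deg c := h1 hc'
  exact ⟨⟨l, hl, h2 hc'⟩, by omega⟩

lemma d_filter (x : X.Cell →₀ ℤ) (n : ℕ) :
    X.d (x.filter fun c => X.deg c = n + 1) = (X.d x).filter fun c => X.deg c = n := by
  induction x using Finsupp.induction_linear with
  | zero => rw [map_zero, Finsupp.filter_zero, Finsupp.filter_zero, map_zero]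
  | add x y hx hy => rw [Finsupp.filter_add, map_add, hx, hy, map_add, Finsupp.filter_add]
  | single c r =>
    have hr : Finsupp.single c r = r • Finsupp.single c (1 : ℤ) := by simp
    have h1 := (Finsupp.mem_supported ℤ _).1 (X.d_deg c)
    rw [hr, map_smul, Finsupp.filter_smul, Finsupp.filter_smul, map_smul]
    congr 1
    by_cases h : X.deg c = n + 1
    · rw [Finsupp.filter_single_of_pos (fun c => X.deg c = n + 1) h, eq_comm,
        Finsupp.filter_eq_self_iff]
      intro c' hc'
      have h3 : X.deg c' + 1 = X.deg c := h1 (Finsupp.mem_support_iff.2 hc')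
      omega
    · rw [Finsupp.filter_single_of_neg (fun c => X.deg c = n + 1) h, map_zero, eq_comm,
        Finsupp.filter_eq_zero_iff]
      intro c' hc'
      by_contra hne
      have h3 : X.deg c' + 1 = X.deg c := h1 (Finsupp.mem_support_iff.2 hne)
      omega

lemma exact_chains {l : Λ} {n : ℕ} {x : X.Cell →₀ ℤ} (hx : x ∈ X.chains {l} n) (h : X.d x = 0) :
    ∃ y ∈ X.chains {l} (n + 1), X.d y = x := by
  have hx' := (Finsupp.mem_supported ℤ _).1 hx
  obtain ⟨y, hy, hyx⟩ := X.exact l x (Finsupp.supported_mono (fun c hc => by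
    obtain ⟨⟨_, rfl, hc⟩, hn⟩ := hc
    exact hc) hx) h
  refine ⟨y.filter fun c => X.deg c = n + 1, ?_, ?_⟩
  · unfold chains
    rw [Finsupp.mem_supported]
    intro c hc
    simp only [Finset.mem_coe, Finsupp.support_filter, Finset.mem_filter] at hc
    exact ⟨⟨l, rfl, (Finsupp.mem_supported ℤ _).1 hy hc.1⟩, hc.2⟩
  · rw [d_filter, hyx, Finsupp.filter_eq_self_iff]
    exact fun c hc => (hx' (Finsupp.mem_support_iff.2 hc)).2

/-- A linear map respects the filtration, and raises degrees by `s`. -/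
def Carried (X Y : CellComplex Λ) (s : ℕ) (f : (X.Cell →₀ ℤ) →ₗ[ℤ] (Y.Cell →₀ ℤ)) : Prop :=
  ∀ n l, ∀ x ∈ X.chains {l} n, f x ∈ Y.chains {l} (n + s)

lemma Carried.mem {s : ℕ} {f : (X.Cell →₀ ℤ) →ₗ[ℤ] (Y.Cell →₀ ℤ)} (hf : Carried X Y s f)
    {A : Set Λ} {n : ℕ} {x : X.Cell →₀ ℤ} (hx : x ∈ X.chains A n) : f x ∈ Y.chains A (n + s) := by
  refine map_mem_of_single _ (fun c hc => ?_) hx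
  obtain ⟨⟨l, hl, hc⟩, rfl⟩ := hc
  exact chains_mono (Set.singleton_subset_iff.2 hl) _ (hf _ l _ (single_mem_chains hc))

lemma carried_of_single {s : ℕ} {f : (X.Cell →₀ ℤ) →ₗ[ℤ] (Y.Cell →₀ ℤ)}
    (h : ∀ l, ∀ c ∈ X.inside l, f (Finsupp.single c 1) ∈ Y.chains {l} (X.deg c + s)) :
    Carried X Y s f := by
  intro n l x hx
  refine map_mem_of_single _ (fun c hc => ?_) hx
  obtain ⟨⟨_, rfl, hc⟩, rfl⟩ := hc
  exact h _ c hc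

/-- A linear map commutes with the boundary maps on all cells that lie in an element of `Λ`. -/
def IsChainMap (X Y : CellComplex Λ) (f : (X.Cell →₀ ℤ) →ₗ[ℤ] (Y.Cell →₀ ℤ)) : Prop :=
  ∀ A n, ∀ x ∈ X.chains A n, Y.d (f x) = f (X.d x)

lemma d_single_empty : X.d (Finsupp.single X.empty 1) = 0 := by
  have h := X.d_deg X.empty
  have e : {c' | X.deg c' + 1 = X.deg X.empty} = ∅ := by
    ext c
    simp [X.deg_empty]
  rw [e, Finsupp.supported_empty, Submodule.mem_bot] at h
  exact h

lemma d_single_mem_chains {l : Λ} {c : X.Cell} (hc : c ∈ X.inside l) {n : ℕ}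
    (hn : X.deg c = n + 1) : X.d (Finsupp.single c 1) ∈ X.chains {l} n :=
  d_mem_chains (by rw [← hn]; exact single_mem_chains hc)

/-- Acyclic carriers: there is a filtered chain map that extends the identity in degree `0`. -/
theorem exists_chainMap (X Y : CellComplex Λ) :
    ∃ f : (X.Cell →₀ ℤ) →ₗ[ℤ] (Y.Cell →₀ ℤ), Carried X Y 0 f ∧ IsChainMap X Y f ∧
      f (Finsupp.single X.empty 1) = Finsupp.single Y.empty 1 := by
  obtain ⟨f, hf⟩ := exists_linearMap_of_degree (M := Y.Cell →₀ ℤ) X.deg X.d X.d_deg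
    (fun c z y => (c = X.empty ∧ y = Finsupp.single Y.empty 1) ∨
      (X.deg c ≠ 0 ∧ Y.d y = z ∧ ∀ l, c ∈ X.inside l → y ∈ Y.chains {l} (X.deg c)))
  have h0 : f (Finsupp.single X.empty 1) = Finsupp.single Y.empty 1 := by
    rcases hf X.empty ⟨_, Or.inl ⟨rfl, rfl⟩⟩ with h | h
    · exact h.2
    · exact absurd X.deg_empty h.1
  have key : ∀ n, (∀ l, ∀ c ∈ X.inside l, X.deg c = n →
      f (Finsupp.single c 1) ∈ Y.chains {l} n) ∧ (∀ l, ∀ c ∈ X.inside l, X.deg c = n →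
        Y.d (f (Finsupp.single c 1)) = f (X.d (Finsupp.single c 1))) := by
    intro n
    induction n with
    | zero =>
      constructor
      · intro l c hc hn
        rw [X.eq_empty l c hc hn, h0, ← Y.deg_empty]
        exact single_mem_chains (Y.empty_inside l)
      · intro l c hc hn
        rw [X.eq_empty l c hc hn, h0, d_single_empty, d_single_empty, map_zero]
    | succ n ih =>
      have main : ∀ l, ∀ c ∈ X.inside l, X.deg c = n + 1 →
          (X.deg c ≠ 0 ∧ Y.d (f (Finsupp.single c 1)) = f (X.d (Finsupp.single c 1)) ∧
            ∀ l, c ∈ X.inside l → f (Finsupp.single c 1) ∈ Y.chains {l} (X.deg c)) := by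
        intro l c hc hn
        have hne : X.deg c ≠ 0 := by omega
        refine (hf c ?_).resolve_left fun h => hne (h.1 ▸ X.deg_empty)
        obtain ⟨l', hl', hmin⟩ := X.hull l c hc hne
        have hdc := d_single_mem_chains hl' hn
        have hz : f (X.d (Finsupp.single c 1)) ∈ Y.chains {l'} n := by
          refine map_mem_of_single f (fun c' hc' => ?_) hdc
          obtain ⟨⟨_, rfl, h1⟩, h2⟩ := hc'
          exact ih.1 _ c' h1 h2
        have hz' : Y.d (f (X.d (Finsupp.single c 1))) = 0 := by
          have := map_eq_of_single (Y.d ∘ₗ f) (f ∘ₗ X.d) (fun c' hc' => by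
            obtain ⟨⟨_, rfl, h1⟩, h2⟩ := hc'
            exact ih.2 _ c' h1 h2) hdc
          simpa [X.d_d] using this
        obtain ⟨y, hy, hyz⟩ := exact_chains hz hz'
        exact ⟨y, Or.inr ⟨hne, hyz, fun l'' h'' => hn ▸ chains_le (hmin l'' h'') _ hy⟩⟩
      exact ⟨fun l c hc hn => hn ▸ (main l c hc hn).2.2 l hc,
        fun l c hc hn => (main l c hc hn).2.1⟩
  refine ⟨f, carried_of_single fun l c hc => (key _).1 l c hc rfl, fun A n x hx => ?_, h0⟩
  refine map_eq_of_single (Y.d ∘ₗ f) (f ∘ₗ X.d) (fun c hc => ?_) hx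
  obtain ⟨⟨l, _, h1⟩, h2⟩ := hc
  exact (key _).2 l c h1 rfl

/-- Acyclic carriers: a filtered chain map that vanishes in degree `0` is null-homotopic through a
filtered homotopy. -/
theorem exists_homotopy {f : (X.Cell →₀ ℤ) →ₗ[ℤ] (Y.Cell →₀ ℤ)} (hf : Carried X Y 0 f)
    (hfd : IsChainMap X Y f) (hf0 : f (Finsupp.single X.empty 1) = 0) :
    ∃ h : (X.Cell →₀ ℤ) →ₗ[ℤ] (Y.Cell →₀ ℤ), Carried X Y 1 h ∧
      ∀ A n, ∀ x ∈ X.chains A n, Y.d (h x) + h (X.d x) = f x := by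
  obtain ⟨h, hh⟩ := exists_linearMap_of_degree (M := Y.Cell →₀ ℤ) X.deg X.d X.d_deg
    (fun c z y => Y.d y + z = f (Finsupp.single c 1) ∧
      (X.deg c = 0 → y = 0) ∧ ∀ l, c ∈ X.inside l → y ∈ Y.chains {l} (X.deg c + 1))
  have key : ∀ n l, ∀ c ∈ X.inside l, X.deg c = n →
      Y.d (h (Finsupp.single c 1)) + h (X.d (Finsupp.single c 1)) = f (Finsupp.single c 1) ∧
      (X.deg c = 0 → h (Finsupp.single c 1) = 0) ∧
      ∀ l, c ∈ X.inside l → h (Finsupp.single c 1) ∈ Y.chains {l} (X.deg c + 1) := by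
    intro n
    induction n with
    | zero =>
      intro l c hc hn
      refine hh c ⟨0, ?_, fun _ => rfl, fun _ _ => Submodule.zero_mem _⟩
      rw [X.eq_empty l c hc hn, d_single_empty, hf0, map_zero, map_zero, add_zero]
    | succ n ih =>
      intro l c hc hn
      have hne : X.deg c ≠ 0 := by omega
      refine hh c ?_
      obtain ⟨l', hl', hmin⟩ := X.hull l c hc hne
      have hdc := d_single_mem_chains hl' hn
      have hz : h (X.d (Finsupp.single c 1)) ∈ Y.chains {l'} (n + 1) := by
        refine map_mem_of_single h (fun c' hc' => ?_) hdc
        obtain ⟨⟨_, rfl, h1⟩, h2⟩ := hc'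
        exact h2 ▸ (ih _ c' h1 h2).2.2 _ h1
      have hz' : Y.d (h (X.d (Finsupp.single c 1))) = f (X.d (Finsupp.single c 1)) := by
        have := map_eq_of_single (Y.d ∘ₗ h + h ∘ₗ X.d) f (fun c' hc' => by
          obtain ⟨⟨_, rfl, h1⟩, h2⟩ := hc'
          exact (ih _ c' h1 h2).1) hdc
        simpa [X.d_d] using this
      have hfc : f (Finsupp.single c 1) ∈ Y.chains {l'} (n + 1) :=
        hn ▸ hf _ l' _ (single_mem_chains hl')
      obtain ⟨y, hy, hyz⟩ := exact_chains (Submodule.sub_mem _ hfc hz) (by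
        rw [map_sub, hz', hfd {l'} _ _ (single_mem_chains hl'), sub_self])
      exact ⟨y, by rw [hyz, sub_add_cancel], fun h0 => absurd h0 hne,
        fun l'' h'' => hn ▸ chains_le (hmin l'' h'') _ hy⟩
  refine ⟨h, carried_of_single fun l c hc => (key _ l c hc rfl).2.2 l hc, fun A n x hx => ?_⟩
  refine map_eq_of_single (Y.d ∘ₗ h + h ∘ₗ X.d) f (fun c hc => ?_) hx
  obtain ⟨⟨l, _, h1⟩, h2⟩ := hc
  exact (key _ l c h1 rfl).1

end CellComplex

end Carrier

/-! ### The order on `ℤ` given by the semigroup, and its order complex -/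

section Bar

/-- The integer `n` lies in the semigroup generated by `a` and `b`. -/
def InS (a b : ℕ) (n : ℤ) : Prop := ∃ i j : ℕ, n = a * i + b * j

lemma InS.add {a b : ℕ} {k n : ℤ} (hk : InS a b k) (hn : InS a b n) : InS a b (k + n) := by
  obtain ⟨i, j, rfl⟩ := hk
  obtain ⟨i', j', rfl⟩ := hn
  exact ⟨i + i', j + j', by push_cast; ring⟩

lemma InS.zero (a b : ℕ) : InS a b 0 := ⟨0, 0, by simp⟩

lemma InS.self (a b : ℕ) (n : ℤ) : InS a b (n - n) := by
  rw [sub_self]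
  exact InS.zero a b

lemma InS.nonneg {a b : ℕ} {n : ℤ} (h : InS a b n) : 0 ≤ n := by
  obtain ⟨i, j, rfl⟩ := h
  positivity

lemma InS.trans {a b : ℕ} {x y z : ℤ} (h : InS a b (y - x)) (h' : InS a b (z - y)) :
    InS a b (z - x) := by
  have := h.add h'
  rwa [show y - x + (z - y) = z - x by ring] at this

lemma inS_natCast {a b n : ℕ} : InS a b (n : ℤ) ↔ IsSum a b n := by
  unfold InS IsSum
  exact exists_congr fun i => exists_congr fun j => by norm_cast

/-- The closed intervals of the order on `ℤ` in which `x` lies below `y` if and only if `y - x` is a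
sum of `a`'s and `b`'s. -/
structure Interval (a b : ℕ) where
  /-- The lower end. -/
  lo : ℤ
  /-- The upper end. -/
  hi : ℤ
  le : InS a b (hi - lo)

variable {a b : ℕ}

/-- Intervals are ordered by inclusion. -/
instance : Preorder (Interval a b) where
  le l l' := InS a b (l.lo - l'.lo) ∧ InS a b (l'.hi - l.hi)
  le_refl _ := ⟨InS.self a b _, InS.self a b _⟩
  le_trans _ _ _ h h' := ⟨h'.1.trans h.1, h.2.trans h'.2⟩

/-- The intervals from some `x` to `x + m`; the subcomplexes of `barComplex` and `koszulComplex`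
over them make up the truncated complexes to be compared. -/
def windows (a b m : ℕ) : Set (Interval a b) := {l | l.hi = l.lo + m}

/-- A finite set of integers is a chain for the order given by `a` and `b`. -/
def IsSChain (a b : ℕ) (s : Finset ℤ) : Prop := ∀ x ∈ s, ∀ y ∈ s, x ≤ y → InS a b (y - x)

lemma IsSChain.mono {s t : Finset ℤ} (hs : IsSChain a b s) (h : t ⊆ s) : IsSChain a b t :=
  fun x hx y hy => hs x (h hx) y (h hy)

variable (a b) in
/-- The order complex of `ℤ`, filtered by the order complexes of its intervals. -/
def barComplex : CellComplex (Interval a b) where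
  Cell := Finset ℤ
  deg := Finset.card
  d := finsetBoundary
  inside l := {s | (∀ x ∈ s, InS a b (x - l.lo) ∧ InS a b (l.hi - x)) ∧ IsSChain a b s}
  empty := ∅
  d_deg s := finsetBoundary_mem (S := {s}) (fun t ht v hv => by
    rw [Set.mem_singleton_iff.1 ht] at hv ⊢
    exact Finset.card_erase_add_one hv) (Finsupp.single_mem_supported ℤ _ rfl)
  d_inside l s hs := finsetBoundary_mem (S := {s}) (fun t ht v hv => by
    rw [Set.mem_singleton_iff.1 ht] at hv ⊢
    exact ⟨fun x hx => hs.1 x (Finset.mem_of_mem_erase hx), hs.2.mono (Finset.erase_subset v s)⟩)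
    (Finsupp.single_mem_supported ℤ _ rfl)
  d_d := finsetBoundary_finsetBoundary
  deg_empty := Finset.card_empty
  empty_inside l := ⟨fun _ h => absurd h (Finset.notMem_empty _),
    fun _ h => absurd h (Finset.notMem_empty _)⟩
  eq_empty l s _ h := Finset.card_eq_zero.1 h
  inside_mono h s hs := ⟨fun x hx => ⟨h.1.trans (hs.1 x hx).1, (hs.1 x hx).2.trans h.2⟩, hs.2⟩
  hull l s hs h := by
    have hne : s.Nonempty := Finset.card_ne_zero.1 h
    refine ⟨⟨s.min' hne, s.max' hne, hs.2 _ (s.min'_mem hne) _ (s.max'_mem hne)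
      (s.min'_le _ (s.max'_mem hne))⟩, ⟨fun x hx => ⟨?_, ?_⟩, hs.2⟩, fun l'' h'' => ⟨?_, ?_⟩⟩
    · exact hs.2 _ (s.min'_mem hne) x hx (s.min'_le x hx)
    · exact hs.2 x hx _ (s.max'_mem hne) (s.le_max' x hx)
    · exact (h''.1 _ (s.min'_mem hne)).1
    · exact (h''.1 _ (s.max'_mem hne)).2
  exact l x hx hd := by
    refine ⟨coneOp l.lo x, coneOp_mem (fun s hs _ => ?_) hx, ?_⟩
    · refine ⟨fun y hy => ?_, fun y hy z hz hyz => ?_⟩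
      · rcases Finset.mem_insert.1 hy with rfl | hy
        · exact ⟨InS.self a b _, l.le⟩
        · exact hs.1 y hy
      · rcases Finset.mem_insert.1 hy with rfl | hy <;> rcases Finset.mem_insert.1 hz with rfl | hz
        · exact InS.self a b _
        · exact (hs.1 z hz).1
        · have := (hs.1 y hy).1.nonneg
          rw [show y = l.lo by omega]
          exact InS.self a b _
        · exact hs.2 y hy z hz hyz
    · have := finsetBoundary_coneOp l.lo x
      rwa [hd, map_zero, add_zero] at this

/-- The finite sets of integers such that both `y - x` and `m - (y - x)` are sums of `a`'s and `b`'s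
for all elements `x ≤ y`. They form a simplicial complex, called the cover of `Σ(a,b,m)` in what
follows: it maps onto `Σ(a,b,m)` by reduction modulo `m`, it contains `Σ(a,b,m)` as the part between
`0` and `m - 1`, and the translation by `1`, which corresponds to the rotation of `Σ(a,b,m)`,
preserves the order of the vertices. -/
def coverFaces (a b m : ℕ) : Set (Finset ℤ) :=
  {s | ∀ x ∈ s, ∀ y ∈ s, x ≤ y → InS a b (y - x) ∧ InS a b (m - (y - x))}

lemma coverFaces_mono {m : ℕ} {s t : Finset ℤ} (hs : s ∈ coverFaces a b m) (h : t ⊆ s) :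
    t ∈ coverFaces a b m :=
  fun x hx y hy => hs x (h hx) y (h hy)

lemma exists_windows_inside_iff {m : ℕ} (hm : InS a b m) (s : Finset ℤ) :
    (∃ l ∈ windows a b m, s ∈ (barComplex a b).inside l) ↔ s ∈ coverFaces a b m := by
  constructor
  · rintro ⟨l, hl, hs⟩ x hx y hy hxy
    refine ⟨hs.2 x hx y hy hxy, ?_⟩
    have h := (hs.1 x hx).1.add (hs.1 y hy).2
    have hl' : l.hi = l.lo + m := hl
    rwa [hl', show x - l.lo + (l.lo + m - y) = m - (y - x) by ring] at h
  · intro hs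
    rcases s.eq_empty_or_nonempty with rfl | hne
    · exact ⟨⟨0, m, by rwa [sub_zero]⟩, by simp [windows], (barComplex a b).empty_inside _⟩
    · refine ⟨⟨s.min' hne, s.min' hne + m, by rwa [add_sub_cancel_left]⟩, rfl, fun x hx => ?_,
        fun x hx y hy hxy => (hs x hx y hy hxy).1⟩
      have h := hs _ (s.min'_mem hne) x hx (s.min'_le x hx)
      exact ⟨h.1, by convert h.2 using 1; ring⟩

/-- The chains of degree `n` of the cover. -/
def coverChains (a b m n : ℕ) : Submodule ℤ (Finset ℤ →₀ ℤ) :=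
  Finsupp.supported ℤ ℤ {s | s ∈ coverFaces a b m ∧ s.card = n}

lemma barComplex_chains_windows {m : ℕ} (hm : InS a b m) (n : ℕ) :
    (barComplex a b).chains (windows a b m) n = coverChains a b m n := by
  unfold CellComplex.chains coverChains
  congr 1
  ext s
  exact and_congr_left fun _ => exists_windows_inside_iff hm s

end Bar

/-! ### A small complex of cells in the order -/

section Koszul

/-- Laurent polynomials with integer coefficients: the group ring of the group of translations
of `ℤ`. -/
abbrev Lau : Type := LaurentPolynomial ℤ

open LaurentPolynomial (T)

/-- The map that sends `∑ r_z T^z` to the chain `∑ r_z f(z)`. -/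
def lin {I : Type} (f : ℤ → I) : Lau →ₗ[ℤ] (I →₀ ℤ) :=
  Finsupp.lmapDomain ℤ ℤ f ∘ₗ (AddMonoidAlgebra.coeffLinearEquiv ℤ).toLinearMap

lemma lin_T {I : Type} (f : ℤ → I) (z : ℤ) : lin f (T z) = Finsupp.single (f z) 1 := by
  change Finsupp.mapDomain f (Finsupp.single z 1) = _
  rw [Finsupp.mapDomain_single]

lemma lau_hom_ext {M : Type} [AddCommGroup M] {f g : Lau →ₗ[ℤ] M} (h : ∀ z, f (T z) = g (T z)) :
    f = g := by
  ext z
  exact h z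

/-- Multiplication by a Laurent polynomial as a linear map. -/
abbrev mulL (p : Lau) : Lau →ₗ[ℤ] Lau := LinearMap.mulLeft ℤ p

/-- The geometric sum `1 + T^n + … + T^{n(k-1)}`. -/
def geom (n k : ℕ) : Lau := ∑ i ∈ Finset.range k, T (n * i : ℤ)

lemma geom_succ (n k : ℕ) : geom n (k + 1) = geom n k + T (n * k : ℤ) := Finset.sum_range_succ _ _

lemma geom_add (n i k : ℕ) : geom n (i + k) = geom n i + T (n * i : ℤ) * geom n k := by
  induction k with
  | zero => simp [geom]
  | succ k ih =>
    rw [← add_assoc, geom_succ, ih, geom_succ]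
    push_cast
    rw [mul_add (n : ℤ), LaurentPolynomial.T_add]
    ring

lemma geom_mul (n k : ℕ) : (T (n : ℤ) - 1) * geom n k = T (n * k : ℤ) - 1 := by
  induction k with
  | zero => simp [geom]
  | succ k ih =>
    rw [geom_succ, mul_add, ih]
    push_cast
    rw [mul_add, mul_one, LaurentPolynomial.T_add]
    ring

lemma lin_geom {I : Type} (f : ℤ → I) (n k : ℕ) (z : ℤ) :
    lin f (geom n k * T z) = ∑ i ∈ Finset.range k, Finsupp.single (f (z + n * i)) 1 := by
  rw [geom, Finset.sum_mul, map_sum]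
  refine Finset.sum_congr rfl fun i _ => ?_
  rw [← LaurentPolynomial.T_add, lin_T, add_comm]

lemma lin_sub {I : Type} (f : ℤ → I) (n z : ℤ) :
    lin f ((T n - 1) * T z) = Finsupp.single (f (z + n)) 1 - Finsupp.single (f z) 1 := by
  rw [sub_mul, one_mul, map_sub, ← LaurentPolynomial.T_add, lin_T, lin_T, add_comm]

/-- The cells of the Koszul-Tate resolution of `ℤ` over the semigroup ring
`ℤ[x, y] / (x ^ b - y ^ a)`, on which `x` and `y` act as `1`. For each divided power `γ_k` of the
class of the relation there are the cells `γ_k`, `γ_k dx`, `γ_k dy` and `γ_k dx dy`, at each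
position `z`; in addition there is an empty cell. -/
inductive KCell : Type
  | empty : KCell
  | pt (k : ℕ) (z : ℤ) : KCell
  | dx (k : ℕ) (z : ℤ) : KCell
  | dy (k : ℕ) (z : ℤ) : KCell
  | dxy (k : ℕ) (z : ℤ) : KCell

namespace KCell

/-- The dimension plus one. -/
def deg : KCell → ℕ
  | empty => 0
  | pt k _ => 2 * k + 1
  | dx k _ => 2 * k + 2
  | dy k _ => 2 * k + 2
  | dxy k _ => 2 * k + 3

/-- The position of a cell, which is the bottom of the interval that it occupies. -/
def bot : KCell → ℤ
  | empty => 0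
  | pt _ z => z
  | dx _ z => z
  | dy _ z => z
  | dxy _ z => z

/-- The length of the interval that a cell occupies. -/
def width (a b : ℕ) : KCell → ℤ
  | empty => 0
  | pt k _ => k * (a * b)
  | dx k _ => k * (a * b) + a
  | dy k _ => k * (a * b) + b
  | dxy k _ => k * (a * b) + a + b

/-- The top of the interval that a cell occupies. -/
abbrev top (a b : ℕ) (c : KCell) : ℤ := c.bot + c.width a b

/-- The linear combinations of the cells `γ_{k-1} dx dy`, where `γ_{-1} = 0`. -/
def low : ℕ → Lau →ₗ[ℤ] (KCell →₀ ℤ)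
  | 0 => 0
  | k + 1 => lin (dxy k)

/-- The boundary of a cell. With `x = T ^ a` and `y = T ^ b` it is the derivation with `dx ↦ x - 1`,
`dy ↦ y - 1` and `γ_k ↦ γ_{k-1} (α dx - β dy)`, where
`0 = x ^ b - y ^ a = α (x - 1) - β (y - 1)`. -/
def dCell (a b : ℕ) : KCell → (KCell →₀ ℤ)
  | empty => 0
  | pt 0 _ => Finsupp.single empty 1
  | pt (k + 1) z => lin (dx k) (geom a b * T z) - lin (dy k) (geom b a * T z)
  | dx k z => lin (pt k) ((T (a : ℤ) - 1) * T z) + low k (geom b a * T z)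
  | dy k z => lin (pt k) ((T (b : ℤ) - 1) * T z) + low k (geom a b * T z)
  | dxy k z => lin (dy k) ((T (a : ℤ) - 1) * T z) - lin (dx k) ((T (b : ℤ) - 1) * T z)

/-- The boundary map. -/
def bdry (a b : ℕ) : (KCell →₀ ℤ) →ₗ[ℤ] (KCell →₀ ℤ) := Finsupp.linearCombination ℤ (dCell a b)

lemma bdry_single (a b : ℕ) (c : KCell) : bdry a b (Finsupp.single c 1) = dCell a b c := by
  simp [bdry]

/-- The sum of the coefficients of a Laurent polynomial. -/
def aug : Lau →+* ℤ := LaurentPolynomial.eval₂ (RingHom.id ℤ) 1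

lemma aug_T (z : ℤ) : aug (T z) = 1 := by
  simp [aug]

/-- A formula for a linear map on all combinations of the cells of one type follows from the cells
themselves. -/
lemma map_lin {I M : Type} [AddCommGroup M] {f : ℤ → I} (d : (I →₀ ℤ) →ₗ[ℤ] M)
    (g : Lau →ₗ[ℤ] M) (h : ∀ z, d (Finsupp.single (f z) 1) = g (T z)) (p : Lau) :
    d (lin f p) = g p := by
  have : d ∘ₗ lin f = g := lau_hom_ext fun z => by rw [LinearMap.comp_apply, lin_T, h]
  exact LinearMap.congr_fun this p

variable {a b : ℕ}

lemma bdry_pt_zero (p : Lau) :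
    bdry a b (lin (pt 0) p) = aug p • Finsupp.single empty (1 : ℤ) :=
  map_lin (bdry a b) (LinearMap.toSpanSingleton ℤ _ (Finsupp.single empty (1 : ℤ)) ∘ₗ
    aug.toAddMonoidHom.toIntLinearMap) (fun z => by
      rw [bdry_single]; simp [dCell, aug_T]) p

lemma bdry_pt_succ (k : ℕ) (p : Lau) :
    bdry a b (lin (pt (k + 1)) p) = lin (dx k) (geom a b * p) - lin (dy k) (geom b a * p) :=
  map_lin (bdry a b) (lin (dx k) ∘ₗ mulL (geom a b) - lin (dy k) ∘ₗ mulL (geom b a))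
    (fun z => by rw [bdry_single]; rfl) p

lemma bdry_dx (k : ℕ) (p : Lau) :
    bdry a b (lin (dx k) p) = lin (pt k) ((T (a : ℤ) - 1) * p) + low k (geom b a * p) :=
  map_lin (bdry a b) (lin (pt k) ∘ₗ mulL (T (a : ℤ) - 1) + low k ∘ₗ mulL (geom b a))
    (fun z => by rw [bdry_single]; rfl) p

lemma bdry_dy (k : ℕ) (p : Lau) :
    bdry a b (lin (dy k) p) = lin (pt k) ((T (b : ℤ) - 1) * p) + low k (geom a b * p) :=
  map_lin (bdry a b) (lin (pt k) ∘ₗ mulL (T (b : ℤ) - 1) + low k ∘ₗ mulL (geom a b))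
    (fun z => by rw [bdry_single]; rfl) p

lemma bdry_dxy (k : ℕ) (p : Lau) :
    bdry a b (lin (dxy k) p) =
      lin (dy k) ((T (a : ℤ) - 1) * p) - lin (dx k) ((T (b : ℤ) - 1) * p) :=
  map_lin (bdry a b) (lin (dy k) ∘ₗ mulL (T (a : ℤ) - 1) - lin (dx k) ∘ₗ mulL (T (b : ℤ) - 1))
    (fun z => by rw [bdry_single]; rfl) p

/-- Both sides are `T^{ab} - 1`. -/
lemma geom_relation (a b : ℕ) :
    (T (a : ℤ) - 1) * geom a b = (T (b : ℤ) - 1) * geom b a := by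
  rw [geom_mul, geom_mul, mul_comm (a : ℤ)]

lemma bdry_bdry (x : KCell →₀ ℤ) : bdry a b (bdry a b x) = 0 := by
  suffices h : bdry a b ∘ₗ bdry a b = 0 from LinearMap.congr_fun h x
  ext c : 2
  simp only [LinearMap.comp_apply, Finsupp.lsingle_apply, LinearMap.zero_apply, bdry_single]
  have h0 : bdry a b (Finsupp.single empty 1) = 0 := bdry_single a b empty
  have hr := geom_relation a b
  match c with
  | empty => simp [dCell]
  | pt 0 z => exact h0
  | pt (k + 1) z =>
    rw [dCell, map_sub, bdry_dx, bdry_dy, ← mul_assoc, ← mul_assoc, ← mul_assoc, ← mul_assoc, hr,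
      mul_comm (geom b a) (geom a b), sub_self]
  | dx 0 z =>
    rw [dCell, map_add, bdry_pt_zero, map_mul, map_sub, aug_T, map_one]
    simp [low]
  | dx (k + 1) z =>
    rw [dCell, low, map_add, bdry_pt_succ, bdry_dxy, ← mul_assoc, ← mul_assoc, ← mul_assoc,
      ← mul_assoc, ← hr, mul_comm (geom a b), mul_comm (geom b a)]
    abel
  | dy 0 z =>
    rw [dCell, map_add, bdry_pt_zero, map_mul, map_sub, aug_T, map_one]
    simp [low]
  | dy (k + 1) z =>
    rw [dCell, low, map_add, bdry_pt_succ, bdry_dxy, ← mul_assoc, ← mul_assoc, ← mul_assoc,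
      ← mul_assoc, hr, mul_comm (geom a b), mul_comm (geom b a)]
    abel
  | dxy k z =>
    rw [dCell, map_sub, bdry_dx, bdry_dy, ← mul_assoc, ← mul_assoc, ← mul_assoc, ← mul_assoc,
      mul_comm (geom b a), mul_comm (geom a b), hr, mul_comm (T (a : ℤ) - 1) (T (b : ℤ) - 1),
      sub_self]

/-- The cells that occur in the boundary of a cell. -/
inductive Face (a b : ℕ) : KCell → KCell → Prop
  | pt_zero (z : ℤ) : Face a b empty (pt 0 z)
  | pt_dx (k : ℕ) (z : ℤ) (i : ℕ) (h : i < b) : Face a b (dx k (z + a * i)) (pt (k + 1) z)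
  | pt_dy (k : ℕ) (z : ℤ) (j : ℕ) (h : j < a) : Face a b (dy k (z + b * j)) (pt (k + 1) z)
  | dx_hi (k : ℕ) (z : ℤ) : Face a b (pt k (z + a)) (dx k z)
  | dx_lo (k : ℕ) (z : ℤ) : Face a b (pt k z) (dx k z)
  | dx_dxy (k : ℕ) (z : ℤ) (j : ℕ) (h : j < a) : Face a b (dxy k (z + b * j)) (dx (k + 1) z)
  | dy_hi (k : ℕ) (z : ℤ) : Face a b (pt k (z + b)) (dy k z)
  | dy_lo (k : ℕ) (z : ℤ) : Face a b (pt k z) (dy k z)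
  | dy_dxy (k : ℕ) (z : ℤ) (i : ℕ) (h : i < b) : Face a b (dxy k (z + a * i)) (dy (k + 1) z)
  | dxy_dy_hi (k : ℕ) (z : ℤ) : Face a b (dy k (z + a)) (dxy k z)
  | dxy_dy_lo (k : ℕ) (z : ℤ) : Face a b (dy k z) (dxy k z)
  | dxy_dx_hi (k : ℕ) (z : ℤ) : Face a b (dx k (z + b)) (dxy k z)
  | dxy_dx_lo (k : ℕ) (z : ℤ) : Face a b (dx k z) (dxy k z)

lemma lin_geom_mem {I : Type} {f : ℤ → I} {n k : ℕ} {z : ℤ} {S : Set I}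
    (h : ∀ i < k, f (z + n * i) ∈ S) : lin f (geom n k * T z) ∈ Finsupp.supported ℤ ℤ S := by
  rw [lin_geom]
  exact Submodule.sum_mem _ fun i hi =>
    Finsupp.single_mem_supported ℤ _ (h i (Finset.mem_range.1 hi))

lemma lin_sub_mem {I : Type} {f : ℤ → I} {n z : ℤ} {S : Set I} (h : f (z + n) ∈ S)
    (h' : f z ∈ S) : lin f ((T n - 1) * T z) ∈ Finsupp.supported ℤ ℤ S := by
  rw [lin_sub]
  exact Submodule.sub_mem _ (Finsupp.single_mem_supported ℤ _ h)
    (Finsupp.single_mem_supported ℤ _ h')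

lemma dCell_mem (c : KCell) : dCell a b c ∈ Finsupp.supported ℤ ℤ {c' | Face a b c' c} := by
  match c with
  | empty => exact Submodule.zero_mem _
  | pt 0 z => exact Finsupp.single_mem_supported ℤ _ (Face.pt_zero z)
  | pt (k + 1) z =>
    exact Submodule.sub_mem _ (lin_geom_mem fun i h => Face.pt_dx k z i h)
      (lin_geom_mem fun i h => Face.pt_dy k z i h)
  | dx 0 z =>
    exact Submodule.add_mem _ (lin_sub_mem (Face.dx_hi 0 z) (Face.dx_lo 0 z))
      (Submodule.zero_mem _)
  | dx (k + 1) z =>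
    exact Submodule.add_mem _ (lin_sub_mem (Face.dx_hi _ z) (Face.dx_lo _ z))
      (lin_geom_mem fun i h => Face.dx_dxy k z i h)
  | dy 0 z =>
    exact Submodule.add_mem _ (lin_sub_mem (Face.dy_hi 0 z) (Face.dy_lo 0 z))
      (Submodule.zero_mem _)
  | dy (k + 1) z =>
    exact Submodule.add_mem _ (lin_sub_mem (Face.dy_hi _ z) (Face.dy_lo _ z))
      (lin_geom_mem fun i h => Face.dy_dxy k z i h)
  | dxy k z =>
    exact Submodule.sub_mem _ (lin_sub_mem (Face.dxy_dy_hi _ z) (Face.dxy_dy_lo _ z))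
      (lin_sub_mem (Face.dxy_dx_hi _ z) (Face.dxy_dx_lo _ z))

lemma Face.deg {c c' : KCell} (h : Face a b c' c) : c'.deg + 1 = c.deg := by
  cases h <;> simp only [KCell.deg] <;> ring

lemma inS_of_eq {n : ℤ} (i j : ℕ) (h : n = a * i + b * j) : InS a b n := ⟨i, j, h⟩

/-- The faces of a cell lie in the interval that the cell occupies. -/
lemma Face.inS {c c' : KCell} (h : Face a b c' c) :
    c' = empty ∨ (InS a b (c'.bot - c.bot) ∧ InS a b (c.top a b - c'.top a b)) := by
  cases h with
  | pt_zero => exact Or.inl rfl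
  | pt_dx k z i h =>
    obtain ⟨r, rfl⟩ := Nat.exists_eq_add_of_lt h
    exact Or.inr ⟨inS_of_eq i 0 (by simp only [bot]; push_cast; ring),
      inS_of_eq r 0 (by simp only [top, bot, width]; push_cast; ring)⟩
  | pt_dy k z j h =>
    obtain ⟨r, rfl⟩ := Nat.exists_eq_add_of_lt h
    exact Or.inr ⟨inS_of_eq 0 j (by simp only [bot]; push_cast; ring),
      inS_of_eq 0 r (by simp only [top, bot, width]; push_cast; ring)⟩
  | dx_hi k z =>
    exact Or.inr ⟨inS_of_eq 1 0 (by simp only [bot]; push_cast; ring),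
      inS_of_eq 0 0 (by simp only [top, bot, width]; push_cast; ring)⟩
  | dx_lo k z =>
    exact Or.inr ⟨inS_of_eq 0 0 (by simp only [bot]; push_cast; ring),
      inS_of_eq 1 0 (by simp only [top, bot, width]; push_cast; ring)⟩
  | dx_dxy k z j h =>
    obtain ⟨r, rfl⟩ := Nat.exists_eq_add_of_lt h
    exact Or.inr ⟨inS_of_eq 0 j (by simp only [bot]; push_cast; ring),
      inS_of_eq 0 r (by simp only [top, bot, width]; push_cast; ring)⟩
  | dy_hi k z =>
    exact Or.inr ⟨inS_of_eq 0 1 (by simp only [bot]; push_cast; ring),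
      inS_of_eq 0 0 (by simp only [top, bot, width]; push_cast; ring)⟩
  | dy_lo k z =>
    exact Or.inr ⟨inS_of_eq 0 0 (by simp only [bot]; push_cast; ring),
      inS_of_eq 0 1 (by simp only [top, bot, width]; push_cast; ring)⟩
  | dy_dxy k z i h =>
    obtain ⟨r, rfl⟩ := Nat.exists_eq_add_of_lt h
    exact Or.inr ⟨inS_of_eq i 0 (by simp only [bot]; push_cast; ring),
      inS_of_eq r 0 (by simp only [top, bot, width]; push_cast; ring)⟩
  | dxy_dy_hi k z =>
    exact Or.inr ⟨inS_of_eq 1 0 (by simp only [bot]; push_cast; ring),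
      inS_of_eq 0 0 (by simp only [top, bot, width]; push_cast; ring)⟩
  | dxy_dy_lo k z =>
    exact Or.inr ⟨inS_of_eq 0 0 (by simp only [bot]; push_cast; ring),
      inS_of_eq 1 0 (by simp only [top, bot, width]; push_cast; ring)⟩
  | dxy_dx_hi k z =>
    exact Or.inr ⟨inS_of_eq 0 1 (by simp only [bot]; push_cast; ring),
      inS_of_eq 0 0 (by simp only [top, bot, width]; push_cast; ring)⟩
  | dxy_dx_lo k z =>
    exact Or.inr ⟨inS_of_eq 0 0 (by simp only [bot]; push_cast; ring),
      inS_of_eq 0 1 (by simp only [top, bot, width]; push_cast; ring)⟩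

/-- The cells that lie in an interval. -/
def inside (l : Interval a b) : Set KCell :=
  {c | c = empty ∨ (InS a b (c.bot - l.lo) ∧ InS a b (l.hi - c.top a b))}

lemma Face.inside {c c' : KCell} (h : Face a b c' c) {l : Interval a b} (hc : c ∈ inside l) :
    c' ∈ inside l := by
  rcases hc with rfl | hc
  · cases h
  · exact h.inS.imp id fun h => ⟨hc.1.trans h.1, h.2.trans hc.2⟩

end KCell

end Koszul

/-! ### A contraction of the small complex over an interval -/

section Contraction

open LaurentPolynomial (T)

/-- Elements of the semigroup are uniquely of the form `a i + b j` with `j < a`; this chooses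
`(i, j)`. -/
def normalForm (a b : ℕ) (n : ℤ) : ℕ × ℕ :=
  open Classical in
  if h : ∃ p : ℕ × ℕ, n = a * p.1 + b * p.2 ∧ p.2 < a then h.choose else 0

lemma normalForm_eq {a b : ℕ} (hab : a.Coprime b) {i j : ℕ} (hj : j < a) :
    normalForm a b (a * i + b * j) = (i, j) := by
  have h : ∃ p : ℕ × ℕ, (a * i + b * j : ℤ) = a * p.1 + b * p.2 ∧ p.2 < a := ⟨(i, j), rfl, hj⟩
  have e : normalForm a b (a * i + b * j) = h.choose := dif_pos h
  obtain ⟨h1, h2⟩ := h.choose_spec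
  rw [e]
  generalize h.choose = p at h1 h2
  obtain ⟨i', j'⟩ := p
  simp only at h1 h2
  norm_cast at h1
  have hm : j ≡ j' [MOD a] := by
    refine Nat.ModEq.cancel_left_of_coprime (c := b) hab ?_
    have : (a * i + b * j) % a = (a * i' + b * j') % a := by rw [h1]
    simpa [Nat.add_mod, Nat.ModEq] using this
  have hjj : j = j' := Nat.ModEq.eq_of_lt_of_lt hm hj h2
  subst hjj
  have : a * i = a * i' := by omega
  rw [Nat.eq_of_mul_eq_mul_left (by omega) this]

lemma InS.exists_normalForm {a b : ℕ} (ha : 0 < a) {n : ℤ} (h : InS a b n) :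
    ∃ i j : ℕ, n = a * i + b * j ∧ j < a := by
  obtain ⟨i, j, rfl⟩ := h
  refine ⟨i + b * (j / a), j % a, ?_, Nat.mod_lt _ ha⟩
  have := Nat.div_add_mod j a
  have h2 : (j : ℤ) = a * (j / a : ℕ) + (j % a : ℕ) := by exact_mod_cast this.symm
  rw [Nat.cast_add, Nat.cast_mul]
  linear_combination (b : ℤ) * h2

namespace KCell

/-- The value on a cell of the contraction of the complex over an interval with lower end `u`. It
moves a cell at `z = u + a i + b j`, where `j < a`, towards the lower end of the interval: `j` is
lowered to `0` by cells in the direction `dy`, and for `γ_0` then also `i` by cells in the direction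
`dx`. The step from `j = a - 1` to `j = a`, which changes the normal form, is what the divided
powers `γ_{k+1}` account for. -/
def hCell (a b : ℕ) (u : ℤ) : KCell → (KCell →₀ ℤ)
  | empty => Finsupp.single (pt 0 u) 1
  | pt k z =>
    lin (dy k) (geom b (normalForm a b (z - u)).2 * T (u + a * (normalForm a b (z - u)).1)) +
      if k = 0 then lin (dx 0) (geom a (normalForm a b (z - u)).1 * T u) else 0
  | dx k z =>
    -lin (dxy k) (geom b (normalForm a b (z - u)).2 * T (u + a * (normalForm a b (z - u)).1))
  | dy k z =>
    if (normalForm a b (z - u)).2 + 1 = a then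
      -Finsupp.single (pt (k + 1) (u + a * (normalForm a b (z - u)).1)) 1 else 0
  | dxy k z =>
    if (normalForm a b (z - u)).2 + 1 = a then
      Finsupp.single (dx (k + 1) (u + a * (normalForm a b (z - u)).1)) 1 else 0

/-- The contraction of the complex over an interval with lower end `u`. -/
def contr (a b : ℕ) (u : ℤ) : (KCell →₀ ℤ) →ₗ[ℤ] (KCell →₀ ℤ) :=
  Finsupp.linearCombination ℤ (hCell a b u)

lemma contr_single (a b : ℕ) (u : ℤ) (c : KCell) :
    contr a b u (Finsupp.single c 1) = hCell a b u c := by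
  simp [contr]

section

variable {a b : ℕ} {u : ℤ} {i j : ℕ}

lemma contr_pt (hab : a.Coprime b) (hj : j < a) (k : ℕ) :
    contr a b u (Finsupp.single (pt k (u + a * i + b * j)) 1) =
      lin (dy k) (geom b j * T (u + a * i)) +
        if k = 0 then lin (dx 0) (geom a i * T u) else 0 := by
  rw [contr_single, hCell, show u + a * i + b * j - u = a * i + b * j by ring,
    normalForm_eq hab hj]

lemma contr_dx (hab : a.Coprime b) (hj : j < a) (k : ℕ) :
    contr a b u (Finsupp.single (dx k (u + a * i + b * j)) 1) =
      -lin (dxy k) (geom b j * T (u + a * i)) := by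
  rw [contr_single, hCell, show u + a * i + b * j - u = a * i + b * j by ring,
    normalForm_eq hab hj]

lemma contr_dy (hab : a.Coprime b) (hj : j < a) (k : ℕ) :
    contr a b u (Finsupp.single (dy k (u + a * i + b * j)) 1) =
      if j + 1 = a then -Finsupp.single (pt (k + 1) (u + a * i)) 1 else 0 := by
  rw [contr_single, hCell, show u + a * i + b * j - u = a * i + b * j by ring,
    normalForm_eq hab hj]

lemma contr_dxy (hab : a.Coprime b) (hj : j < a) (k : ℕ) :
    contr a b u (Finsupp.single (dxy k (u + a * i + b * j)) 1) =
      if j + 1 = a then Finsupp.single (dx (k + 1) (u + a * i)) 1 else 0 := by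
  rw [contr_single, hCell, show u + a * i + b * j - u = a * i + b * j by ring,
    normalForm_eq hab hj]

/-- Among the `a` positions `z, z + b, …, z + (a - 1) b` exactly one has the residue that the
contraction does not kill. -/
lemma contr_lin_geom (hj : j < a) {f : ℤ → KCell} {g : ℤ → (KCell →₀ ℤ)}
    (hf : ∀ i j : ℕ, j < a → contr a b u (Finsupp.single (f (u + a * i + b * j)) 1) =
      if j + 1 = a then g (u + a * i) else 0) :
    contr a b u (lin f (geom b a * T (u + a * i + b * j))) = g (u + a * i) := by
  rw [lin_geom, map_sum, Finset.sum_eq_single (a - 1 - j)]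
  · rw [show u + a * i + b * j + b * (a - 1 - j : ℕ) = u + a * i + b * (a - 1 : ℕ) by
        rw [show a - 1 = j + (a - 1 - j) by omega, show j + (a - 1 - j) - j = a - 1 - j by omega]
        push_cast
        ring,
      hf i _ (by omega), if_pos (by omega)]
  · intro t ht hne
    have ht' := Finset.mem_range.1 ht
    rcases lt_or_ge (j + t) a with h | h
    · rw [show u + a * i + b * j + b * t = u + a * i + b * (j + t : ℕ) by push_cast; ring,
        hf i _ h, if_neg (by omega)]
    · obtain ⟨r, hr⟩ := Nat.exists_eq_add_of_le h
      have hr' : (j : ℤ) + t = a + r := by exact_mod_cast hr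
      rw [show u + a * i + b * j + b * t = u + a * (i + b : ℕ) + b * r by
          push_cast
          linear_combination (b : ℤ) * hr',
        hf _ _ (by omega), if_neg (by omega)]
  · intro h
    exact absurd (Finset.mem_range.2 (by omega)) h

lemma contr_dy_geom (hab : a.Coprime b) (hj : j < a) (k : ℕ) :
    contr a b u (lin (dy k) (geom b a * T (u + a * i + b * j))) =
      -lin (pt (k + 1)) (T (u + a * i)) := by
  rw [lin_T]
  exact contr_lin_geom hj (g := fun z => -Finsupp.single (pt (k + 1) z) 1)
    fun i j hj => contr_dy hab hj k

lemma contr_dxy_geom (hab : a.Coprime b) (hj : j < a) (k : ℕ) :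
    contr a b u (lin (dxy k) (geom b a * T (u + a * i + b * j))) =
      lin (dx (k + 1)) (T (u + a * i)) := by
  rw [lin_T]
  exact contr_lin_geom hj (g := fun z => Finsupp.single (dx (k + 1) z) 1)
    fun i j hj => contr_dxy hab hj k

lemma contr_dx_geom (hab : a.Coprime b) (hj : j < a) (k : ℕ) :
    contr a b u (lin (dx k) (geom a b * T (u + a * i + b * j))) =
      -lin (dxy k) (geom a b * (geom b j * T (u + a * i))) := by
  rw [lin_geom, map_sum, geom, Finset.sum_mul, map_sum, ← Finset.sum_neg_distrib]
  refine Finset.sum_congr rfl fun r _ => ?_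
  rw [show u + a * i + b * j + a * r = u + a * (i + r : ℕ) + b * j by push_cast; ring,
    contr_dx hab hj, mul_left_comm, ← LaurentPolynomial.T_add]
  congr 4
  push_cast
  ring_nf

lemma contr_dxy_geom' (hab : a.Coprime b) (hj : j < a) (k : ℕ) :
    contr a b u (lin (dxy k) (geom a b * T (u + a * i + b * j))) =
      if j + 1 = a then lin (dx (k + 1)) (geom a b * T (u + a * i)) else 0 := by
  rw [lin_geom, map_sum]
  have h : ∀ r : ℕ, contr a b u (Finsupp.single (dxy k (u + a * i + b * j + a * r)) 1) =
      if j + 1 = a then Finsupp.single (dx (k + 1) (u + a * i + a * r)) 1 else 0 := by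
    intro r
    rw [show u + a * i + b * j + a * r = u + a * (i + r : ℕ) + b * j by push_cast; ring,
      contr_dxy hab hj]
    push_cast
    rw [mul_add, add_assoc]
  simp only [h]
  split_ifs with h1
  · rw [lin_geom]
  · simp

/-- The contracting homotopy at a cell in normal position. -/
lemma bdry_contr_pt (hab : a.Coprime b) (hj : j < a) (k : ℕ) :
    bdry a b (contr a b u (Finsupp.single (pt k (u + a * i + b * j)) 1)) +
      contr a b u (bdry a b (Finsupp.single (pt k (u + a * i + b * j)) 1)) =
        Finsupp.single (pt k (u + a * i + b * j)) 1 := by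
  have g1 := geom_mul b j
  have g2 := geom_mul a i
  rw [contr_pt hab hj, bdry_single, ← lin_T, map_add, bdry_dy,
    LaurentPolynomial.T_add _ (b * j : ℤ)]
  cases k with
  | zero =>
    rw [if_pos rfl, bdry_dx, dCell, contr_single, hCell, ← lin_T]
    have e1 : (T (b : ℤ) - 1) * (geom b j * T (u + a * i)) + (T (a : ℤ) - 1) * (geom a i * T u) +
        T u = T (u + a * i) * T (b * j : ℤ) := by
      rw [LaurentPolynomial.T_add u]
      linear_combination T u * T (a * i : ℤ) * g1 + T u * g2
    have e := congrArg (lin (pt 0)) e1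
    simp only [map_add] at e
    simp only [low, LinearMap.zero_apply, add_zero]
    exact e
  | succ k =>
    rw [if_neg (Nat.succ_ne_zero k), map_zero, dCell, map_sub, contr_dx_geom hab hj,
      contr_dy_geom hab hj]
    have e1 : (T (b : ℤ) - 1) * (geom b j * T (u + a * i)) + T (u + a * i) =
        T (u + a * i) * T (b * j : ℤ) := by
      linear_combination T (u + a * i) * g1
    have e := congrArg (lin (pt (k + 1))) e1
    rw [map_add] at e
    simp only [low]
    linear_combination (norm := abel) e

lemma contr_pt_step (hab : a.Coprime b) (hj : j < a) (k : ℕ) :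
    contr a b u (lin (pt k) ((T (a : ℤ) - 1) * T (u + a * i + b * j))) =
      lin (dy k) (geom b j * ((T (a : ℤ) - 1) * T (u + a * i))) +
        if k = 0 then lin (dx 0) (T (u + a * i)) else 0 := by
  rw [lin_sub, map_sub, contr_pt hab hj,
    show u + a * i + b * j + a = u + a * (i + 1 : ℕ) + b * j by push_cast; ring, contr_pt hab hj,
    sub_mul, mul_sub, map_sub, one_mul, ← LaurentPolynomial.T_add]
  have e : (u + a * (i + 1 : ℕ) : ℤ) = a + (u + a * i) := by push_cast; ring
  rw [e]
  split_ifs with h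
  · have e2 : geom a (i + 1) * T u = geom a i * T u + T (u + a * i) := by
      rw [geom_succ, LaurentPolynomial.T_add]
      ring
    rw [e2, map_add]
    abel
  · abel

lemma bdry_contr_dx (hab : a.Coprime b) (hj : j < a) (k : ℕ) :
    bdry a b (contr a b u (Finsupp.single (dx k (u + a * i + b * j)) 1)) +
      contr a b u (bdry a b (Finsupp.single (dx k (u + a * i + b * j)) 1)) =
        Finsupp.single (dx k (u + a * i + b * j)) 1 := by
  have g1 := geom_mul b j
  rw [contr_dx hab hj, bdry_single, map_neg, bdry_dxy, dCell, map_add, contr_pt_step hab hj,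
    ← lin_T]
  have e1 : (T (b : ℤ) - 1) * (geom b j * T (u + a * i)) + T (u + a * i) =
      T (u + a * i + b * j) := by
    rw [LaurentPolynomial.T_add _ (b * j : ℤ)]
    linear_combination T (u + a * i) * g1
  have e := congrArg (lin (dx k)) e1
  rw [map_add] at e
  rw [mul_left_comm (geom b j)]
  cases k with
  | zero =>
    simp only [low, LinearMap.zero_apply, map_zero, if_true]
    linear_combination (norm := abel) e
  | succ k =>
    simp only [low]
    rw [contr_dxy_geom hab hj, if_neg (Nat.succ_ne_zero k)]
    linear_combination (norm := abel) e

lemma bdry_contr_dy (hab : a.Coprime b) (hj : j < a) (k : ℕ) :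
    bdry a b (contr a b u (Finsupp.single (dy k (u + a * i + b * j)) 1)) +
      contr a b u (bdry a b (Finsupp.single (dy k (u + a * i + b * j)) 1)) =
        Finsupp.single (dy k (u + a * i + b * j)) 1 := by
  rw [contr_dy hab hj, bdry_single, dCell, map_add, lin_sub, map_sub, contr_pt hab hj]
  by_cases h : j + 1 = a
  · have ha : 0 < a := by omega
    have hba : (b * a : ℤ) = b * j + b := by
      rw [← h]
      push_cast
      ring
    rw [if_pos h, show u + a * i + b * j + b = u + a * (i + b : ℕ) + b * (0 : ℕ) by
      push_cast
      linear_combination -hba, contr_pt hab ha, ← lin_T, map_neg, bdry_pt_succ]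
    have e1 : geom b a * T (u + a * i) = geom b j * T (u + a * i) + T (u + a * i + b * j) := by
      rw [← h, geom_succ, LaurentPolynomial.T_add _ (b * j : ℤ)]
      ring
    have e := congrArg (lin (dy k)) e1
    rw [map_add, lin_T] at e
    have e0 : geom b 0 = 0 := by simp [geom]
    rw [e0, zero_mul, map_zero, zero_add]
    cases k with
    | zero =>
      simp only [low, LinearMap.zero_apply, map_zero, if_true]
      have e3 : geom a (i + b) * T u = geom a i * T u + geom a b * T (u + a * i) := by
        rw [geom_add, LaurentPolynomial.T_add]
        ring
      rw [e3, map_add]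
      linear_combination (norm := abel) e
    | succ k =>
      simp only [low]
      rw [contr_dxy_geom' hab hj, if_pos h, if_neg (Nat.succ_ne_zero k)]
      linear_combination (norm := abel) e
  · rw [if_neg h, map_zero, zero_add,
      show u + a * i + b * j + b = u + a * i + b * (j + 1 : ℕ) by push_cast; ring,
      contr_pt hab (show j + 1 < a by omega)]
    have e1 : geom b (j + 1) * T (u + a * i) =
        geom b j * T (u + a * i) + T (u + a * i + b * j) := by
      rw [geom_succ, LaurentPolynomial.T_add _ (b * j : ℤ)]
      ring
    rw [e1, map_add, lin_T]
    cases k with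
    | zero =>
      simp only [low, LinearMap.zero_apply, map_zero]
      abel
    | succ k =>
      simp only [low]
      rw [contr_dxy_geom' hab hj, if_neg h]
      abel

lemma bdry_contr_dxy (hab : a.Coprime b) (hj : j < a) (k : ℕ) :
    bdry a b (contr a b u (Finsupp.single (dxy k (u + a * i + b * j)) 1)) +
      contr a b u (bdry a b (Finsupp.single (dxy k (u + a * i + b * j)) 1)) =
        Finsupp.single (dxy k (u + a * i + b * j)) 1 := by
  rw [contr_dxy hab hj, bdry_single, dCell, map_sub, lin_sub, map_sub, contr_dy hab hj, lin_sub,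
    map_sub, contr_dx hab hj,
    show u + a * i + b * j + a = u + a * (i + 1 : ℕ) + b * j by push_cast; ring, contr_dy hab hj]
  by_cases h : j + 1 = a
  · have ha : 0 < a := by omega
    have hba : (b * a : ℤ) = b * j + b := by
      rw [← h]
      push_cast
      ring
    rw [if_pos h, if_pos h, if_pos h, show u + a * i + b * j + b = u + a * (i + b : ℕ) +
      b * (0 : ℕ) by
        push_cast
        linear_combination -hba, contr_dx hab ha, ← lin_T, bdry_dx, low, lin_sub]
    have e1 : geom b a * T (u + a * i) = geom b j * T (u + a * i) + T (u + a * i + b * j) := by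
      rw [← h, geom_succ, LaurentPolynomial.T_add _ (b * j : ℤ)]
      ring
    have e0 : geom b 0 = 0 := by simp [geom]
    rw [e1, map_add, e0, zero_mul, map_zero, lin_T,
      show u + a * i + a = u + a * (i + 1 : ℕ) by push_cast; ring]
    abel
  · rw [if_neg h, if_neg h, if_neg h, map_zero,
      show u + a * i + b * j + b = u + a * i + b * (j + 1 : ℕ) by push_cast; ring,
      contr_dx hab (show j + 1 < a by omega)]
    have e1 : geom b (j + 1) * T (u + a * i) =
        geom b j * T (u + a * i) + T (u + a * i + b * j) := by
      rw [geom_succ, LaurentPolynomial.T_add _ (b * j : ℤ)]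
      ring
    rw [e1, map_add, lin_T]
    abel

/-- The contraction stays inside every interval with lower end `u`. -/
lemma contr_mem (hab : a.Coprime b) (hj : j < a) {l : Interval a b} (hl : l.lo = u) {c : KCell}
    (hc : c ∈ inside l) (h0 : c ≠ empty) (hz : c.bot = u + a * i + b * j) :
    contr a b u (Finsupp.single c 1) ∈ Finsupp.supported ℤ ℤ (inside l) := by
  have hc' := hc.resolve_left h0
  -- a cell that starts at `u + a p + b q` and whose top lies below that of `c`
  have key : ∀ c' : KCell, ∀ p q p' q' : ℕ, c'.bot = u + a * p + b * q →
      c.top a b = c'.top a b + a * p' + b * q' → c' ∈ inside l := by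
    intro c' p q p' q' h1 h2
    refine Or.inr ⟨⟨p, q, by rw [h1, hl]; ring⟩, ?_⟩
    have h3 : InS a b (c.top a b - c'.top a b) := ⟨p', q', by rw [h2]; ring⟩
    exact h3.trans hc'.2
  have hy : ∀ t < j, ∃ r : ℕ, j = t + r + 1 := fun t ht => Nat.exists_eq_add_of_lt ht
  cases c with
  | empty => exact absurd rfl h0
  | pt k z =>
    change z = _ at hz
    subst hz
    rw [contr_pt hab hj]
    refine Submodule.add_mem _ (lin_geom_mem fun t ht => ?_) ?_
    · obtain ⟨r, hr⟩ := Nat.exists_eq_add_of_lt ht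
      refine key _ i t 0 r rfl ?_
      simp only [top, bot, width, hr]
      push_cast
      ring
    · split_ifs with hk
      · subst hk
        refine lin_geom_mem fun t ht => ?_
        obtain ⟨r, hr⟩ := Nat.exists_eq_add_of_lt ht
        refine key _ t 0 r j (by simp [bot]) ?_
        simp only [top, bot, width, hr]
        push_cast
        ring
      · exact Submodule.zero_mem _
  | dx k z =>
    change z = _ at hz
    subst hz
    rw [contr_dx hab hj]
    refine Submodule.neg_mem _ (lin_geom_mem fun t ht => ?_)
    obtain ⟨r, hr⟩ := Nat.exists_eq_add_of_lt ht
    refine key _ i t 0 r rfl ?_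
    simp only [top, bot, width, hr]
    push_cast
    ring
  | dy k z =>
    change z = _ at hz
    subst hz
    rw [contr_dy hab hj]
    split_ifs with h
    · refine Submodule.neg_mem _ (Finsupp.single_mem_supported ℤ _
        (key _ i 0 0 0 (by simp [bot]) ?_))
      simp only [top, bot, width, ← h]
      push_cast
      ring
    · exact Submodule.zero_mem _
  | dxy k z =>
    change z = _ at hz
    subst hz
    rw [contr_dxy hab hj]
    split_ifs with h
    · refine Finsupp.single_mem_supported ℤ _ (key _ i 0 0 0 (by simp [bot]) ?_)
      simp only [top, bot, width, ← h]
      push_cast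
      ring
    · exact Submodule.zero_mem _

end

variable {a b : ℕ}

lemma bdry_contr (ha : 0 < a) (hab : a.Coprime b) (l : Interval a b) {c : KCell}
    (hc : c ∈ inside l) :
    bdry a b (contr a b l.lo (Finsupp.single c 1)) +
      contr a b l.lo (bdry a b (Finsupp.single c 1)) = Finsupp.single c 1 ∧
    contr a b l.lo (Finsupp.single c 1) ∈ Finsupp.supported ℤ ℤ (inside l) := by
  by_cases h0 : c = empty
  · subst h0
    have h : contr a b l.lo (Finsupp.single empty 1) = Finsupp.single (pt 0 l.lo) 1 :=
      contr_single _ _ _ _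
    rw [h, bdry_single, bdry_single, dCell, dCell, map_zero, add_zero]
    refine ⟨rfl, Finsupp.single_mem_supported ℤ _ (Or.inr ⟨InS.self a b _, ?_⟩)⟩
    simpa [top, bot, width] using l.le
  · obtain ⟨i, j, hij, hj⟩ := (hc.resolve_left h0).1.exists_normalForm ha
    have hz : c.bot = l.lo + a * i + b * j := by linarith
    refine ⟨?_, contr_mem hab hj rfl hc h0 hz⟩
    cases c with
    | empty => exact absurd rfl h0
    | pt k z =>
      change z = _ at hz
      rw [hz]
      exact bdry_contr_pt hab hj k
    | dx k z =>
      change z = _ at hz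
      rw [hz]
      exact bdry_contr_dx hab hj k
    | dy k z =>
      change z = _ at hz
      rw [hz]
      exact bdry_contr_dy hab hj k
    | dxy k z =>
      change z = _ at hz
      rw [hz]
      exact bdry_contr_dxy hab hj k

end KCell

/-- The small complex, filtered by its subcomplexes over the intervals. -/
def koszulComplex {a b : ℕ} (ha : 0 < a) (hab : a.Coprime b) : CellComplex (Interval a b) where
  Cell := KCell
  deg := KCell.deg
  d := KCell.bdry a b
  inside := KCell.inside
  empty := KCell.empty
  d_deg c := by
    rw [KCell.bdry_single]
    exact Finsupp.supported_mono (fun c' hc' => hc'.deg) (KCell.dCell_mem c)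
  d_inside l c hc := by
    rw [KCell.bdry_single]
    exact Finsupp.supported_mono (fun c' hc' => hc'.inside hc) (KCell.dCell_mem c)
  d_d := KCell.bdry_bdry
  deg_empty := rfl
  empty_inside _ := Or.inl rfl
  eq_empty l c _ h := by cases c <;> simp [KCell.deg] at h ⊢
  inside_mono h c hc := hc.imp id fun hc => ⟨h.1.trans hc.1, hc.2.trans h.2⟩
  hull l c hc h := by
    have h0 : c ≠ KCell.empty := fun e => h (e ▸ rfl)
    have hw : InS a b (c.top a b - c.bot) := by
      cases c with
      | empty => exact absurd rfl h0
      | pt k z => exact ⟨k * b, 0, by simp [KCell.top, KCell.width]; ring⟩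
      | dx k z => exact ⟨k * b + 1, 0, by simp [KCell.top, KCell.width]; ring⟩
      | dy k z => exact ⟨k * b, 1, by simp [KCell.top, KCell.width]; ring⟩
      | dxy k z => exact ⟨k * b + 1, 1, by simp [KCell.top, KCell.width]; ring⟩
    exact ⟨⟨c.bot, c.top a b, hw⟩, Or.inr ⟨InS.self a b _, InS.self a b _⟩,
      fun l'' h'' => h''.resolve_left h0⟩
  exact l x hx hd := by
    refine ⟨KCell.contr a b l.lo x,
      map_mem_of_single _ (fun c hc => (KCell.bdry_contr ha hab l hc).2) hx, ?_⟩
    have := map_eq_of_single (KCell.bdry a b ∘ₗ KCell.contr a b l.lo +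
      KCell.contr a b l.lo ∘ₗ KCell.bdry a b) LinearMap.id
      (fun c hc => (KCell.bdry_contr ha hab l hc).1) hx
    simpa [hd] using this

end Contraction

/-! ### Factorizations of geometric sums -/

section Laurent

open LaurentPolynomial (T)

lemma T_one_ne_one : (T 1 - 1 : Lau) ≠ 0 := by
  intro h
  have := congrArg (fun p : Lau => p.coeff 0) h
  rw [← LaurentPolynomial.T_zero] at this
  simp [LaurentPolynomial.T_apply] at this

lemma sub_one_eq_mul_geom (a : ℕ) : (T (a : ℤ) - 1 : Lau) = (T 1 - 1) * geom 1 a := by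
  have := geom_mul 1 a
  simpa using this.symm

lemma geom_one_dvd_geom_mul (m q : ℕ) : geom 1 m ∣ geom 1 (m * q) := by
  induction q with
  | zero => simp [geom]
  | succ q ih =>
    rw [Nat.mul_succ, geom_add]
    exact dvd_add ih (Dvd.intro_left _ rfl)

lemma isCoprime_geom {a b : ℕ} (h : a.Coprime b) : IsCoprime (geom 1 a) (geom 1 b) := by
  induction a, b using Nat.gcd.induction with
  | H0 n =>
    rw [Nat.coprime_zero_left] at h
    subst h
    have : geom 1 1 = 1 := by simp [geom]
    rw [this]
    exact isCoprime_one_right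
  | H1 m n hm ih =>
    have h1 : IsCoprime (geom 1 (n % m)) (geom 1 m) :=
      ih (by rwa [Nat.Coprime, ← Nat.gcd_rec])
    obtain ⟨y, hy⟩ := geom_one_dvd_geom_mul m (n / m)
    conv_rhs => rw [← Nat.mod_add_div n m, geom_add, hy, mul_left_comm]
    exact h1.symm.add_mul_left_right _

lemma aug_geom (n k : ℕ) : KCell.aug (geom n k) = k := by
  simp [geom, KCell.aug_T]

lemma geom_ne_zero {n k : ℕ} (hk : k ≠ 0) : geom n k ≠ 0 := by
  intro h
  have := aug_geom n k
  rw [h, map_zero] at this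
  exact hk (by exact_mod_cast this.symm)

lemma T_sub_one_dvd (n : ℕ) (k : ℤ) : (T (n : ℤ) - 1 : Lau) ∣ T (n * k) - 1 := by
  obtain ⟨k, rfl | rfl⟩ := k.eq_nat_or_neg
  · exact ⟨_, (geom_mul n k).symm⟩
  · refine ⟨-(T (-(n * k : ℤ)) * geom n k), ?_⟩
    have h : (T (-(n * k : ℤ)) * T (n * k : ℤ) : Lau) = 1 := by
      rw [← LaurentPolynomial.T_add, neg_add_cancel, LaurentPolynomial.T_zero]
    rw [mul_neg]
    linear_combination T (-(n * k : ℤ)) * geom_mul n k + h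

/-- A property of Laurent polynomials that is additive holds if it holds for monomials. -/
lemma lau_mem {N : AddSubgroup Lau} (h : ∀ z, T z ∈ N) (p : Lau) : p ∈ N := by
  induction p using LaurentPolynomial.induction_on' with
  | add p q hp hq => exact N.add_mem hp hq
  | C_mul_T z n =>
    have : (LaurentPolynomial.C n * T z : Lau) = n • T z := by
      rw [LaurentPolynomial.smul_eq_C_mul]
    rw [this]
    exact N.zsmul_mem (h z) n

lemma dvd_of_aug_eq_zero {p : Lau} (hp : KCell.aug p = 0) : (T 1 - 1 : Lau) ∣ p := by
  have h : p ∈ ((Ideal.span {(T 1 - 1 : Lau)}).toAddSubgroup.comap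
      (AddMonoidHom.id Lau - (Int.castAddHom Lau).comp KCell.aug.toAddMonoidHom)) := by
    refine lau_mem (fun z => ?_) p
    simp only [AddSubgroup.mem_comap, Submodule.mem_toAddSubgroup, Ideal.mem_span_singleton]
    have := T_sub_one_dvd 1 z
    simpa [KCell.aug_T] using this
  simp only [AddSubgroup.mem_comap, Submodule.mem_toAddSubgroup, Ideal.mem_span_singleton] at h
  simpa [hp] using h

/-- The geometric sum of length `b` in `T ^ a` is divisible by the one in `T`, and likewise with `a`
and `b` exchanged; the cofactor `w` is the same one, because
`(T ^ (a b) - 1) (T - 1) = (T ^ a - 1) (T ^ b - 1) w`. -/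
lemma exists_geom_factor {a b : ℕ} (ha : a ≠ 0) (hb : b ≠ 0) (h : a.Coprime b) :
    ∃ w : Lau, geom a b = geom 1 b * w ∧ geom b a = geom 1 a * w ∧ IsCoprime w (T 1 - 1) := by
  have h1 : geom a b * geom 1 a = geom b a * geom 1 b := by
    have hr := KCell.geom_relation a b
    rw [sub_one_eq_mul_geom, sub_one_eq_mul_geom b] at hr
    refine mul_left_cancel₀ T_one_ne_one ?_
    linear_combination hr
  obtain ⟨w, hw⟩ : geom 1 a ∣ geom b a :=
    (isCoprime_geom h).dvd_of_dvd_mul_right ⟨geom a b, by rw [← h1, mul_comm]⟩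
  have hw' : geom a b = geom 1 b * w := by
    refine mul_right_cancel₀ (geom_ne_zero (n := 1) ha) ?_
    rw [h1, hw]
    ring
  refine ⟨w, hw', hw, ?_⟩
  have hw1 : KCell.aug w = 1 := by
    have := congrArg KCell.aug hw'
    rw [map_mul, aug_geom, aug_geom] at this
    have hb' : (b : ℤ) ≠ 0 := by exact_mod_cast hb
    exact mul_left_cancel₀ hb' (by rw [← this, mul_one])
  obtain ⟨y, hy⟩ := dvd_of_aug_eq_zero (p := w - 1) (by rw [map_sub, hw1, map_one, sub_self])
  exact ⟨1, -y, by linear_combination hy⟩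

end Laurent

/-! ### The homology of the small complex -/

section TopHomology

open LaurentPolynomial (T)

lemma lin_apply {I : Type} {f : ℤ → I} (hf : Function.Injective f) (p : Lau) (z : ℤ) :
    lin f p (f z) = p.coeff z :=
  Finsupp.mapDomain_apply hf _ _

lemma lin_apply_of_ne {I : Type} {f : ℤ → I} (p : Lau) {c : I} (h : ∀ z, f z ≠ c) :
    lin f p c = 0 :=
  Finsupp.mapDomain_of_notMem_range _ _ fun ⟨z, hz⟩ => h z hz

lemma lin_injective {I : Type} {f : ℤ → I} (hf : Function.Injective f) {p q : Lau}
    (h : lin f p = lin f q) : p = q :=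
  LaurentPolynomial.ext fun z => by rw [← lin_apply hf, h, lin_apply hf]

lemma lin_add_lin_eq_zero {I : Type} {f g : ℤ → I} (hf : Function.Injective f)
    (hg : Function.Injective g) (hfg : ∀ y z, f y ≠ g z) {p q : Lau}
    (h : lin f p + lin g q = 0) : p = 0 ∧ q = 0 := by
  constructor
  · ext z
    have := DFunLike.congr_fun h (f z)
    rw [Finsupp.add_apply, lin_apply hf, lin_apply_of_ne q fun y => (hfg z y).symm] at this
    simpa using this
  · ext z
    have := DFunLike.congr_fun h (g z)
    rw [Finsupp.add_apply, lin_apply hg, lin_apply_of_ne p fun y => hfg y z] at this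
    simpa using this

lemma lin_mem {I : Type} {f : ℤ → I} {S : Set I} (h : ∀ z, f z ∈ S) (p : Lau) :
    lin f p ∈ Finsupp.supported ℤ ℤ S := by
  have := lau_mem (N := ((Finsupp.supported ℤ ℤ S).comap (lin f)).toAddSubgroup) (fun z => by
    simp only [Submodule.mem_toAddSubgroup, Submodule.mem_comap, lin_T]
    exact Finsupp.single_mem_supported ℤ _ (h z)) p
  exact this

/-- In the complex with differential `d` and modules `C k`, the homology is concentrated in
degree `n`, where the cycles are the free module of rank one on Laurent polynomials, by way of `e`,
and the boundaries are the multiples of `θ`. -/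
structure IsTopHomology {M : Type} [AddCommGroup M] (d : M →ₗ[ℤ] M) (C : ℕ → Submodule ℤ M)
    (n : ℕ) (θ : Lau) (e : Lau →ₗ[ℤ] M) : Prop where
  exact : ∀ k ≠ n, ∀ x ∈ C k, d x = 0 → ∃ y ∈ C (k + 1), d y = x
  mem : ∀ r, e r ∈ C n
  d_e : ∀ r, d (e r) = 0
  cycle : ∀ x ∈ C n, d x = 0 → ∃ r, x = e r
  boundary : ∀ r, (∃ y ∈ C (n + 1), d y = e r) ↔ θ ∣ r

namespace KCell

lemma pt_injective (k : ℕ) : Function.Injective (pt k) := fun _ _ h => by injection h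
lemma dx_injective (k : ℕ) : Function.Injective (dx k) := fun _ _ h => by injection h
lemma dy_injective (k : ℕ) : Function.Injective (dy k) := fun _ _ h => by injection h
lemma dxy_injective (k : ℕ) : Function.Injective (dxy k) := fun _ _ h => by injection h

/-- The combinations of the cells `f z`, or `0` if `P` does not hold. -/
def linRange (P : Prop) (f : ℤ → KCell) : Submodule ℤ (KCell →₀ ℤ) :=
  ⨆ _ : P, LinearMap.range (lin f)

lemma single_mem_linRange {P : Prop} (h : P) (f : ℤ → KCell) (z : ℤ) :
    Finsupp.single (f z) 1 ∈ linRange P f := by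
  unfold linRange
  rw [iSup_pos h]
  exact ⟨T z, lin_T f z⟩

lemma exists_of_mem_linRange {P : Prop} {f : ℤ → KCell} {x : KCell →₀ ℤ} (hx : x ∈ linRange P f) :
    ∃ p, x = lin f p ∧ (¬P → p = 0) := by
  unfold linRange at hx
  by_cases h : P
  · rw [iSup_pos h] at hx
    obtain ⟨p, rfl⟩ := hx
    exact ⟨p, rfl, fun h' => absurd h h'⟩
  · rw [iSup_neg h, Submodule.mem_bot] at hx
    exact ⟨0, by rw [hx, map_zero], fun _ => rfl⟩

variable {a b : ℕ} {ha : 0 < a} {hab : a.Coprime b} {m : ℕ}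

/-- A cell of the small complex lies in an interval of length `m`; this does not depend on the
position of the cell. -/
def Present (a b m : ℕ) (c : KCell) : Prop := InS a b (m - c.width a b)

lemma exists_windows_inside_iff (hm : InS a b m) (c : KCell) :
    (∃ l ∈ windows a b m, c ∈ inside l) ↔ Present a b m c := by
  unfold Present
  by_cases h0 : c = empty
  · subst h0
    simp only [width, sub_zero, hm, iff_true]
    exact ⟨⟨0, m, by rwa [sub_zero]⟩, by simp [windows], Or.inl rfl⟩
  · constructor
    · rintro ⟨l, hl, hc⟩
      have h := (hc.resolve_left h0).1.add (hc.resolve_left h0).2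
      have hl' : l.hi = l.lo + m := hl
      rwa [hl', show c.bot - l.lo + (l.lo + m - c.top a b) = m - c.width a b by
        simp only [top]; ring] at h
    · intro h
      refine ⟨⟨c.bot, c.bot + m, by rwa [add_sub_cancel_left]⟩, rfl, Or.inr ⟨InS.self a b _, ?_⟩⟩
      convert h using 1
      simp only [top]
      ring

/-- The chains of degree `n` of the small complex over the intervals of length `m`. -/
def kChains (a b m n : ℕ) : Submodule ℤ (KCell →₀ ℤ) :=
  Finsupp.supported ℤ ℤ {c | Present a b m c ∧ c.deg = n}

lemma koszulComplex_chains_windows (hm : InS a b m) (n : ℕ) :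
    (koszulComplex ha hab).chains (windows a b m) n = kChains a b m n := by
  unfold CellComplex.chains kChains
  congr 1
  ext c
  exact and_congr_left fun _ => exists_windows_inside_iff hm c

lemma lin_mem_kChains {f : ℤ → KCell} {n : ℕ} (h : ∀ z, Present a b m (f z) ∧ (f z).deg = n)
    (p : Lau) : lin f p ∈ kChains a b m n :=
  lin_mem (S := {c | Present a b m c ∧ c.deg = n}) h p

lemma exists_of_mem_even {k : ℕ} {x : KCell →₀ ℤ}
    (hx : x ∈ kChains a b m (2 * k + 2)) :
    ∃ p q, x = lin (dx k) p + lin (dy k) q ∧ (¬Present a b m (dx k 0) → p = 0) ∧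
      (¬Present a b m (dy k 0) → q = 0) := by
  have h : x ∈ linRange (Present a b m (dx k 0)) (dx k) ⊔
      linRange (Present a b m (dy k 0)) (dy k) := by
    refine map_mem_of_single LinearMap.id (fun c hc => ?_) hx
    obtain ⟨h1, h2⟩ := hc
    cases c with
    | empty => simp [deg] at h2
    | pt k' z => simp only [deg] at h2; omega
    | dxy k' z => simp only [deg] at h2; omega
    | dx k' z =>
      have : k' = k := by simp only [deg] at h2; omega
      subst this
      exact Submodule.mem_sup_left (single_mem_linRange h1 _ _)
    | dy k' z =>
      have : k' = k := by simp only [deg] at h2; omega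
      subst this
      exact Submodule.mem_sup_right (single_mem_linRange h1 _ _)
  obtain ⟨y, hy, z, hz, rfl⟩ := Submodule.mem_sup.1 h
  obtain ⟨p, rfl, hp⟩ := exists_of_mem_linRange hy
  obtain ⟨q, rfl, hq⟩ := exists_of_mem_linRange hz
  exact ⟨p, q, rfl, hp, hq⟩

lemma exists_of_mem_odd {k : ℕ} {x : KCell →₀ ℤ}
    (hx : x ∈ kChains a b m (2 * k + 3)) :
    ∃ p q, x = lin (pt (k + 1)) p + lin (dxy k) q ∧ (¬Present a b m (pt (k + 1) 0) → p = 0) ∧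
      (¬Present a b m (dxy k 0) → q = 0) := by
  have h : x ∈ linRange (Present a b m (pt (k + 1) 0)) (pt (k + 1)) ⊔
      linRange (Present a b m (dxy k 0)) (dxy k) := by
    refine map_mem_of_single LinearMap.id (fun c hc => ?_) hx
    obtain ⟨h1, h2⟩ := hc
    cases c with
    | empty => simp [deg] at h2
    | dx k' z => simp only [deg] at h2; omega
    | dy k' z => simp only [deg] at h2; omega
    | pt k' z =>
      have : k' = k + 1 := by simp only [deg] at h2; omega
      subst this
      exact Submodule.mem_sup_left (single_mem_linRange h1 _ _)
    | dxy k' z =>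
      have : k' = k := by simp only [deg] at h2; omega
      subst this
      exact Submodule.mem_sup_right (single_mem_linRange h1 _ _)
  obtain ⟨y, hy, z, hz, rfl⟩ := Submodule.mem_sup.1 h
  obtain ⟨p, rfl, hp⟩ := exists_of_mem_linRange hy
  obtain ⟨q, rfl, hq⟩ := exists_of_mem_linRange hz
  exact ⟨p, q, rfl, hp, hq⟩

lemma exists_of_mem_one {x : KCell →₀ ℤ}
    (hx : x ∈ kChains a b m 1) : ∃ p, x = lin (pt 0) p := by
  have h : x ∈ LinearMap.range (lin (pt 0)) := by
    refine map_mem_of_single LinearMap.id (fun c hc => ?_) hx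
    obtain ⟨h1, h2⟩ := hc
    cases c with
    | empty => simp [deg] at h2
    | dx k' z => simp only [deg] at h2; omega
    | dy k' z => simp only [deg] at h2; omega
    | dxy k' z => simp only [deg] at h2; omega
    | pt k' z =>
      have : k' = 0 := by simp only [deg] at h2; omega
      subst this
      exact ⟨T z, lin_T _ z⟩
  obtain ⟨p, rfl⟩ := h
  exact ⟨p, rfl⟩

/-- The cycles of degree `2 k + 2`. -/
def cycEven (a b k : ℕ) : Lau →ₗ[ℤ] (KCell →₀ ℤ) :=
  lin (dx k) ∘ₗ mulL (geom 1 b) - lin (dy k) ∘ₗ mulL (geom 1 a)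

/-- The cycles of degree `2 k + 1`, for the cofactor `w` of `exists_geom_factor`. -/
def cycOdd (w : Lau) (k : ℕ) : Lau →ₗ[ℤ] (KCell →₀ ℤ) :=
  lin (pt k) ∘ₗ mulL (T 1 - 1) + low k ∘ₗ mulL w

lemma cycEven_apply (a b k : ℕ) (r : Lau) :
    cycEven a b k r = lin (dx k) (geom 1 b * r) - lin (dy k) (geom 1 a * r) := rfl

lemma cycOdd_apply (w : Lau) (k : ℕ) (r : Lau) :
    cycOdd w k r = lin (pt k) ((T 1 - 1) * r) + low k (w * r) := rfl

variable {w : Lau}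

lemma bdry_odd (hw : geom a b = geom 1 b * w) (hw' : geom b a = geom 1 a * w) (k : ℕ) (p q : Lau) :
    bdry a b (lin (pt (k + 1)) p + lin (dxy k) q) = cycEven a b k (p * w - q * (T 1 - 1)) := by
  rw [map_add, bdry_pt_succ, bdry_dxy, cycEven_apply, hw, hw', sub_one_eq_mul_geom a,
    sub_one_eq_mul_geom b]
  have e1 : geom 1 b * (p * w - q * (T 1 - 1)) =
      geom 1 b * w * p - (T 1 - 1) * geom 1 b * q := by ring
  have e2 : geom 1 a * (p * w - q * (T 1 - 1)) =
      geom 1 a * w * p - (T 1 - 1) * geom 1 a * q := by ring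
  rw [e1, e2, map_sub, map_sub]
  abel

lemma bdry_even (hw : geom a b = geom 1 b * w) (hw' : geom b a = geom 1 a * w) (k : ℕ)
    (p q : Lau) :
    bdry a b (lin (dx k) p + lin (dy k) q) = cycOdd w k (p * geom 1 a + q * geom 1 b) := by
  rw [map_add, bdry_dx, bdry_dy, cycOdd_apply, hw, hw', sub_one_eq_mul_geom a,
    sub_one_eq_mul_geom b]
  have e1 : (T 1 - 1) * (p * geom 1 a + q * geom 1 b) =
      (T 1 - 1) * geom 1 a * p + (T 1 - 1) * geom 1 b * q := by ring
  have e2 : w * (p * geom 1 a + q * geom 1 b) =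
      geom 1 a * w * p + geom 1 b * w * q := by ring
  rw [e1, e2, map_add, map_add]
  abel

lemma cycEven_injective (hb : b ≠ 0) {k : ℕ} {r : Lau} (h : cycEven a b k r = 0) : r = 0 := by
  rw [cycEven_apply, sub_eq_add_neg, ← map_neg] at h
  have := (lin_add_lin_eq_zero (dx_injective k) (dy_injective k) (fun _ _ h => by cases h) h).1
  exact (mul_eq_zero.1 this).resolve_left (geom_ne_zero hb)

lemma cycOdd_injective {k : ℕ} {r : Lau} (h : cycOdd w k r = 0) : r = 0 := by
  rw [cycOdd_apply] at h
  have : (T 1 - 1) * r = 0 := by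
    cases k with
    | zero =>
      rw [low, LinearMap.zero_apply, add_zero] at h
      exact lin_injective (pt_injective 0) (by rw [h, map_zero])
    | succ k =>
      exact (lin_add_lin_eq_zero (pt_injective _) (dxy_injective k) (fun _ _ h => by cases h) h).1
  exact (mul_eq_zero.1 this).resolve_left T_one_ne_one

lemma bdry_cycEven (hw : geom a b = geom 1 b * w) (hw' : geom b a = geom 1 a * w) (k : ℕ)
    (r : Lau) : bdry a b (cycEven a b k r) = 0 := by
  rw [cycEven_apply, sub_eq_add_neg, ← map_neg, bdry_even hw hw']
  convert map_zero (cycOdd w k) using 2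
  ring

lemma bdry_cycOdd (hw : geom a b = geom 1 b * w) (hw' : geom b a = geom 1 a * w) (k : ℕ)
    (r : Lau) : bdry a b (cycOdd w k r) = 0 := by
  rw [cycOdd_apply]
  cases k with
  | zero =>
    rw [low, LinearMap.zero_apply, add_zero, bdry_pt_zero, map_mul, map_sub, aug_T, map_one,
      sub_self, zero_mul, zero_smul]
  | succ k =>
    rw [low, bdry_odd hw hw']
    convert map_zero (cycEven a b k) using 2
    ring

lemma exists_cycEven (hb : b ≠ 0) (hab : a.Coprime b) (hw : geom a b = geom 1 b * w)
    (hw' : geom b a = geom 1 a * w) {k : ℕ} {p q : Lau}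
    (h : bdry a b (lin (dx k) p + lin (dy k) q) = 0) :
    ∃ r, lin (dx k) p + lin (dy k) q = cycEven a b k r ∧ p = geom 1 b * r ∧
      q = -(geom 1 a * r) := by
  rw [bdry_even hw hw'] at h
  have h1 := cycOdd_injective h
  obtain ⟨r, hr⟩ : geom 1 b ∣ p :=
    (isCoprime_geom hab).symm.dvd_of_dvd_mul_right ⟨-q, by linear_combination h1⟩
  have hq : q = -(geom 1 a * r) := by
    refine mul_left_cancel₀ (geom_ne_zero (n := 1) hb) ?_
    rw [hr] at h1
    linear_combination h1
  exact ⟨r, by rw [cycEven_apply, hr, hq, map_neg, sub_eq_add_neg], hr, hq⟩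

lemma exists_cycOdd (hb : b ≠ 0) (hw : geom a b = geom 1 b * w)
    (hw' : geom b a = geom 1 a * w) (hwc : IsCoprime w (T 1 - 1)) {k : ℕ} {p q : Lau}
    (h : bdry a b (lin (pt (k + 1)) p + lin (dxy k) q) = 0) :
    ∃ r, lin (pt (k + 1)) p + lin (dxy k) q = cycOdd w (k + 1) r ∧ p = (T 1 - 1) * r ∧
      q = w * r := by
  rw [bdry_odd hw hw'] at h
  have h1 := cycEven_injective hb h
  obtain ⟨r, hr⟩ : (T 1 - 1 : Lau) ∣ p :=
    hwc.symm.dvd_of_dvd_mul_right ⟨q, by linear_combination h1⟩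
  have hq : q = w * r := by
    refine mul_left_cancel₀ T_one_ne_one ?_
    rw [hr] at h1
    linear_combination -h1
  exact ⟨r, by rw [cycOdd_apply, hr, hq, low], hr, hq⟩

end KCell

end TopHomology

section TruncatedHomology

open LaurentPolynomial (T)

namespace KCell

/-- The assumptions for the computation of the homology of the small complex; `w` is the cofactor of
`exists_geom_factor`. -/
structure Setup (a b m : ℕ) (w : Lau) : Prop where
  ha : 0 < a
  hb : b ≠ 0
  hab : a.Coprime b
  hm : InS a b m
  hw : geom a b = geom 1 b * w
  hw' : geom b a = geom 1 a * w
  hwc : IsCoprime w (T 1 - 1)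

variable {a b m : ℕ} {w : Lau}

lemma exact_zero (s : Setup a b m w) {x : KCell →₀ ℤ} (hx : x ∈ kChains a b m 0) :
    ∃ y ∈ kChains a b m 1, bdry a b y = x := by
  have h : x ∈ Submodule.span ℤ {Finsupp.single empty (1 : ℤ)} := by
    refine map_mem_of_single LinearMap.id (fun c hc => ?_) hx
    obtain ⟨h1, h2⟩ := hc
    cases c with
    | empty => exact Submodule.mem_span_singleton_self _
    | pt k' z => simp [deg] at h2
    | dx k' z => simp [deg] at h2
    | dy k' z => simp [deg] at h2
    | dxy k' z => simp [deg] at h2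
  obtain ⟨r, rfl⟩ := Submodule.mem_span_singleton.1 h
  have hp : ∀ z, Present a b m (pt 0 z) ∧ (pt 0 z).deg = 1 := fun z =>
    ⟨by simpa [Present, width] using s.hm, rfl⟩
  refine ⟨lin (pt 0) (r • T 0), lin_mem_kChains hp _, ?_⟩
  rw [bdry_pt_zero, map_zsmul, aug_T, smul_eq_mul, mul_one]

/-- In odd degree `2 k + 1` there are only cycles of the form `cycOdd w k r`. -/
lemma eq_cycOdd (s : Setup a b m w) {k : ℕ} {x : KCell →₀ ℤ} (hx : x ∈ kChains a b m (2 * k + 1))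
    (hd : bdry a b x = 0) : ∃ r, x = cycOdd w k r ∧ (¬Present a b m (pt k 0) → r = 0) ∧
      ∀ k', k = k' + 1 → ¬Present a b m (dxy k' 0) → r = 0 := by
  cases k with
  | zero =>
    obtain ⟨p, rfl⟩ := exists_of_mem_one hx
    rw [bdry_pt_zero, smul_eq_zero] at hd
    obtain ⟨r, rfl⟩ := dvd_of_aug_eq_zero (hd.resolve_right (by simp))
    refine ⟨r, by rw [cycOdd_apply, low, LinearMap.zero_apply, add_zero], fun h => ?_, ?_⟩
    · refine absurd ?_ h
      simpa [Present, width] using s.hm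
    · intro k' h
      exact absurd h (Nat.succ_ne_zero k').symm
  | succ k =>
    obtain ⟨p, q, rfl, hp, hq⟩ := exists_of_mem_odd hx
    obtain ⟨r, hr, hpr, hqr⟩ := exists_cycOdd s.hb s.hw s.hw' s.hwc hd
    refine ⟨r, hr, fun h => ?_, fun k' hk' h => ?_⟩
    · rw [hp h] at hpr
      exact (mul_eq_zero.1 hpr.symm).resolve_left T_one_ne_one
    · have : k' = k := by omega
      subst this
      rw [hq h] at hqr
      refine (mul_eq_zero.1 hqr.symm).resolve_left fun h0 => ?_
      have h1 := s.hw
      rw [h0, mul_zero] at h1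
      exact geom_ne_zero s.hb h1

lemma eq_cycEven (s : Setup a b m w) {k : ℕ} {x : KCell →₀ ℤ} (hx : x ∈ kChains a b m (2 * k + 2))
    (hd : bdry a b x = 0) : ∃ r, x = cycEven a b k r ∧ (¬Present a b m (dx k 0) → r = 0) ∧
      (¬Present a b m (dy k 0) → r = 0) := by
  obtain ⟨p, q, rfl, hp, hq⟩ := exists_of_mem_even hx
  obtain ⟨r, hr, hpr, hqr⟩ := exists_cycEven s.hb s.hab s.hw s.hw' hd
  refine ⟨r, hr, fun h => ?_, fun h => ?_⟩
  · rw [hp h] at hpr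
    exact (mul_eq_zero.1 hpr.symm).resolve_left (geom_ne_zero s.hb)
  · rw [hq h, eq_comm, neg_eq_zero] at hqr
    exact (mul_eq_zero.1 hqr).resolve_left (geom_ne_zero s.ha.ne')

lemma dx_mem {k : ℕ} (h : Present a b m (dx k 0)) (p : Lau) :
    lin (dx k) p ∈ kChains a b m (2 * k + 2) :=
  lin_mem_kChains (f := dx k) (fun _ => ⟨h, rfl⟩) p

lemma dy_mem {k : ℕ} (h : Present a b m (dy k 0)) (p : Lau) :
    lin (dy k) p ∈ kChains a b m (2 * k + 2) :=
  lin_mem_kChains (f := dy k) (fun _ => ⟨h, rfl⟩) p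

lemma pt_mem {k : ℕ} (h : Present a b m (pt k 0)) (p : Lau) :
    lin (pt k) p ∈ kChains a b m (2 * k + 1) :=
  lin_mem_kChains (f := pt k) (fun _ => ⟨h, rfl⟩) p

lemma dxy_mem {k : ℕ} (h : Present a b m (dxy k 0)) (p : Lau) :
    lin (dxy k) p ∈ kChains a b m (2 * k + 3) :=
  lin_mem_kChains (f := dxy k) (fun _ => ⟨h, rfl⟩) p

lemma cycEven_mem {k : ℕ} (hx : Present a b m (dx k 0)) (hy : Present a b m (dy k 0)) (r : Lau) :
    cycEven a b k r ∈ kChains a b m (2 * k + 2) :=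
  Submodule.sub_mem _ (dx_mem hx _) (dy_mem hy _)

lemma exact_odd (s : Setup a b m w) {k : ℕ} (hx : Present a b m (dx k 0))
    (hy : Present a b m (dy k 0)) (r : Lau) :
    ∃ y ∈ kChains a b m (2 * k + 2), bdry a b y = cycOdd w k r := by
  obtain ⟨p, q, hpq⟩ := isCoprime_geom s.hab
  refine ⟨_, Submodule.add_mem _ (dx_mem hx (r * p)) (dy_mem hy (r * q)), ?_⟩
  rw [bdry_even s.hw s.hw']
  congr 1
  linear_combination r * hpq

lemma exact_even (s : Setup a b m w) {k : ℕ} (h : Present a b m (pt (k + 1) 0))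
    (h' : Present a b m (dxy k 0)) (r : Lau) :
    ∃ y ∈ kChains a b m (2 * k + 3), bdry a b y = cycEven a b k r := by
  obtain ⟨p, q, hpq⟩ := s.hwc
  refine ⟨_, Submodule.add_mem _ (pt_mem h (r * p)) (dxy_mem h' (-(r * q))), ?_⟩
  rw [bdry_odd s.hw s.hw']
  congr 1
  linear_combination r * hpq

/-- Every degree is `0`, or twice a natural number plus one or two. -/
lemma exact_of_cases (s : Setup a b m w) {n : ℕ}
    (h1 : ∀ k, 2 * k + 1 ≠ n → ∀ x ∈ kChains a b m (2 * k + 1),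
      bdry a b x = 0 → ∃ y ∈ kChains a b m (2 * k + 2), bdry a b y = x)
    (h2 : ∀ k, 2 * k + 2 ≠ n → ∀ x ∈ kChains a b m (2 * k + 2),
      bdry a b x = 0 → ∃ y ∈ kChains a b m (2 * k + 3), bdry a b y = x) :
    ∀ k ≠ n, ∀ x ∈ kChains a b m k, bdry a b x = 0 →
      ∃ y ∈ kChains a b m (k + 1), bdry a b y = x := by
  intro k hk x hx hd
  rcases Nat.even_or_odd' k with ⟨j, rfl | rfl⟩
  · cases j with
    | zero => exact exact_zero s hx
    | succ j => exact h2 j hk x hx hd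
  · exact h1 j hk x hx hd

lemma exact_of_eq_zero {n : ℕ} {x : KCell →₀ ℤ} (h : x = 0) :
    ∃ y ∈ kChains a b m n, bdry a b y = x :=
  ⟨0, Submodule.zero_mem _, by rw [h, map_zero]⟩

/-- The homology if neither `a` nor `b` divides `m`. -/
theorem isTopHomology_neither (s : Setup a b m w) {L : ℕ} (hL : 0 < L)
    (hpt : ∀ k, Present a b m (pt k 0) ↔ k < L)
    (hdx : ∀ k, Present a b m (dx k 0) ↔ k < L) (hdy : ∀ k, Present a b m (dy k 0) ↔ k < L)
    (hdxy : ∀ k, Present a b m (dxy k 0) ↔ k < L) :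
    IsTopHomology (bdry a b) (kChains a b m) (2 * L) (T 1 - 1)
      (cycEven a b (L - 1)) where
  exact := exact_of_cases s (fun k hk x hx hd => by
      obtain ⟨r, rfl, h1, -⟩ := eq_cycOdd s hx hd
      by_cases h : k < L
      · exact exact_odd s ((hdx k).2 h) ((hdy k).2 h) r
      · exact exact_of_eq_zero (by rw [h1 (by rwa [hpt]), map_zero]))
    (fun k hk x hx hd => by
      obtain ⟨r, rfl, h1, -⟩ := eq_cycEven s hx hd
      by_cases h : k < L
      · exact exact_even s ((hpt _).2 (by omega)) ((hdxy k).2 h) r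
      · exact exact_of_eq_zero (by rw [h1 (by rwa [hdx]), map_zero]))
  mem r := by
    have := cycEven_mem ((hdx (L - 1)).2 (by omega)) ((hdy (L - 1)).2 (by omega)) r
    rwa [show 2 * (L - 1) + 2 = 2 * L by omega] at this
  d_e r := bdry_cycEven s.hw s.hw' _ r
  cycle x hx hd := by
    rw [show 2 * L = 2 * (L - 1) + 2 by omega] at hx
    obtain ⟨r, hr, -⟩ := eq_cycEven s hx hd
    exact ⟨r, hr⟩
  boundary r := by
    rw [show 2 * L + 1 = 2 * (L - 1) + 3 by omega]
    constructor
    · rintro ⟨y, hy, hd⟩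
      obtain ⟨p, q, rfl, hp, -⟩ := exists_of_mem_odd hy
      have hd' := (bdry_odd s.hw s.hw' (L - 1) p q).symm.trans hd
      rw [hp (by rw [hpt]; omega), ← sub_eq_zero, ← map_sub] at hd'
      have := cycEven_injective s.hb hd'
      exact ⟨-q, by linear_combination -this⟩
    · rintro ⟨q, rfl⟩
      refine ⟨_, dxy_mem ((hdxy (L - 1)).2 (by omega)) (-q), ?_⟩
      have := bdry_odd s.hw s.hw' (L - 1) 0 (-q)
      rw [map_zero, zero_add] at this
      refine this.trans (congrArg _ ?_)
      ring

/-- The homology if `a` divides `m` and `b` does not. -/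
theorem isTopHomology_left (s : Setup a b m w) {L : ℕ} (hpt : ∀ k, Present a b m (pt k 0) ↔ k ≤ L)
    (hdx : ∀ k, Present a b m (dx k 0) ↔ k ≤ L) (hdy : ∀ k, Present a b m (dy k 0) ↔ k < L)
    (hdxy : ∀ k, Present a b m (dxy k 0) ↔ k < L) :
    IsTopHomology (bdry a b) (kChains a b m) (2 * L + 1) (geom 1 a)
      (cycOdd w L) where
  exact := exact_of_cases s (fun k hk x hx hd => by
      obtain ⟨r, rfl, h1, -⟩ := eq_cycOdd s hx hd
      by_cases h : k < L
      · exact exact_odd s ((hdx k).2 h.le) ((hdy k).2 h) r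
      · exact exact_of_eq_zero (by rw [h1 (by rw [hpt]; omega), map_zero]))
    (fun k hk x hx hd => by
      obtain ⟨r, rfl, -, h1⟩ := eq_cycEven s hx hd
      by_cases h : k < L
      · exact exact_even s ((hpt _).2 (by omega)) ((hdxy k).2 h) r
      · exact exact_of_eq_zero (by rw [h1 (by rwa [hdy]), map_zero]))
  mem r := by
    refine Submodule.add_mem _ (pt_mem ((hpt L).2 le_rfl) _) ?_
    cases L with
    | zero => exact Submodule.zero_mem _
    | succ L => exact dxy_mem ((hdxy L).2 (Nat.lt_succ_self L)) _
  d_e r := bdry_cycOdd s.hw s.hw' _ r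
  cycle x hx hd := by
    obtain ⟨r, hr, -⟩ := eq_cycOdd s hx hd
    exact ⟨r, hr⟩
  boundary r := by
    constructor
    · rintro ⟨y, hy, hd⟩
      obtain ⟨p, q, rfl, -, hq⟩ := exists_of_mem_even hy
      have hd' := (bdry_even s.hw s.hw' L p q).symm.trans hd
      rw [hq (by rw [hdy]; omega), ← sub_eq_zero, ← map_sub] at hd'
      have := cycOdd_injective hd'
      exact ⟨p, by linear_combination -this⟩
    · rintro ⟨p, rfl⟩
      refine ⟨_, dx_mem ((hdx L).2 le_rfl) p, ?_⟩
      have := bdry_even s.hw s.hw' L p 0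
      rw [map_zero, add_zero] at this
      refine this.trans (congrArg _ ?_)
      ring

/-- The homology if `b` divides `m` and `a` does not. -/
theorem isTopHomology_right (s : Setup a b m w) {L : ℕ} (hpt : ∀ k, Present a b m (pt k 0) ↔ k ≤ L)
    (hdx : ∀ k, Present a b m (dx k 0) ↔ k < L) (hdy : ∀ k, Present a b m (dy k 0) ↔ k ≤ L)
    (hdxy : ∀ k, Present a b m (dxy k 0) ↔ k < L) :
    IsTopHomology (bdry a b) (kChains a b m) (2 * L + 1) (geom 1 b)
      (cycOdd w L) where
  exact := exact_of_cases s (fun k hk x hx hd => by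
      obtain ⟨r, rfl, h1, -⟩ := eq_cycOdd s hx hd
      by_cases h : k < L
      · exact exact_odd s ((hdx k).2 h) ((hdy k).2 h.le) r
      · exact exact_of_eq_zero (by rw [h1 (by rw [hpt]; omega), map_zero]))
    (fun k hk x hx hd => by
      obtain ⟨r, rfl, h1, -⟩ := eq_cycEven s hx hd
      by_cases h : k < L
      · exact exact_even s ((hpt _).2 (by omega)) ((hdxy k).2 h) r
      · exact exact_of_eq_zero (by rw [h1 (by rwa [hdx]), map_zero]))
  mem r := by
    refine Submodule.add_mem _ (pt_mem ((hpt L).2 le_rfl) _) ?_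
    cases L with
    | zero => exact Submodule.zero_mem _
    | succ L => exact dxy_mem ((hdxy L).2 (Nat.lt_succ_self L)) _
  d_e r := bdry_cycOdd s.hw s.hw' _ r
  cycle x hx hd := by
    obtain ⟨r, hr, -⟩ := eq_cycOdd s hx hd
    exact ⟨r, hr⟩
  boundary r := by
    constructor
    · rintro ⟨y, hy, hd⟩
      obtain ⟨p, q, rfl, hp, -⟩ := exists_of_mem_even hy
      have hd' := (bdry_even s.hw s.hw' L p q).symm.trans hd
      rw [hp (by rw [hdx]; omega), ← sub_eq_zero, ← map_sub] at hd'
      have := cycOdd_injective hd'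
      exact ⟨q, by linear_combination -this⟩
    · rintro ⟨q, rfl⟩
      refine ⟨_, dy_mem ((hdy L).2 le_rfl) q, ?_⟩
      have := bdry_even s.hw s.hw' L 0 q
      rw [map_zero, zero_add] at this
      refine this.trans (congrArg _ ?_)
      ring

/-- The homology if both `a` and `b` divide `m`. -/
theorem isTopHomology_both (s : Setup a b m w) {L : ℕ}
    (hpt : ∀ k, Present a b m (pt k 0) ↔ k ≤ L + 1)
    (hdx : ∀ k, Present a b m (dx k 0) ↔ k ≤ L) (hdy : ∀ k, Present a b m (dy k 0) ↔ k ≤ L)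
    (hdxy : ∀ k, Present a b m (dxy k 0) ↔ k < L) :
    IsTopHomology (bdry a b) (kChains a b m) (2 * L + 2) w
      (cycEven a b L) where
  exact := exact_of_cases s (fun k hk x hx hd => by
      obtain ⟨r, rfl, -, h1⟩ := eq_cycOdd s hx hd
      by_cases h : k ≤ L
      · exact exact_odd s ((hdx k).2 h) ((hdy k).2 h) r
      · exact exact_of_eq_zero (by
          rw [h1 (k - 1) (by omega) (by rw [hdxy]; omega), map_zero]))
    (fun k hk x hx hd => by
      obtain ⟨r, rfl, h1, -⟩ := eq_cycEven s hx hd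
      by_cases h : k < L
      · exact exact_even s ((hpt _).2 (by omega)) ((hdxy k).2 h) r
      · exact exact_of_eq_zero (by rw [h1 (by rw [hdx]; omega), map_zero]))
  mem r := cycEven_mem ((hdx L).2 le_rfl) ((hdy L).2 le_rfl) r
  d_e r := bdry_cycEven s.hw s.hw' _ r
  cycle x hx hd := by
    obtain ⟨r, hr, -⟩ := eq_cycEven s hx hd
    exact ⟨r, hr⟩
  boundary r := by
    constructor
    · rintro ⟨y, hy, hd⟩
      obtain ⟨p, q, rfl, -, hq⟩ := exists_of_mem_odd hy
      have hd' := (bdry_odd s.hw s.hw' L p q).symm.trans hd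
      rw [hq (by rw [hdxy]; omega), ← sub_eq_zero, ← map_sub] at hd'
      have := cycEven_injective s.hb hd'
      exact ⟨p, by linear_combination -this⟩
    · rintro ⟨p, rfl⟩
      refine ⟨_, pt_mem ((hpt (L + 1)).2 le_rfl) p, ?_⟩
      have := bdry_odd s.hw s.hw' L p 0
      rw [map_zero, add_zero] at this
      refine this.trans (congrArg _ ?_)
      ring

end KCell

end TruncatedHomology

/-! ### Representations of `m` as a sum of `a`'s and `b`'s -/

section Ell

variable {a b m : ℕ}

/-- `k < ℓ(a,b,m)` if and only if `m - k a b` is a sum of a positive number of `a`'s and a positive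
number of `b`'s. -/
lemma lt_ell_iff (ha : 0 < a) (hb : 0 < b) (hab : a.Coprime b) (k : ℕ) :
    k < ell a b m ↔ ∃ i j : ℕ, 0 < i ∧ 0 < j ∧ m = a * i + b * j + k * (a * b) := by
  have hfin : {p : ℕ × ℕ | 0 < p.1 ∧ 0 < p.2 ∧ m = a * p.1 + b * p.2}.Finite := by
    refine ((Set.finite_Iic m).prod (Set.finite_Iic m)).subset fun p hp => ?_
    have h1 := Nat.le_mul_of_pos_left p.1 ha
    have h2 := Nat.le_mul_of_pos_left p.2 hb
    have h3 : m = a * p.1 + b * p.2 := hp.2.2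
    exact ⟨by simp only [Set.mem_Iic]; omega, by simp only [Set.mem_Iic]; omega⟩
  constructor
  · contrapose!
    intro h
    have hle : ∀ p : ℕ × ℕ, 0 < p.1 → 0 < p.2 → m = a * p.1 + b * p.2 → p.2 ≤ k * a := by
      intro p h1 h2 h3
      by_contra! hlt
      obtain ⟨r, hr⟩ := Nat.exists_eq_add_of_lt hlt
      refine h p.1 (r + 1) h1 (Nat.succ_pos r) ?_
      rw [h3, hr]
      ring
    have hk := Set.ncard_le_ncard_of_injOn (s := {p : ℕ × ℕ | 0 < p.1 ∧ 0 < p.2 ∧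
      m = a * p.1 + b * p.2}) (t := (Finset.range k : Set ℕ)) (fun p => (p.2 - 1) / a) ?_ ?_
      (Finset.finite_toSet _)
    · rwa [Set.ncard_coe_finset, Finset.card_range] at hk
    · rintro p ⟨h1, h2, h3⟩
      rw [Finset.coe_range, Set.mem_Iio]
      refine Nat.div_lt_of_lt_mul ?_
      have := hle p h1 h2 h3
      rw [mul_comm]
      omega
    -- all the numbers `j` in question are congruent modulo `a`
    · rintro ⟨i, j⟩ ⟨h1, h2, h3⟩ ⟨i', j'⟩ ⟨h1', h2', h3'⟩ he
      simp only at h1 h2 h3 h1' h2' h3' he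
      have hm : b * j ≡ b * j' [MOD a] := by
        have e : (a * i + b * j) % a = (a * i' + b * j') % a := by rw [← h3, ← h3']
        simpa [Nat.add_mod, Nat.ModEq] using e
      have hm' : j ≡ j' [MOD a] := Nat.ModEq.cancel_left_of_coprime hab hm
      have hm'' : (j - 1) ≡ (j' - 1) [MOD a] := by
        refine Nat.ModEq.add_right_cancel' 1 ?_
        rwa [Nat.sub_add_cancel h2, Nat.sub_add_cancel h2']
      have hjj : j - 1 = j' - 1 := by
        rw [← Nat.div_add_mod (j - 1) a, ← Nat.div_add_mod (j' - 1) a, he, hm'']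
      have hj : j = j' := by omega
      subst hj
      have hi : a * i = a * i' := by omega
      rw [Nat.eq_of_mul_eq_mul_left ha hi]
  · rintro ⟨i, j, hi, hj, h⟩
    have hk := Set.ncard_le_ncard_of_injOn (s := (Finset.range (k + 1) : Set ℕ))
      (t := {p : ℕ × ℕ | 0 < p.1 ∧ 0 < p.2 ∧ m = a * p.1 + b * p.2})
      (fun t => (i + t * b, j + (k - t) * a)) ?_ ?_ hfin
    · rw [Set.ncard_coe_finset, Finset.card_range] at hk
      exact hk
    · intro t ht
      rw [Finset.coe_range, Set.mem_Iio] at ht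
      refine ⟨by simp only; omega, by simp only; omega, ?_⟩
      obtain ⟨r, rfl⟩ := Nat.exists_eq_add_of_le (Nat.lt_succ_iff.1 ht)
      rw [h, Nat.add_sub_cancel_left]
      ring
    · intro t _ t' _ he
      have h1 : i + t * b = i + t' * b := congrArg Prod.fst he
      exact Nat.eq_of_mul_eq_mul_right hb (by omega)

namespace KCell

lemma present_iff {c : KCell} {n : ℕ} (h : c.width a b = n) :
    Present a b m c ↔ ∃ i j : ℕ, m = a * i + b * j + n := by
  unfold Present InS
  rw [h]
  refine exists_congr fun i => exists_congr fun j => ?_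
  rw [sub_eq_iff_eq_add]
  norm_cast

lemma present_pt (k : ℕ) : Present a b m (pt k 0) ↔
    ∃ i j : ℕ, m = a * i + b * j + k * (a * b) :=
  present_iff (by simp [width])

lemma present_dx (k : ℕ) : Present a b m (dx k 0) ↔
    ∃ i j : ℕ, 0 < i ∧ m = a * i + b * j + k * (a * b) := by
  rw [present_iff (n := k * (a * b) + a) (by simp [width])]
  constructor
  · rintro ⟨i, j, h⟩
    exact ⟨i + 1, j, Nat.succ_pos i, by rw [h]; ring⟩
  · rintro ⟨i, j, hi, h⟩
    obtain ⟨r, rfl⟩ := Nat.exists_eq_succ_of_ne_zero hi.ne'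
    exact ⟨r, j, by rw [h, Nat.succ_eq_add_one]; ring⟩

lemma present_dy (k : ℕ) : Present a b m (dy k 0) ↔
    ∃ i j : ℕ, 0 < j ∧ m = a * i + b * j + k * (a * b) := by
  rw [present_iff (n := k * (a * b) + b) (by simp [width])]
  constructor
  · rintro ⟨i, j, h⟩
    exact ⟨i, j + 1, Nat.succ_pos j, by rw [h]; ring⟩
  · rintro ⟨i, j, hj, h⟩
    obtain ⟨r, rfl⟩ := Nat.exists_eq_succ_of_ne_zero hj.ne'
    exact ⟨i, r, by rw [h, Nat.succ_eq_add_one]; ring⟩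

lemma present_dxy (ha : 0 < a) (hb : 0 < b) (hab : a.Coprime b) (k : ℕ) :
    Present a b m (dxy k 0) ↔ k < ell a b m := by
  rw [present_iff (n := k * (a * b) + a + b) (by simp [width]), lt_ell_iff ha hb hab]
  constructor
  · rintro ⟨i, j, h⟩
    exact ⟨i + 1, j + 1, Nat.succ_pos i, Nat.succ_pos j, by rw [h]; ring⟩
  · rintro ⟨i, j, hi, hj, h⟩
    obtain ⟨r, rfl⟩ := Nat.exists_eq_succ_of_ne_zero hi.ne'
    obtain ⟨r', rfl⟩ := Nat.exists_eq_succ_of_ne_zero hj.ne'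
    exact ⟨r, r', by rw [h, Nat.succ_eq_add_one, Nat.succ_eq_add_one]; ring⟩

lemma left_pos_of_not_dvd (h : ¬b ∣ m) {i j k : ℕ} (e : m = a * i + b * j + k * (a * b)) :
    0 < i := by
  rcases Nat.eq_zero_or_pos i with rfl | hi
  · exact absurd ⟨j + k * a, by rw [e]; ring⟩ h
  · exact hi

lemma right_pos_of_not_dvd (h : ¬a ∣ m) {i j k : ℕ} (e : m = a * i + b * j + k * (a * b)) :
    0 < j := by
  rcases Nat.eq_zero_or_pos j with rfl | hj
  · exact absurd ⟨i + k * b, by rw [e]; ring⟩ h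
  · exact hj

lemma dvd_of_left_dvd (hab : a.Coprime b) (h : a ∣ m) {i j k : ℕ}
    (e : m = a * i + b * j + k * (a * b)) : a ∣ j := by
  refine hab.dvd_of_dvd_mul_left ?_
  have h1 : a ∣ a * i + k * (a * b) := ⟨i + k * b, by ring⟩
  refine (Nat.dvd_add_right h1).1 ?_
  rwa [show a * i + k * (a * b) + b * j = m by rw [e]; ring]

lemma dvd_of_right_dvd (hab : a.Coprime b) (h : b ∣ m) {i j k : ℕ}
    (e : m = a * i + b * j + k * (a * b)) : b ∣ i := by
  refine hab.symm.dvd_of_dvd_mul_left ?_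
  have h1 : b ∣ b * j + k * (a * b) := ⟨j + k * a, by ring⟩
  refine (Nat.dvd_add_right h1).1 ?_
  rwa [show b * j + k * (a * b) + a * i = m by rw [e]; ring]

/-- The cells `γ_k` fit one step further if `a ∣ m`. -/
lemma present_pt_of_left_dvd (ha : 0 < a) (hb : 0 < b) (hab : a.Coprime b) (hm : IsSum a b m)
    (h : a ∣ m) (h' : ¬b ∣ m) (k : ℕ) : Present a b m (pt k 0) ↔ k ≤ ell a b m := by
  rw [present_pt]
  cases k with
  | zero => simpa [IsSum] using hm
  | succ k =>
    rw [Nat.succ_le_iff, lt_ell_iff ha hb hab]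
    constructor
    · rintro ⟨i, j, e⟩
      exact ⟨i, j + a, left_pos_of_not_dvd h' e, by omega, by rw [e]; ring⟩
    · rintro ⟨i, j, _, hj, e⟩
      obtain ⟨r, rfl⟩ := dvd_of_left_dvd hab h e
      obtain ⟨r, rfl⟩ := Nat.exists_eq_succ_of_ne_zero (pos_of_mul_pos_right hj (Nat.zero_le a)).ne'
      exact ⟨i, a * r, by rw [e, Nat.succ_eq_add_one]; ring⟩

lemma present_pt_of_right_dvd (ha : 0 < a) (hb : 0 < b) (hab : a.Coprime b) (hm : IsSum a b m)
    (h : ¬a ∣ m) (h' : b ∣ m) (k : ℕ) : Present a b m (pt k 0) ↔ k ≤ ell a b m := by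
  rw [present_pt]
  cases k with
  | zero => simpa [IsSum] using hm
  | succ k =>
    rw [Nat.succ_le_iff, lt_ell_iff ha hb hab]
    constructor
    · rintro ⟨i, j, e⟩
      exact ⟨i + b, j, by omega, right_pos_of_not_dvd h e, by rw [e]; ring⟩
    · rintro ⟨i, j, hi, _, e⟩
      obtain ⟨r, rfl⟩ := dvd_of_right_dvd hab h' e
      obtain ⟨r, rfl⟩ := Nat.exists_eq_succ_of_ne_zero (pos_of_mul_pos_right hi (Nat.zero_le b)).ne'
      exact ⟨b * r, j, by rw [e, Nat.succ_eq_add_one]; ring⟩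

lemma present_dx_of_not_dvd (h : ¬b ∣ m) (k : ℕ) :
    Present a b m (dx k 0) ↔ Present a b m (pt k 0) := by
  rw [present_dx, present_pt]
  exact exists_congr fun i => exists_congr fun j =>
    ⟨fun e => e.2, fun e => ⟨left_pos_of_not_dvd h e, e⟩⟩

lemma present_dy_of_not_dvd (h : ¬a ∣ m) (k : ℕ) :
    Present a b m (dy k 0) ↔ Present a b m (pt k 0) := by
  rw [present_dy, present_pt]
  exact exists_congr fun i => exists_congr fun j =>
    ⟨fun e => e.2, fun e => ⟨right_pos_of_not_dvd h e, e⟩⟩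

lemma present_dy_iff_lt_ell (ha : 0 < a) (hb : 0 < b) (hab : a.Coprime b) (h : ¬b ∣ m) (k : ℕ) :
    Present a b m (dy k 0) ↔ k < ell a b m := by
  rw [present_dy, lt_ell_iff ha hb hab]
  exact exists_congr fun i => exists_congr fun j =>
    ⟨fun e => ⟨left_pos_of_not_dvd h e.2, e⟩, fun e => e.2⟩

lemma present_dx_iff_lt_ell (ha : 0 < a) (hb : 0 < b) (hab : a.Coprime b) (h : ¬a ∣ m) (k : ℕ) :
    Present a b m (dx k 0) ↔ k < ell a b m := by
  rw [present_dx, lt_ell_iff ha hb hab]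
  exact exists_congr fun i => exists_congr fun j =>
    ⟨fun e => ⟨e.1, right_pos_of_not_dvd h e.2, e.2⟩, fun e => ⟨e.1, e.2.2⟩⟩

/-- If `m = a b n`, then the lengths of all cells are compared with multiples of `a b`. -/
lemma present_of_both_dvd (ha : 0 < a) (hb : 0 < b) (hab : a.Coprime b) {n : ℕ} (hn : 0 < n)
    (hm : m = n * (a * b)) : ell a b m + 1 = n ∧ (∀ k, Present a b m (pt k 0) ↔ k ≤ n) ∧
      (∀ k, Present a b m (dx k 0) ↔ k < n) ∧ (∀ k, Present a b m (dy k 0) ↔ k < n) := by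
  have hab0 : 0 < a * b := Nat.mul_pos ha hb
  have hda : a ∣ m := ⟨n * b, by rw [hm]; ring⟩
  have hdb : b ∣ m := ⟨n * a, by rw [hm]; ring⟩
  have hlt : ∀ {x k : ℕ}, 0 < x → n * (a * b) = x + k * (a * b) → k < n := by
    intro x k hx e
    exact lt_of_mul_lt_mul_right (show k * (a * b) < n * (a * b) by omega) (Nat.zero_le _)
  have hell : ∀ k, k < ell a b m ↔ k + 1 < n := by
    intro k
    rw [lt_ell_iff ha hb hab]
    constructor
    · rintro ⟨i, j, hi, hj, e⟩
      obtain ⟨r, rfl⟩ := dvd_of_right_dvd hab hdb e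
      obtain ⟨t, rfl⟩ := dvd_of_left_dvd hab hda e
      obtain ⟨r, rfl⟩ := Nat.exists_eq_succ_of_ne_zero (pos_of_mul_pos_right hi (Nat.zero_le b)).ne'
      have ht := Nat.mul_pos hb hj
      refine hlt (x := a * (b * r) + b * (a * t)) (Nat.add_pos_right _ ht) ?_
      rw [← hm, e, Nat.succ_eq_add_one]
      ring
    · intro h
      obtain ⟨r, rfl⟩ := Nat.exists_eq_add_of_lt h
      exact ⟨b * (r + 1), a, Nat.mul_pos hb (Nat.succ_pos r), ha, by rw [hm]; ring⟩
  refine ⟨?_, fun k => ?_, fun k => ?_, fun k => ?_⟩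
  · have h1 := hell (ell a b m)
    have h2 := hell (n - 1)
    omega
  · rw [present_pt]
    constructor
    · rintro ⟨i, j, e⟩
      rw [hm] at e
      exact le_of_mul_le_mul_right (show k * (a * b) ≤ n * (a * b) by omega) hab0
    · intro h
      obtain ⟨r, rfl⟩ := Nat.exists_eq_add_of_le h
      exact ⟨b * r, 0, by rw [hm]; ring⟩
  · rw [present_dx]
    constructor
    · rintro ⟨i, j, hi, e⟩
      exact hlt (x := a * i + b * j) (Nat.add_pos_left (Nat.mul_pos ha hi) _) (hm ▸ e)
    · intro h
      obtain ⟨r, rfl⟩ := Nat.exists_eq_add_of_lt h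
      exact ⟨b * (r + 1), 0, Nat.mul_pos hb (Nat.succ_pos r), by rw [hm]; ring⟩
  · rw [present_dy]
    constructor
    · rintro ⟨i, j, hj, e⟩
      exact hlt (x := a * i + b * j) (Nat.add_pos_right _ (Nat.mul_pos hb hj)) (hm ▸ e)
    · intro h
      obtain ⟨r, rfl⟩ := Nat.exists_eq_add_of_lt h
      exact ⟨0, a * (r + 1), Nat.mul_pos ha (Nat.succ_pos r), by rw [hm]; ring⟩

end KCell

end Ell

/-! ### Comparison of the cover with `Σ(a,b,m)` -/

section Link

variable {V W : Type} [LinearOrder V] [LinearOrder W]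

/-- The map on chains that is induced by a strictly increasing map of vertices. -/
abbrev mapChain (f : V ↪o W) : (Finset V →₀ ℤ) →ₗ[ℤ] (Finset W →₀ ℤ) :=
  Finsupp.lmapDomain ℤ ℤ (Finset.map f.toEmbedding)

lemma mapChain_single (f : V ↪o W) (s : Finset V) (r : ℤ) :
    mapChain f (Finsupp.single s r) = Finsupp.single (s.map f.toEmbedding) r := by
  rw [Finsupp.lmapDomain_apply, Finsupp.mapDomain_single]

lemma faceSign_map (f : V ↪o W) (s : Finset V) (v : V) :
    faceSign (s.map f.toEmbedding) (f v) = faceSign s v := by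
  rw [faceSign_eq_prod, faceSign_eq_prod, Finset.prod_map]
  exact Finset.prod_congr rfl fun u _ => by simp

lemma finsetBoundary_mapChain (f : V ↪o W) (x : Finset V →₀ ℤ) :
    finsetBoundary (mapChain f x) = mapChain f (finsetBoundary x) := by
  suffices h : finsetBoundary ∘ₗ mapChain f = mapChain f ∘ₗ finsetBoundary from
    LinearMap.congr_fun h x
  ext s : 2
  rw [LinearMap.comp_apply, LinearMap.comp_apply, LinearMap.comp_apply, LinearMap.comp_apply,
    Finsupp.lsingle_apply, mapChain_single, finsetBoundary_single, finsetBoundary_single,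
    one_smul, one_smul, map_sum, Finset.sum_map]
  refine Finset.sum_congr rfl fun v _ => ?_
  rw [mapChain_single, Finset.map_erase]
  congr 1
  exact faceSign_map f s v

/-- The sum of the faces opposite to `v`, with their incidence signs. -/
def link (v : V) : (Finset V →₀ ℤ) →ₗ[ℤ] (Finset V →₀ ℤ) :=
  Finsupp.linearCombination ℤ fun s =>
    if v ∈ s then Finsupp.single (s.erase v) (faceSign s v) else 0

lemma link_single_of_mem {v : V} {s : Finset V} (h : v ∈ s) :
    link v (Finsupp.single s 1) = Finsupp.single (s.erase v) (faceSign s v) := by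
  simp [link, h]

lemma link_single_of_notMem {v : V} {s : Finset V} (h : v ∉ s) :
    link v (Finsupp.single s 1) = 0 := by
  simp [link, h]

lemma vertexPart_single_of_mem {v : V} {s : Finset V} (h : v ∈ s) (r : ℤ) :
    vertexPart v (Finsupp.single s r) = Finsupp.single s r :=
  Finsupp.filter_single_of_pos _ h

lemma vertexPart_single_of_notMem {v : V} {s : Finset V} (h : v ∉ s) (r : ℤ) :
    vertexPart v (Finsupp.single s r) = 0 :=
  Finsupp.filter_single_of_neg _ h

/-- If the boundary of a chain avoids `v`, then the boundary of the part that contains `v` only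
consists of the faces opposite to `v`. -/
lemma finsetBoundary_vertexPart {v : V} {x : Finset V →₀ ℤ}
    (hd : finsetBoundary x ∈ Finsupp.supported ℤ ℤ {s : Finset V | v ∉ s}) :
    finsetBoundary (vertexPart v x) = link v x := by
  have h1 : link v x ∈ Finsupp.supported ℤ ℤ {s : Finset V | v ∉ s} := by
    refine map_mem_of_single (S := Set.univ) _ (fun s _ => ?_) (by simp)
    by_cases h : v ∈ s
    · rw [link_single_of_mem h]
      exact Finsupp.single_mem_supported ℤ _ (Finset.notMem_erase v s)
    · rw [link_single_of_notMem h]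
      exact Submodule.zero_mem _
  have h2 : finsetBoundary (vertexPart v x) - link v x ∈
      Finsupp.supported ℤ ℤ {s : Finset V | v ∈ s} := by
    refine map_mem_of_single (S := Set.univ) (finsetBoundary ∘ₗ
      (Finsupp.filterAddHom (M := ℤ) (v ∈ ·)).toIntLinearMap - link v) (fun s _ => ?_) (by simp)
    change finsetBoundary (vertexPart v (Finsupp.single s 1)) - link v (Finsupp.single s 1) ∈ _
    by_cases h : v ∈ s
    · rw [link_single_of_mem h, vertexPart_single_of_mem h, finsetBoundary_single, one_smul,
        ← Finset.add_sum_erase s _ h, add_sub_cancel_left]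
      exact Submodule.sum_mem _ fun u hu => Finsupp.single_mem_supported ℤ _
        (Finset.mem_erase.2 ⟨(Finset.ne_of_mem_erase hu).symm, h⟩)
    · rw [link_single_of_notMem h, vertexPart_single_of_notMem h, map_zero, sub_zero]
      exact Submodule.zero_mem _
  have h3 := Submodule.sub_mem _ (finsetBoundary_vertexPart_mem hd) h1
  have h4 : Disjoint (Finsupp.supported ℤ ℤ {s : Finset V | v ∉ s})
      (Finsupp.supported ℤ ℤ {s : Finset V | v ∈ s}) := by
    refine Finsupp.disjoint_supported_supported ?_
    exact Set.disjoint_left.2 fun s h h' => h h'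
  exact sub_eq_zero.1 (Submodule.disjoint_def.1 h4 _ h3 h2)

end Link

section Cover

variable {a b m : ℕ}

/-- The chains on simplices between `0` and `m - 1`. -/
abbrev baseChains (m : ℕ) : Submodule ℤ (Finset ℤ →₀ ℤ) :=
  Finsupp.supported ℤ ℤ {s | s ⊆ Finset.Ico 0 (m : ℤ)}

lemma insert_mem_coverFaces_of_top {s : Finset ℤ} (hm : InS a b m) (hs : s ∈ coverFaces a b m)
    {v : ℤ} (hv : v ∈ s) (h : ∀ x ∈ s, x ≤ v) : insert (v - m) s ∈ coverFaces a b m := by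
  have key : ∀ x ∈ s, InS a b (x - (v - m)) ∧ InS a b (v - x) := fun x hx => by
    have := hs x hx v hv (h x hx)
    exact ⟨by convert this.2 using 1; ring, this.1⟩
  intro x hx y hy hxy
  rcases Finset.mem_insert.1 hx with rfl | hx <;> rcases Finset.mem_insert.1 hy with rfl | hy
  · exact ⟨InS.self a b _, by simpa using hm⟩
  · exact ⟨(key y hy).1, by convert (key y hy).2 using 1; ring⟩
  · have := (key x hx).1.nonneg
    rw [show x = v - m by omega]
    exact ⟨InS.self a b _, by simpa using hm⟩
  · exact hs x hx y hy hxy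

lemma insert_mem_coverFaces_of_bot {s : Finset ℤ} (hm : InS a b m) (hs : s ∈ coverFaces a b m)
    {v : ℤ} (hv : v ∈ s) (h : ∀ x ∈ s, v ≤ x) : insert (v + m) s ∈ coverFaces a b m := by
  have key : ∀ x ∈ s, InS a b (v + m - x) ∧ InS a b (x - v) := fun x hx => by
    have := hs v hv x hx (h x hx)
    exact ⟨by convert this.2 using 1; ring, this.1⟩
  intro x hx y hy hxy
  rcases Finset.mem_insert.1 hx with rfl | hx <;> rcases Finset.mem_insert.1 hy with rfl | hy
  · exact ⟨InS.self a b _, by simpa using hm⟩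
  · have := (key y hy).1.nonneg
    rw [show y = v + m by omega]
    exact ⟨InS.self a b _, by simpa using hm⟩
  · exact ⟨(key x hx).1, by convert (key x hx).2 using 1; ring⟩
  · exact hs x hx y hy hxy

lemma finsetBoundary_mem_coverChains {n : ℕ} {x : Finset ℤ →₀ ℤ}
    (hx : x ∈ coverChains a b m (n + 1)) :
    finsetBoundary x ∈ coverChains a b m n :=
  finsetBoundary_mem (S := {s | s ∈ coverFaces a b m ∧ s.card = n + 1})
    (S' := {s | s ∈ coverFaces a b m ∧ s.card = n})
    (fun s hs v hv => ⟨coverFaces_mono hs.1 (Finset.erase_subset v s), by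
    have := Finset.card_erase_add_one hv
    have := hs.2
    omega⟩) hx

/-- One step of moving a chain towards the simplices between `0` and `m - 1`: a vertex `v` outside
of this range that is dominated by a vertex `w` can be avoided. -/
lemma push_step {n : ℕ} {S : Set (Finset ℤ)} {v w : ℤ} (hvw : v ≠ w) (hv : v ∉ Finset.Ico 0 (m : ℤ))
    (hS : S ⊆ coverFaces a b m) (hS' : ∀ s ∈ S, ∀ u ∈ s, s.erase u ∈ S)
    (hdom : ∀ s ∈ S, v ∈ s → insert w s ∈ S) {x : Finset ℤ →₀ ℤ} (hx : x ∈ coverChains a b m n)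
    (hxS : x ∈ Finsupp.supported ℤ ℤ S) (hd : finsetBoundary x ∈ baseChains m) :
    ∃ y ∈ coverChains a b m (n + 1),
      x - finsetBoundary y ∈ Finsupp.supported ℤ ℤ {s ∈ S | v ∉ s} := by
  refine ⟨coneOp w (vertexPart v x), ?_, sub_finsetBoundary_coneOp_mem hvw hS' hdom hxS
    (Finsupp.supported_mono (s := {s | s ⊆ Finset.Ico 0 (m : ℤ)})
      (fun s hs h => hv (hs h)) hd)⟩
  have h : vertexPart v x ∈ Finsupp.supported ℤ ℤ {s ∈ {s | s ∈ S ∧ s.card = n} | v ∈ s} := by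
    refine vertexPart_mem ?_
    rw [coverChains, Finsupp.mem_supported] at hx
    rw [Finsupp.mem_supported] at hxS ⊢
    exact fun s hs => ⟨hxS hs, (hx hs).2⟩
  exact coneOp_mem (S' := {s | s ∈ coverFaces a b m ∧ s.card = n + 1})
    (fun s hs hw => ⟨hS (hdom s hs.1.1 hs.2), by
    rw [Finset.card_insert_of_notMem hw, hs.1.2]⟩) h

lemma exists_push_of_bounded (hm0 : 0 < m) (hm : InS a b m) {n : ℕ} (j k : ℕ) :
    ∀ x ∈ coverChains a b m n, x ∈ Finsupp.supported ℤ ℤ {s | s ⊆ Finset.Ico (-j : ℤ) (m + k)} →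
      finsetBoundary x ∈ baseChains m →
      ∃ y ∈ coverChains a b m (n + 1), x - finsetBoundary y ∈ baseChains m := by
  have combine : ∀ {x y : Finset ℤ →₀ ℤ}, x ∈ coverChains a b m n → y ∈ coverChains a b m (n + 1) →
      finsetBoundary x ∈ baseChains m →
      ((x - finsetBoundary y) ∈ coverChains a b m n →
        finsetBoundary (x - finsetBoundary y) ∈ baseChains m →
        ∃ z ∈ coverChains a b m (n + 1), x - finsetBoundary y - finsetBoundary z ∈ baseChains m) →
      ∃ y ∈ coverChains a b m (n + 1), x - finsetBoundary y ∈ baseChains m := by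
    intro x y hx hy hd h
    obtain ⟨z, hz, hz'⟩ := h (Submodule.sub_mem _ hx (finsetBoundary_mem_coverChains hy)) (by
      rwa [map_sub, finsetBoundary_finsetBoundary, sub_zero])
    exact ⟨y + z, Submodule.add_mem _ hy hz, by rwa [map_add, ← sub_sub]⟩
  induction k with
  | zero =>
    induction j with
    | zero =>
      intro x _ hxs _
      exact ⟨0, Submodule.zero_mem _, by simpa using hxs⟩
    | succ j ih =>
      intro x hx hxs hd
      obtain ⟨y, hy, hy'⟩ := push_step (v := -(j + 1 : ℕ)) (w := -(j + 1 : ℕ) + m)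
        (S := {s | s ∈ coverFaces a b m ∧ s ⊆ Finset.Ico (-(j + 1 : ℕ) : ℤ) (m + (0 : ℕ))})
        (by omega) (by simp; omega) (fun s hs => hs.1)
        (fun s hs u _ => ⟨coverFaces_mono hs.1 (Finset.erase_subset u s),
          (Finset.erase_subset u s).trans hs.2⟩)
        (fun s hs hv => ⟨insert_mem_coverFaces_of_bot hm hs.1 hv fun u hu =>
          (Finset.mem_Ico.1 (hs.2 hu)).1, Finset.insert_subset (by simp; omega) hs.2⟩)
        hx (by
          rw [coverChains, Finsupp.mem_supported] at hx
          rw [Finsupp.mem_supported] at hxs ⊢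
          exact fun s hs => ⟨(hx hs).1, hxs hs⟩) hd
      refine combine hx hy hd fun h1 h2 =>
        ih _ h1 (Finsupp.supported_mono (fun s hs u hu => ?_) hy') h2
      have h3 := Finset.mem_Ico.1 (hs.1.2 hu)
      have h4 : u ≠ -(j + 1 : ℕ) := fun e => hs.2 (e ▸ hu)
      rw [Finset.mem_Ico]
      omega
  | succ k ih =>
    intro x hx hxs hd
    obtain ⟨y, hy, hy'⟩ := push_step (v := m + k) (w := m + k - m)
      (S := {s | s ∈ coverFaces a b m ∧ s ⊆ Finset.Ico (-j : ℤ) (m + (k + 1 : ℕ))})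
      (by omega) (by simp) (fun s hs => hs.1)
      (fun s hs u _ => ⟨coverFaces_mono hs.1 (Finset.erase_subset u s),
        (Finset.erase_subset u s).trans hs.2⟩)
      (fun s hs hv => ⟨insert_mem_coverFaces_of_top hm hs.1 hv fun u hu => by
          have := (Finset.mem_Ico.1 (hs.2 hu)).2
          omega, Finset.insert_subset (by simp; omega) hs.2⟩)
      hx (by
        rw [coverChains, Finsupp.mem_supported] at hx
        rw [Finsupp.mem_supported] at hxs ⊢
        exact fun s hs => ⟨(hx hs).1, hxs hs⟩) hd
    refine combine hx hy hd fun h1 h2 =>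
        ih _ h1 (Finsupp.supported_mono (fun s hs u hu => ?_) hy') h2
    have h3 := Finset.mem_Ico.1 (hs.1.2 hu)
    have h4 : u ≠ (m + k : ℤ) := fun e => hs.2 (e ▸ hu)
    rw [Finset.mem_Ico]
    omega

/-- A chain of the cover whose boundary lies between `0` and `m - 1` can be changed by a boundary
so as to lie there itself: the vertex `v ≥ m` that is the highest one is dominated by `v - m`, and
the vertex `v < 0` that is the lowest one is dominated by `v + m`. -/
theorem exists_push (hm0 : 0 < m) (hm : InS a b m) {n : ℕ} {x : Finset ℤ →₀ ℤ}
    (hx : x ∈ coverChains a b m n) (hd : finsetBoundary x ∈ baseChains m) :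
    ∃ y ∈ coverChains a b m (n + 1), x - finsetBoundary y ∈ baseChains m := by
  let N := (x.support.biUnion id).sup Int.natAbs
  refine exists_push_of_bounded hm0 hm N (N + 1) x hx ?_ hd
  rw [Finsupp.mem_supported]
  intro s hs u hu
  have : u.natAbs ≤ N := Finset.le_sup (f := Int.natAbs) (Finset.mem_biUnion.2 ⟨s, hs, hu⟩)
  rw [Finset.mem_Ico]
  omega

end Cover

section Embed

variable {a b m : ℕ}

/-- The vertices of `Σ(a,b,m)` as integers. -/
def position (m : ℕ) : Fin m ↪o ℤ where
  toFun i := (i : ℕ)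
  inj' i j h := Fin.ext (Nat.cast_injective (R := ℤ) h)
  map_rel_iff' {i j} := by
    change ((i : ℕ) : ℤ) ≤ (j : ℕ) ↔ i ≤ j
    rw [Nat.cast_le, Fin.le_def]

lemma position_apply (i : Fin m) : position m i = ((i : ℕ) : ℤ) := rfl

variable (a b m) in
/-- The oriented chains of `Σ(a,b,m)` as chains on sets of integers. -/
def embed (q : ℤ) : (Simplex (SigmaComplex a b m) q →₀ ℤ) →ₗ[ℤ] (Finset ℤ →₀ ℤ) :=
  Finsupp.lmapDomain ℤ ℤ fun s => s.1.map (position m).toEmbedding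

lemma embed_single {q : ℤ} (s : Simplex (SigmaComplex a b m) q) (r : ℤ) :
    embed a b m q (Finsupp.single s r) = Finsupp.single (s.1.map (position m).toEmbedding) r := by
  rw [embed, Finsupp.lmapDomain_apply, Finsupp.mapDomain_single]

lemma embed_injective (q : ℤ) : Function.Injective (embed a b m q) :=
  Finsupp.mapDomain_injective fun _ _ h => Subtype.ext (Finset.map_injective _ h)

lemma embed_boundary (q : ℤ) (x : Simplex (SigmaComplex a b m) (q + 1) →₀ ℤ) :
    embed a b m q (boundary (SigmaComplex a b m) q x) = finsetBoundary (embed a b m (q + 1) x) := by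
  suffices h : embed a b m q ∘ₗ boundary (SigmaComplex a b m) q =
      finsetBoundary ∘ₗ embed a b m (q + 1) from LinearMap.congr_fun h x
  ext s : 2
  have e : boundary (SigmaComplex a b m) q (Finsupp.single s 1) =
      ∑ v : {v // v ∈ s.1}, Finsupp.single (s.face v.1 v.2) (faceSign s.1 v.1) := by
    simp [boundary]
  rw [LinearMap.comp_apply, LinearMap.comp_apply, LinearMap.comp_apply, LinearMap.comp_apply,
    Finsupp.lsingle_apply, e, map_sum, embed_single, finsetBoundary_single, one_smul,
    Finset.sum_map, ← Finset.sum_coe_sort s.1]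
  refine Finset.sum_congr rfl fun v _ => ?_
  rw [embed_single, ← Finset.map_erase]
  congr 1
  exact (faceSign_map (position m) s.1 v.1).symm

lemma mem_coverFaces_map_iff {t : Finset (Fin m)} :
    t.map (position m).toEmbedding ∈ coverFaces a b m ↔ t = ∅ ∨ t ∈ SigmaComplex a b m := by
  have key : t ∈ SigmaComplex a b m ↔ _ := isFace_iff
  have h1 : ∀ u v : Fin m, u ≤ v → (InS a b ((v : ℕ) - (u : ℕ) : ℤ) ↔ IsSum a b ((v : ℕ) - u)) :=
    fun u v h => by rw [← inS_natCast, Nat.cast_sub h]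
  have h2 : ∀ u v : Fin m, u ≤ v →
      (InS a b (m - ((v : ℕ) - (u : ℕ)) : ℤ) ↔ IsSum a b (u + m - v)) := fun u v h => by
    rw [← inS_natCast, Nat.cast_sub (by omega)]
    push_cast
    rw [show (m - ((v : ℕ) - (u : ℕ)) : ℤ) = (u : ℕ) + m - (v : ℕ) by ring]
  rw [key]
  constructor
  · intro h
    refine t.eq_empty_or_nonempty.imp id fun h0 => ⟨h0, fun u hu v hv huv => ?_⟩
    have h3 := h _ (Finset.mem_map_of_mem _ hu) _ (Finset.mem_map_of_mem _ hv)
      ((position m).le_iff_le.2 huv)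
    exact ⟨(h1 u v huv).1 h3.1, (h2 u v huv).1 h3.2⟩
  · rintro (rfl | h)
    · intro x hx
      simp at hx
    · intro x hx y hy hxy
      obtain ⟨u, hu, rfl⟩ := Finset.mem_map.1 hx
      obtain ⟨v, hv, rfl⟩ := Finset.mem_map.1 hy
      have huv : u ≤ v := (position m).le_iff_le.1 hxy
      have h3 := h.2 u hu v hv huv
      exact ⟨(h1 u v huv).2 h3.1, (h2 u v huv).2 h3.2⟩

lemma embed_mem_coverChains {n : ℕ} {q : ℤ} (h : q + 1 = n)
    (x : Simplex (SigmaComplex a b m) q →₀ ℤ) : embed a b m q x ∈ coverChains a b m n := by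
  refine map_mem_of_single (S := Set.univ) _ (fun s _ => ?_) (by simp)
  rw [embed_single]
  refine Finsupp.single_mem_supported ℤ _ ⟨(mem_coverFaces_map_iff).2 s.2.1, ?_⟩
  rw [Finset.card_map]
  have := s.2.2
  omega

lemma embed_mem_baseChains {q : ℤ} (x : Simplex (SigmaComplex a b m) q →₀ ℤ) :
    embed a b m q x ∈ baseChains m := by
  refine map_mem_of_single (S := Set.univ) _ (fun s _ => ?_) (by simp)
  rw [embed_single]
  refine Finsupp.single_mem_supported ℤ _ fun z hz => ?_
  obtain ⟨u, -, rfl⟩ := Finset.mem_map.1 hz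
  have := u.isLt
  change ((u : ℕ) : ℤ) ∈ _
  rw [Finset.mem_Ico]
  omega

lemma exists_embed {n : ℕ} {q : ℤ} (h : q + 1 = n) {x : Finset ℤ →₀ ℤ}
    (hx : x ∈ coverChains a b m n) (hx' : x ∈ baseChains m) : ∃ z, embed a b m q z = x := by
  have h1 : x ∈ Finsupp.supported ℤ ℤ
      {s | (s ∈ coverFaces a b m ∧ s.card = n) ∧ s ⊆ Finset.Ico 0 (m : ℤ)} := by
    rw [coverChains, Finsupp.mem_supported] at hx
    rw [Finsupp.mem_supported] at hx' ⊢
    exact fun s hs => ⟨hx hs, hx' hs⟩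
  refine map_mem_of_single (N := LinearMap.range (embed a b m q)) LinearMap.id (fun s hs => ?_) h1
  obtain ⟨t, rfl⟩ : ∃ t : Finset (Fin m), t.map (position m).toEmbedding = s := by
    refine ⟨s.preimage (position m) (position m).injective.injOn, ?_⟩
    ext z
    simp only [Finset.mem_map, Finset.mem_preimage]
    constructor
    · rintro ⟨u, hu, rfl⟩
      exact hu
    · intro hz
      have h2 := Finset.mem_Ico.1 (hs.2 hz)
      have h3 : position m ⟨z.toNat, by omega⟩ = z := by
        rw [position_apply]
        exact Int.toNat_of_nonneg h2.1
      exact ⟨⟨z.toNat, by omega⟩, by rwa [h3], h3⟩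
  refine ⟨Finsupp.single ⟨t, (mem_coverFaces_map_iff).1 hs.1.1, ?_⟩ 1, embed_single _ _⟩
  have := hs.1.2
  rw [Finset.card_map] at this
  omega

/-- The translation of `ℤ` by `k`. -/
def shift (k : ℤ) : ℤ ↪o ℤ := OrderEmbedding.ofStrictMono (· + k) fun _ _ h => by simpa using h

lemma shift_apply (k z : ℤ) : shift k z = z + k := rfl

/-- The generator of `C_m`. -/
def gen (m : ℕ) : Cyc m := Multiplicative.ofAdd 1

variable [NeZero m]

lemma gen_smul_val (r : Fin m) : ((gen m • r : Fin m) : ℕ) = (r + 1) % m := by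
  rw [rotation_val]
  change ((1 : ZMod m).val + r) % m = _
  rw [ZMod.val_one_eq_one_mod, Nat.mod_add_mod, add_comm]

lemma gen_smul_val_cases (r : Fin m) : ((gen m • r : Fin m) : ℕ) = r + 1 ∧ (r : ℕ) + 1 < m ∨
    ((gen m • r : Fin m) : ℕ) = 0 ∧ (r : ℕ) + 1 = m := by
  rw [gen_smul_val]
  have := r.isLt
  rcases Nat.lt_or_ge (r + 1) m with h | h
  · exact Or.inl ⟨Nat.mod_eq_of_lt h, h⟩
  · have : (r : ℕ) + 1 = m := by omega
    exact Or.inr ⟨by rw [this, Nat.mod_self], this⟩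

lemma orientSign_gen_of_mem {s : Finset (Fin m)} {l : Fin m} (hl : (l : ℕ) + 1 = m) (h : l ∈ s) :
    orientSign (gen m) s = faceSign s l := by
  rw [faceSign_eq_prod]
  refine Finset.prod_congr rfl fun u _ => ?_
  rw [Finset.prod_eq_single_of_mem l h]
  · refine if_congr (and_iff_left_of_imp fun hu => ?_) rfl rfl
    have h1 := gen_smul_val_cases u
    have h2 := gen_smul_val_cases l
    rw [Fin.lt_def] at hu ⊢
    omega
  · intro v _ hv
    rw [if_neg]
    rintro ⟨h1, h2⟩
    have h3 := gen_smul_val_cases u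
    have h4 := gen_smul_val_cases v
    rw [Fin.lt_def] at h1 h2
    exact hv (Fin.ext (by omega))

lemma orientSign_gen_of_notMem {s : Finset (Fin m)} (h : ∀ v ∈ s, (v : ℕ) + 1 < m) :
    orientSign (gen m) s = 1 := by
  refine Finset.prod_eq_one fun u hu => Finset.prod_eq_one fun v hv => ?_
  rw [if_neg]
  rintro ⟨h1, h2⟩
  have h3 := gen_smul_val_cases u
  have h4 := gen_smul_val_cases v
  have h5 := h v hv
  rw [Fin.lt_def] at h1 h2
  omega

/-- The rotation of a chain of `Σ(a,b,m)` arises from the translated chain by replacing the vertex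
`m` by `0`. -/
lemma embed_chainRep_gen (q : ℤ) (z : Simplex (SigmaComplex a b m) q →₀ ℤ) :
    embed a b m q (chainRep (SigmaComplex_invariant a b m) q (gen m) z) =
      mapChain (shift 1) (embed a b m q z) -
        vertexPart (m : ℤ) (mapChain (shift 1) (embed a b m q z)) +
        coneOp 0 (link (m : ℤ) (mapChain (shift 1) (embed a b m q z))) := by
  have hlin : ∀ y : Finset ℤ →₀ ℤ,
      (Finsupp.filterAddHom (M := ℤ) ((m : ℤ) ∈ ·)).toIntLinearMap y = vertexPart (m : ℤ) y :=
    fun _ => rfl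
  rw [← hlin]
  suffices h : embed a b m q ∘ₗ chainRep (SigmaComplex_invariant a b m) q (gen m) =
      ((LinearMap.id - (Finsupp.filterAddHom (M := ℤ) ((m : ℤ) ∈ ·)).toIntLinearMap +
        coneOp 0 ∘ₗ link (m : ℤ)) ∘ₗ mapChain (shift 1)) ∘ₗ embed a b m q from
    LinearMap.congr_fun h z
  ext s : 2
  simp only [LinearMap.comp_apply, Finsupp.lsingle_apply, embed_single, mapChain_single,
    LinearMap.add_apply, LinearMap.sub_apply, LinearMap.id_apply, hlin]
  have e : chainRep (SigmaComplex_invariant a b m) q (gen m) (Finsupp.single s 1) =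
      Finsupp.single (s.translate (SigmaComplex_invariant a b m) (gen m))
        (orientSign (gen m) s.1) := by
    simp [chainRep]
  rw [e, embed_single]
  change Finsupp.single ((gen m • s.1).map _) _ = _
  have hmem : ∀ r : Fin m, (m : ℤ) ∈ ((s.1.map (position m).toEmbedding).map
      (shift 1).toEmbedding) → (r : ℕ) + 1 = m → r ∈ s.1 := by
    intro r h hr
    rw [Finset.map_map, Finset.mem_map] at h
    obtain ⟨u, hu, h⟩ := h
    change ((u : ℕ) : ℤ) + 1 = m at h
    have : u = r := Fin.ext (by omega)
    exact this ▸ hu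
  by_cases h : (m : ℤ) ∈ ((s.1.map (position m).toEmbedding).map (shift 1).toEmbedding)
  · obtain ⟨l, hl⟩ : ∃ l : Fin m, (l : ℕ) + 1 = m :=
      ⟨⟨m - 1, by have := NeZero.pos m; omega⟩, by have := NeZero.pos m; simp; omega⟩
    have hls := hmem l h hl
    have h0 : (0 : ℤ) ∉ (((s.1.map (position m).toEmbedding).map (shift 1).toEmbedding).erase
        (m : ℤ)) := by
      intro h0
      rw [Finset.map_map] at h0
      obtain ⟨u, -, h0⟩ := Finset.mem_map.1 (Finset.mem_of_mem_erase h0)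
      change ((u : ℕ) : ℤ) + 1 = 0 at h0
      omega
    rw [vertexPart_single_of_mem h, link_single_of_mem h, sub_self, zero_add,
      coneOp_single_of_notMem h0]
    have h1 : faceSign ((s.1.map (position m).toEmbedding).map (shift 1).toEmbedding) m =
        faceSign s.1 l := by
      have e1 : (m : ℤ) = shift 1 (position m l) := by
        rw [shift_apply, position_apply]
        exact_mod_cast hl.symm
      rw [e1]
      exact (faceSign_map (shift 1) _ _).trans (faceSign_map (position m) s.1 l)
    have h2 : faceSign (((s.1.map (position m).toEmbedding).map (shift 1).toEmbedding).erase
        (m : ℤ)) 0 = 1 := by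
      rw [faceSign, Finset.filter_eq_empty_iff.2, Finset.card_empty, pow_zero]
      intro z hz
      rw [Finset.map_map] at hz
      obtain ⟨u, -, rfl⟩ := Finset.mem_map.1 (Finset.mem_of_mem_erase hz)
      change ¬((u : ℕ) : ℤ) + 1 < 0
      omega
    rw [orientSign_gen_of_mem hl hls, h1, h2, mul_one]
    congr 1
    ext z
    rw [Finset.map_map, Finset.mem_insert, Finset.mem_erase, Finset.mem_map, Finset.mem_map]
    constructor
    · rintro ⟨u, hu, rfl⟩
      obtain ⟨r, hr, rfl⟩ := Finset.mem_smul_finset.1 hu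
      change ((gen m • r : Fin m) : ℕ) = (0 : ℤ) ∨ _
      rcases gen_smul_val_cases r with h3 | h3
      · refine Or.inr ⟨?_, r, hr, ?_⟩
        · change ((gen m • r : Fin m) : ℕ) ≠ (m : ℤ)
          omega
        · change ((r : ℕ) : ℤ) + 1 = ((gen m • r : Fin m) : ℕ)
          omega
      · exact Or.inl (by omega)
    · rintro (rfl | ⟨hz, r, hr, rfl⟩)
      · refine ⟨gen m • l, Finset.smul_mem_smul_finset hls, ?_⟩
        have := gen_smul_val_cases l
        change (((gen m • l : Fin m) : ℕ) : ℤ) = 0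
        omega
      · refine ⟨gen m • r, Finset.smul_mem_smul_finset hr, ?_⟩
        have := gen_smul_val_cases r
        change ((r : ℕ) : ℤ) + 1 ≠ m at hz
        change (((gen m • r : Fin m) : ℕ) : ℤ) = (r : ℕ) + 1
        omega
  · rw [vertexPart_single_of_notMem h, link_single_of_notMem h, map_zero, add_zero, sub_zero]
    have hs : ∀ r ∈ s.1, (r : ℕ) + 1 < m := by
      intro r hr
      refine lt_of_le_of_ne r.isLt fun e => h ?_
      rw [Finset.map_map]
      refine Finset.mem_map.2 ⟨r, hr, ?_⟩
      change ((r : ℕ) : ℤ) + 1 = m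
      exact_mod_cast e
    rw [orientSign_gen_of_notMem hs]
    congr 1
    have hg : ∀ r ∈ s.1, (((gen m • r : Fin m) : ℕ) : ℤ) = (r : ℕ) + 1 := fun r hr => by
      have := hs r hr
      have := gen_smul_val_cases r
      omega
    ext z
    rw [Finset.map_map, Finset.mem_map, Finset.mem_map]
    constructor
    · rintro ⟨u, hu, rfl⟩
      obtain ⟨r, hr, rfl⟩ := Finset.mem_smul_finset.1 hu
      exact ⟨r, hr, (hg r hr).symm⟩
    · rintro ⟨r, hr, rfl⟩
      exact ⟨gen m • r, Finset.smul_mem_smul_finset hr, hg r hr⟩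

end Embed

/-! ### Transport of homology along acyclic carriers -/

section Transport

open LaurentPolynomial (T)

/-- The homology of the chains `C` is concentrated in degree `n`, where it is the quotient of the
ring of Laurent polynomials by `θ`; here `T` acts as the endomorphism `τ` of the chains. Unlike for
`IsTopHomology`, the cycles `e r` are only representatives, and `e` commutes with the actions only
up to boundaries, which makes the notion invariant under chain homotopies. -/
structure HasTopHomology {M : Type} [AddCommGroup M] (d τ : M →ₗ[ℤ] M) (C : ℕ → Submodule ℤ M)
    (n : ℕ) (θ : Lau) : Prop where
  exact : ∀ k ≠ n, ∀ x ∈ C k, d x = 0 → ∃ y ∈ C (k + 1), d y = x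
  top : ∃ e : Lau →ₗ[ℤ] M, (∀ r, e r ∈ C n) ∧ (∀ r, d (e r) = 0) ∧
    (∀ x ∈ C n, d x = 0 → ∃ r, ∃ y ∈ C (n + 1), d y = x - e r) ∧
    (∀ r, (∃ y ∈ C (n + 1), d y = e r) ↔ θ ∣ r) ∧
    ∀ r, ∃ y ∈ C (n + 1), d y = τ (e r) - e (T 1 * r)

lemma IsTopHomology.hasTopHomology {M : Type} [AddCommGroup M] {d τ : M →ₗ[ℤ] M}
    {C : ℕ → Submodule ℤ M} {n : ℕ} {θ : Lau} {e : Lau →ₗ[ℤ] M} (h : IsTopHomology d C n θ e)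
    (he : ∀ r, τ (e r) = e (T 1 * r)) : HasTopHomology d τ C n θ where
  exact := h.exact
  top := ⟨e, h.mem, h.d_e, fun x hx hd => by
    obtain ⟨r, rfl⟩ := h.cycle x hx hd
    exact ⟨r, 0, Submodule.zero_mem _, by simp⟩, h.boundary, fun r =>
    ⟨0, Submodule.zero_mem _, by simp [he]⟩⟩

variable {Λ : Type} [Preorder Λ] {X Y : CellComplex Λ} {A : Set Λ}

/-- Two filtered complexes whose pieces are acyclic have the same homology, and translations that
are compatible with the filtrations act in the same way. -/
theorem HasTopHomology.transport {τX : (X.Cell →₀ ℤ) →ₗ[ℤ] (X.Cell →₀ ℤ)}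
    {τY τY' : (Y.Cell →₀ ℤ) →ₗ[ℤ] (Y.Cell →₀ ℤ)} (σ : Λ → Λ)
    (hX : ∀ l n, ∀ x ∈ X.chains {l} n, τX x ∈ X.chains {σ l} n)
    (hXd : ∀ x, X.d (τX x) = τX (X.d x))
    (hX0 : τX (Finsupp.single X.empty 1) = Finsupp.single X.empty 1)
    (hY : ∀ n, ∀ x ∈ Y.chains A n, τY x ∈ Y.chains A n)
    (hYd : ∀ x, Y.d (τY x) = τY (Y.d x))
    (hY' : ∀ l n, ∀ x ∈ Y.chains {σ l} n, τY' x ∈ Y.chains {l} n)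
    (hYd' : ∀ x, Y.d (τY' x) = τY' (Y.d x))
    (hY0' : τY' (Finsupp.single Y.empty 1) = Finsupp.single Y.empty 1)
    (hYY : ∀ x, τY (τY' x) = x)
    {n : ℕ} {θ : Lau} (h : HasTopHomology X.d τX (X.chains A) n θ) :
    HasTopHomology Y.d τY (Y.chains A) n θ := by
  obtain ⟨F, hF, hFd, hF0⟩ := CellComplex.exists_chainMap X Y
  obtain ⟨G, hG, hGd, hG0⟩ := CellComplex.exists_chainMap Y X
  have hFm : ∀ {k} {x}, x ∈ X.chains A k → F x ∈ Y.chains A k := fun hx => hF.mem hx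
  have hGm : ∀ {k} {x}, x ∈ Y.chains A k → G x ∈ X.chains A k := fun hx => hG.mem hx
  obtain ⟨s, hs, hsd⟩ := CellComplex.exists_homotopy (X := X) (Y := X) (f := G ∘ₗ F - LinearMap.id)
    (fun k l x hx => Submodule.sub_mem _ (hG _ l _ (hF _ l x hx)) hx)
    (fun B k x hx => by
      rw [LinearMap.sub_apply, LinearMap.sub_apply, LinearMap.comp_apply, LinearMap.comp_apply,
        map_sub, hGd B k _ (hF.mem hx), hFd B k x hx]
      rfl)
    (by rw [LinearMap.sub_apply, LinearMap.comp_apply, hF0, hG0, LinearMap.id_apply, sub_self])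
  obtain ⟨t, ht, htd⟩ := CellComplex.exists_homotopy (X := Y) (Y := Y) (f := F ∘ₗ G - LinearMap.id)
    (fun k l x hx => Submodule.sub_mem _ (hF _ l _ (hG _ l x hx)) hx)
    (fun B k x hx => by
      rw [LinearMap.sub_apply, LinearMap.sub_apply, LinearMap.comp_apply, LinearMap.comp_apply,
        map_sub, hFd B k _ (hG.mem hx), hGd B k x hx]
      rfl)
    (by rw [LinearMap.sub_apply, LinearMap.comp_apply, hG0, hF0, LinearMap.id_apply, sub_self])
  have hXu : ∀ {B k} {x}, x ∈ X.chains B k → τX x ∈ X.chains Set.univ k := fun {B k x} hx => by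
    refine map_mem_of_single _ (fun c hc => ?_) hx
    obtain ⟨⟨l, -, hc⟩, rfl⟩ := hc
    exact CellComplex.chains_mono (Set.subset_univ _) _
      (hX l _ _ (CellComplex.single_mem_chains hc))
  -- Conjugating `F` by the translations gives another filtered chain map, homotopic to `F`.
  obtain ⟨u, hu, hud⟩ := CellComplex.exists_homotopy (X := X) (Y := Y) (f := τY' ∘ₗ F ∘ₗ τX - F)
    (fun k l x hx => Submodule.sub_mem _ (hY' l _ _ (hF _ _ _ (hX l _ x hx))) (hF _ l x hx))
    (fun B k x hx => by
      simp only [LinearMap.sub_apply, LinearMap.comp_apply]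
      rw [map_sub, hYd', hFd _ k _ (hXu hx), hXd, hFd B k x hx])
    (by
      simp only [LinearMap.sub_apply, LinearMap.comp_apply]
      rw [hX0, hF0, hY0', sub_self])
  obtain ⟨e, he, hed, hcyc, hbd, heq⟩ := h.top
  have htx : ∀ {k x}, x ∈ Y.chains A k → Y.d x = 0 → Y.d (t x) = F (G x) - x :=
      fun {k x} hx hd => by
    have := htd A k x hx
    rwa [hd, map_zero, add_zero] at this
  have hGc : ∀ {k x}, x ∈ Y.chains A k → Y.d x = 0 → X.d (G x) = 0 := fun {k x} hx hd => by
    rw [hGd A k x hx, hd, map_zero]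
  refine ⟨fun k hk x hx hd => ?_, F ∘ₗ e, fun r => hFm (he r), fun r => ?_, fun x hx hd => ?_,
    fun r => ⟨?_, fun hr => ?_⟩, fun r => ?_⟩
  · obtain ⟨y, hy, hyx⟩ := h.exact k hk _ (hGm hx) (hGc hx hd)
    refine ⟨F y - t x, Submodule.sub_mem _ (hFm hy) (ht.mem hx), ?_⟩
    rw [map_sub, htx hx hd, hFd A _ y hy, hyx]
    abel
  · rw [LinearMap.comp_apply, hFd A n _ (he r), hed, map_zero]
  · obtain ⟨r, y, hy, hyx⟩ := hcyc _ (hGm hx) (hGc hx hd)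
    refine ⟨r, F y - t x, Submodule.sub_mem _ (hFm hy) (ht.mem hx), ?_⟩
    rw [map_sub, htx hx hd, hFd A _ y hy, hyx, map_sub, LinearMap.comp_apply]
    abel
  · rintro ⟨y, hy, hyr⟩
    rw [LinearMap.comp_apply] at hyr
    refine (hbd r).1 ⟨G y - s (e r), Submodule.sub_mem _ (hGm hy) (hs.mem (he r)), ?_⟩
    have := hsd A n _ (he r)
    rw [hed, map_zero, add_zero, LinearMap.sub_apply, LinearMap.comp_apply, LinearMap.id_apply]
      at this
    rw [map_sub, hGd A _ y hy, hyr, this]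
    abel
  · obtain ⟨y, hy, hyr⟩ := (hbd r).2 hr
    exact ⟨F y, hFm hy, by rw [hFd A _ y hy, hyr, LinearMap.comp_apply]⟩
  · obtain ⟨y, hy, hyr⟩ := heq r
    have h1 := hud A n _ (he r)
    rw [hed, map_zero, add_zero] at h1
    simp only [LinearMap.sub_apply, LinearMap.comp_apply] at h1
    refine ⟨F y - τY (u (e r)), Submodule.sub_mem _ (hFm hy) (hY _ _ (hu.mem (he r))), ?_⟩
    rw [map_sub, hYd, h1, map_sub, hYY, hFd A _ y hy, hyr, map_sub, LinearMap.comp_apply,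
      LinearMap.comp_apply]
    abel

end Transport

section Translations

open LaurentPolynomial (T)

namespace KCell

/-- The translation of cells by `1`. -/
def shift : KCell → KCell
  | empty => empty
  | pt k z => pt k (z + 1)
  | dx k z => dx k (z + 1)
  | dy k z => dy k (z + 1)
  | dxy k z => dxy k (z + 1)

/-- The translation of chains by `1`. -/
abbrev shiftChain : (KCell →₀ ℤ) →ₗ[ℤ] (KCell →₀ ℤ) := Finsupp.lmapDomain ℤ ℤ shift

lemma shiftChain_single (c : KCell) (r : ℤ) :
    shiftChain (Finsupp.single c r) = Finsupp.single c.shift r := by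
  rw [Finsupp.lmapDomain_apply, Finsupp.mapDomain_single]

lemma shiftChain_lin {f : ℤ → KCell} (hf : ∀ z, (f z).shift = f (z + 1)) (p : Lau) :
    shiftChain (lin f p) = lin f (T 1 * p) :=
  map_lin shiftChain (lin f ∘ₗ mulL (T 1)) (fun z => by
    rw [shiftChain_single, hf, LinearMap.comp_apply, LinearMap.mulLeft_apply,
      ← LaurentPolynomial.T_add, lin_T, add_comm]) p

lemma shiftChain_low (k : ℕ) (p : Lau) : shiftChain (low k p) = low k (T 1 * p) := by
  cases k with
  | zero => rw [low, LinearMap.zero_apply, LinearMap.zero_apply, map_zero]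
  | succ k => exact shiftChain_lin (fun _ => rfl) p

variable {a b : ℕ}

lemma bdry_shiftChain (x : KCell →₀ ℤ) : bdry a b (shiftChain x) = shiftChain (bdry a b x) := by
  refine map_eq_of_single (S := Set.univ) (bdry a b ∘ₗ shiftChain) (shiftChain ∘ₗ bdry a b)
    (fun c _ => ?_) (by simp)
  have hT : ∀ (p : Lau) (z : ℤ), p * T (z + 1) = T 1 * (p * T z) := fun p z => by
    rw [LaurentPolynomial.T_add]
    ring
  have h1 : ∀ k p, shiftChain (lin (pt k) p) = lin (pt k) (T 1 * p) :=
    fun k => shiftChain_lin fun _ => rfl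
  have h2 : ∀ k p, shiftChain (lin (dx k) p) = lin (dx k) (T 1 * p) :=
    fun k => shiftChain_lin fun _ => rfl
  have h3 : ∀ k p, shiftChain (lin (dy k) p) = lin (dy k) (T 1 * p) :=
    fun k => shiftChain_lin fun _ => rfl
  rw [LinearMap.comp_apply, LinearMap.comp_apply, shiftChain_single, bdry_single, bdry_single]
  rcases c with _ | ⟨k, z⟩ | ⟨k, z⟩ | ⟨k, z⟩ | ⟨k, z⟩
  · exact (map_zero _).symm
  · cases k with
    | zero => exact (shiftChain_single empty 1).symm
    | succ k => simp only [shift, dCell, hT, map_sub, h2, h3]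
  · simp only [shift, dCell, hT, map_add, h1, shiftChain_low]
  · simp only [shift, dCell, hT, map_add, h1, shiftChain_low]
  · simp only [shift, dCell, hT, map_sub, h2, h3]

lemma deg_shift (c : KCell) : c.shift.deg = c.deg := by cases c <;> rfl

lemma shiftChain_cycEven (k : ℕ) (r : Lau) :
    shiftChain (cycEven a b k r) = cycEven a b k (T 1 * r) := by
  rw [cycEven_apply, cycEven_apply, map_sub, shiftChain_lin fun _ => rfl,
    shiftChain_lin fun _ => rfl, mul_left_comm, mul_left_comm (T 1)]

lemma shiftChain_cycOdd (w : Lau) (k : ℕ) (r : Lau) :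
    shiftChain (cycOdd w k r) = cycOdd w k (T 1 * r) := by
  rw [cycOdd_apply, cycOdd_apply, map_add, shiftChain_lin fun _ => rfl, shiftChain_low,
    mul_left_comm, mul_left_comm (T 1) w]

end KCell

variable {a b m : ℕ}

/-- The translation of an interval. -/
def Interval.shift (l : Interval a b) : Interval a b :=
  ⟨l.lo + 1, l.hi + 1, by rw [add_sub_add_right_eq_sub]; exact l.le⟩

lemma KCell.shift_inside {l : Interval a b} {c : KCell} (h : c ∈ inside l) :
    c.shift ∈ inside l.shift := by
  rcases h with rfl | h
  · exact Or.inl rfl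
  · have key : ∀ {c : KCell} (_ : c.shift.bot = c.bot + 1) (_ : c.shift.width a b = c.width a b)
        (_ : InS a b (c.bot - l.lo) ∧ InS a b (l.hi - c.top a b)), c.shift ∈ inside l.shift := by
      intro c h1 h2 h
      refine Or.inr ⟨?_, ?_⟩
      · rw [h1]
        convert h.1 using 1
        simp only [Interval.shift]
        ring
      · convert h.2 using 1
        simp only [Interval.shift, top, h1, h2]
        ring
    cases c with
    | empty => exact Or.inl rfl
    | pt k z => exact key rfl rfl h
    | dx k z => exact key rfl rfl h
    | dy k z => exact key rfl rfl h
    | dxy k z => exact key rfl rfl h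

lemma mapChain_shift_mem {k : ℤ} {l l' : Interval a b} (h : l'.lo = l.lo + k)
    (h' : l'.hi = l.hi + k)
    {n : ℕ} {x : Finset ℤ →₀ ℤ} (hx : x ∈ (barComplex a b).chains {l} n) :
    mapChain (shift k) x ∈ (barComplex a b).chains {l'} n := by
  refine map_mem_of_single (mapChain (shift k)) (fun s hs => ?_) hx
  obtain ⟨⟨_, rfl, hs⟩, hn⟩ := hs
  rw [mapChain_single]
  refine Finsupp.single_mem_supported ℤ _ ⟨⟨l', rfl, fun x hx => ?_, fun x hx y hy hxy => ?_⟩,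
    (Finset.card_map _).trans hn⟩
  · obtain ⟨x, hx', rfl⟩ := Finset.mem_map.1 hx
    have h1 := hs.1 x hx'
    change InS a b (x + k - l'.lo) ∧ InS a b (l'.hi - (x + k))
    rwa [h, h', add_sub_add_right_eq_sub, add_sub_add_right_eq_sub]
  · obtain ⟨x, hx', rfl⟩ := Finset.mem_map.1 hx
    obtain ⟨y, hy', rfl⟩ := Finset.mem_map.1 hy
    change InS a b (y + k - (x + k))
    rw [add_sub_add_right_eq_sub]
    exact hs.2 x hx' y hy' ((shift k).le_iff_le.1 hxy)

lemma mapChain_shift_mem_coverChains {n : ℕ} (k : ℤ) {x : Finset ℤ →₀ ℤ}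
    (hx : x ∈ coverChains a b m n) :
    mapChain (shift k) x ∈ coverChains a b m n := by
  refine map_mem_of_single (mapChain (shift k)) (fun s hs => ?_) hx
  rw [mapChain_single]
  refine Finsupp.single_mem_supported ℤ _ ⟨fun x hx y hy hxy => ?_, (Finset.card_map _).trans hs.2⟩
  obtain ⟨x, hx', rfl⟩ := Finset.mem_map.1 hx
  obtain ⟨y, hy', rfl⟩ := Finset.mem_map.1 hy
  change InS a b (y + k - (x + k)) ∧ InS a b (m - (y + k - (x + k)))
  rw [add_sub_add_right_eq_sub]
  exact hs.1 x hx' y hy' ((shift k).le_iff_le.1 hxy)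

/-- The homology of the cover can be computed with the small complex. -/
theorem hasTopHomology_coverChains (ha : 0 < a) (hab : a.Coprime b) (hm : InS a b m) {n : ℕ}
    {θ : Lau} (h : HasTopHomology (KCell.bdry a b) KCell.shiftChain (KCell.kChains a b m) n θ) :
    HasTopHomology finsetBoundary (mapChain (shift 1)) (coverChains a b m) n θ := by
  have h1 : (fun n => (koszulComplex ha hab).chains (windows a b m) n) = KCell.kChains a b m :=
    funext (KCell.koszulComplex_chains_windows hm)
  have h2 : (fun n => (barComplex a b).chains (windows a b m) n) = coverChains a b m :=
    funext (barComplex_chains_windows hm)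
  rw [← h2]
  refine HasTopHomology.transport (X := koszulComplex ha hab) (Y := barComplex a b)
    (A := windows a b m) (τX := KCell.shiftChain) (τY := mapChain (shift 1))
    (τY' := mapChain (shift (-1))) Interval.shift ?_ KCell.bdry_shiftChain
    (KCell.shiftChain_single _ _) ?_ (finsetBoundary_mapChain _) ?_ (finsetBoundary_mapChain _)
    ?_ ?_ (by rw [← h1] at h; exact h)
  · intro l n x hx
    refine map_mem_of_single KCell.shiftChain (fun c hc => ?_) hx
    obtain ⟨⟨_, rfl, hc⟩, hn⟩ := hc
    rw [KCell.shiftChain_single]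
    exact Finsupp.single_mem_supported ℤ _ ⟨⟨_, rfl, KCell.shift_inside hc⟩,
      (KCell.deg_shift c).trans hn⟩
  · intro n x hx
    rw [barComplex_chains_windows hm] at hx ⊢
    exact mapChain_shift_mem_coverChains 1 hx
  · intro l n x hx
    exact mapChain_shift_mem (by simp [Interval.shift]) (by simp [Interval.shift]) hx
  · exact mapChain_single _ _ _
  · intro x
    refine map_eq_of_single (S := Set.univ) (mapChain (shift 1) ∘ₗ mapChain (shift (-1)))
      LinearMap.id (fun s _ => ?_) (by rw [Finsupp.supported_univ]; exact Submodule.mem_top)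
    rw [LinearMap.comp_apply, mapChain_single, mapChain_single, Finset.map_map]
    congr 1
    convert Finset.map_refl
    ext z
    change z + -1 + 1 = z
    ring

end Translations

/-! ### Transport of homology from the cover to `Σ(a,b,m)` -/

section Sigma

open LaurentPolynomial (T)

/-- The linear map on Laurent polynomials with prescribed values on the monomials. -/
def lauMap {M : Type} [AddCommGroup M] (f : ℤ → M) : Lau →ₗ[ℤ] M :=
  Finsupp.linearCombination ℤ f ∘ₗ (AddMonoidAlgebra.coeffLinearEquiv ℤ).toLinearMap

lemma lauMap_T {M : Type} [AddCommGroup M] (f : ℤ → M) (z : ℤ) : lauMap f (T z) = f z := by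
  change Finsupp.linearCombination ℤ f (Finsupp.single z 1) = _
  rw [Finsupp.linearCombination_single, one_smul]

variable {a b m : ℕ}

/-- A chain of `Σ(a,b,m)` that is a boundary in the cover is a boundary. -/
lemma exists_boundary_of_cover (hm0 : 0 < m) (hm : InS a b m) {k : ℕ} {p : ℤ} (hk : p + 2 = k)
    {x : Simplex (SigmaComplex a b m) (p + 1) →₀ ℤ} {y : Finset ℤ →₀ ℤ}
    (hy : y ∈ coverChains a b m (k + 1)) (hyx : finsetBoundary y = embed a b m (p + 1) x) :
    ∃ w, boundary (SigmaComplex a b m) (p + 1) w = x := by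
  obtain ⟨z, hz, hz'⟩ := exists_push hm0 hm hy (by rw [hyx]; exact embed_mem_baseChains x)
  obtain ⟨w, hw⟩ := exists_embed (q := p + 1 + 1) (n := k + 1) (by push_cast; omega)
    (Submodule.sub_mem _ hy (finsetBoundary_mem_coverChains hz)) hz'
  refine ⟨w, embed_injective _ ?_⟩
  rw [embed_boundary, hw, map_sub, finsetBoundary_finsetBoundary, sub_zero, hyx]

lemma finsetBoundary_embed_eq_zero {p : ℤ} {x : Simplex (SigmaComplex a b m) (p + 1) →₀ ℤ} :
    finsetBoundary (embed a b m (p + 1) x) = 0 ↔ boundary (SigmaComplex a b m) p x = 0 := by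
  rw [← embed_boundary]
  exact map_eq_zero_iff _ (embed_injective _)

variable {n : ℕ} {θ : Lau}

theorem exact_of_hasTopHomology (hm0 : 0 < m) (hm : InS a b m)
    (h : HasTopHomology finsetBoundary (mapChain (shift 1)) (coverChains a b m) n θ) {p : ℤ}
    (hp : p + 2 ≠ n) (x : Simplex (SigmaComplex a b m) (p + 1) →₀ ℤ)
    (hx : boundary (SigmaComplex a b m) p x = 0) :
    ∃ y, boundary (SigmaComplex a b m) (p + 1) y = x := by
  rcases lt_or_ge (p + 2) 0 with h0 | h0
  · have : IsEmpty (Simplex (SigmaComplex a b m) (p + 1)) := ⟨fun s => by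
      have := s.2.2
      omega⟩
    exact ⟨0, Subsingleton.elim _ _⟩
  · obtain ⟨k, hk⟩ := Int.eq_ofNat_of_zero_le h0
    obtain ⟨y, hy, hyx⟩ := h.exact k (by omega) _ (embed_mem_coverChains (by omega) x)
      (finsetBoundary_embed_eq_zero.2 hx)
    exact exists_boundary_of_cover hm0 hm hk hy hyx

/-- Rotating a cycle of `Σ(a,b,m)` amounts, up to a boundary of the cover, to translating it. -/
lemma exists_rotation [NeZero m] (hm : InS a b m) {k : ℕ} {p : ℤ} (hk : p + 2 = k)
    {x : Simplex (SigmaComplex a b m) (p + 1) →₀ ℤ} (hx : boundary (SigmaComplex a b m) p x = 0) :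
    ∃ y ∈ coverChains a b m (k + 1), finsetBoundary y =
      mapChain (shift 1) (embed a b m (p + 1) x) -
        embed a b m (p + 1) (chainRep (SigmaComplex_invariant a b m) (p + 1) (gen m) x) := by
  set X := mapChain (shift 1) (embed a b m (p + 1) x) with hX
  have hd : finsetBoundary X = 0 := by
    rw [hX, finsetBoundary_mapChain, finsetBoundary_embed_eq_zero.2 hx, map_zero]
  have h1 : X ∈ Finsupp.supported ℤ ℤ
      {s | (s ∈ coverFaces a b m ∧ s.card = k) ∧ ∀ z ∈ s, z ≤ (m : ℤ)} := by
    have h2 := mapChain_shift_mem_coverChains 1 (embed_mem_coverChains (n := k) (by omega) x)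
    have h3 : X ∈ Finsupp.supported ℤ ℤ {s | ∀ z ∈ s, z ≤ (m : ℤ)} := by
      refine map_mem_of_single _ (fun s hs => ?_) (embed_mem_baseChains x)
      rw [mapChain_single]
      refine Finsupp.single_mem_supported ℤ _ fun z hz => ?_
      obtain ⟨u, hu, rfl⟩ := Finset.mem_map.1 hz
      exact (Finset.mem_Ico.1 (hs hu)).2
    rw [coverChains, Finsupp.mem_supported] at h2
    rw [Finsupp.mem_supported] at h3 ⊢
    exact fun s hs => ⟨h2 hs, h3 hs⟩
  refine ⟨coneOp 0 (vertexPart (m : ℤ) X), ?_, ?_⟩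
  · refine coneOp_mem (S' := {s | s ∈ coverFaces a b m ∧ s.card = k + 1}) (fun s hs hw => ⟨?_, ?_⟩)
      (vertexPart_mem (v := (m : ℤ)) h1)
    · have := insert_mem_coverFaces_of_top hm hs.1.1.1 hs.2 hs.1.2
      rwa [sub_self] at this
    · rw [Finset.card_insert_of_notMem hw, hs.1.1.2]
  · rw [embed_chainRep_gen, ← hX,
      ← finsetBoundary_vertexPart (by rw [hd]; exact Submodule.zero_mem _),
      ← sub_finsetBoundary_coneOp, sub_sub_cancel]

/-- The homology of `Σ(a,b,m)` in the degree where it does not vanish: the representatives `e r` in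
the cover are replaced by homologous cycles of `Σ(a,b,m)`. -/
theorem top_of_hasTopHomology [NeZero m] (hm : InS a b m)
    (h : HasTopHomology finsetBoundary (mapChain (shift 1)) (coverChains a b m) n θ) {p : ℤ}
    (hp : p + 2 = n) : ∃ e : Lau →ₗ[ℤ] (Simplex (SigmaComplex a b m) (p + 1) →₀ ℤ),
      (∀ r, boundary (SigmaComplex a b m) p (e r) = 0) ∧
      (∀ x, boundary (SigmaComplex a b m) p x = 0 →
        ∃ r y, boundary (SigmaComplex a b m) (p + 1) y = x - e r) ∧
      (∀ r, (∃ y, boundary (SigmaComplex a b m) (p + 1) y = e r) ↔ θ ∣ r) ∧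
      ∀ r, ∃ y, boundary (SigmaComplex a b m) (p + 1) y =
        chainRep (SigmaComplex_invariant a b m) (p + 1) (gen m) (e r) - e (T 1 * r) := by
  have hm0 := NeZero.pos m
  obtain ⟨e, he, hed, hcyc, hbd, heq⟩ := h.top
  have hlift : ∀ z, ∃ x, ∃ y ∈ coverChains a b m (n + 1),
      embed a b m (p + 1) x = e (T z) - finsetBoundary y := fun z => by
    obtain ⟨y, hy, hy'⟩ := exists_push hm0 hm (he (T z)) (by rw [hed]; exact Submodule.zero_mem _)
    obtain ⟨x, hx⟩ := exists_embed (q := p + 1) (n := n) (by omega)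
      (Submodule.sub_mem _ (he (T z)) (finsetBoundary_mem_coverChains hy)) hy'
    exact ⟨x, y, hy, hx⟩
  choose f g hg hfg using hlift
  -- `lauMap f` represents the same classes as `e`; the difference is the boundary of `lauMap g`.
  have hG : ∀ r, lauMap g r ∈ coverChains a b m (n + 1) :=
    lau_mem (N := (coverChains a b m (n + 1)).toAddSubgroup.comap (lauMap g).toAddMonoidHom)
      fun z => by
        change lauMap g (T z) ∈ coverChains a b m (n + 1)
        rw [lauMap_T]
        exact hg z
  have hFG : ∀ r, embed a b m (p + 1) (lauMap f r) = e r - finsetBoundary (lauMap g r) :=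
    LinearMap.congr_fun (f := embed a b m (p + 1) ∘ₗ lauMap f) (g := e - finsetBoundary ∘ₗ lauMap g)
      (lau_hom_ext fun z => by
        rw [LinearMap.comp_apply, LinearMap.sub_apply, LinearMap.comp_apply, lauMap_T, lauMap_T,
          hfg])
  have hcycle : ∀ r, boundary (SigmaComplex a b m) p (lauMap f r) = 0 := fun r => by
    rw [← finsetBoundary_embed_eq_zero, hFG, map_sub, hed, finsetBoundary_finsetBoundary, sub_zero]
  refine ⟨lauMap f, hcycle, fun x hx => ?_, fun r => ⟨?_, fun hr => ?_⟩, fun r => ?_⟩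
  · obtain ⟨r, y, hy, hyx⟩ := hcyc _ (embed_mem_coverChains (by omega) x)
      (finsetBoundary_embed_eq_zero.2 hx)
    refine ⟨r, exists_boundary_of_cover hm0 hm hp (Submodule.add_mem _ hy (hG r)) ?_⟩
    rw [map_add, hyx, map_sub, hFG]
    abel
  · rintro ⟨y, hy⟩
    refine (hbd r).1 ⟨embed a b m (p + 1 + 1) y + lauMap g r,
      Submodule.add_mem _ (embed_mem_coverChains (by push_cast; omega) y) (hG r), ?_⟩
    rw [map_add, ← embed_boundary, hy, hFG, sub_add_cancel]
  · obtain ⟨y, hy, hyr⟩ := (hbd r).2 hr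
    refine exists_boundary_of_cover hm0 hm hp (Submodule.sub_mem _ hy (hG r)) ?_
    rw [map_sub, hyr, hFG]
  · obtain ⟨y, hy, hyr⟩ := heq r
    obtain ⟨z, hz, hzr⟩ := exists_rotation hm hp (hcycle r)
    refine exists_boundary_of_cover hm0 hm hp (y := y - mapChain (shift 1) (lauMap g r) - z +
      lauMap g (T 1 * r)) (Submodule.add_mem _ (Submodule.sub_mem _ (Submodule.sub_mem _ hy
        (mapChain_shift_mem_coverChains 1 (hG r))) hz) (hG _)) ?_
    rw [map_add, map_sub, map_sub, hyr, hzr, map_sub, hFG, hFG, finsetBoundary_mapChain, map_sub]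
    abel

end Sigma

/-! ### Cyclic modules over the group ring of `C_m` -/

section CyclicModule

open LaurentPolynomial (T)

variable {m : ℕ}

/-- The `ℤ[C_m]`-module `N` is isomorphic to the quotient of the ring of Laurent polynomials by
`θ`, with `T` acting as the generator of `C_m`. -/
def IsQuotientBy (m : ℕ) (N : Type) [AddCommMonoid N] [Module ℤ[Cyc m] N] (θ : Lau) : Prop :=
  ∃ π : Lau →+ N, Function.Surjective π ∧ (∀ r, π r = 0 ↔ θ ∣ r) ∧
    ∀ r, π (T 1 * r) = MonoidAlgebra.single (gen m) (1 : ℤ) • π r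

lemma gen_zpow (k : ℤ) : gen m ^ k = Multiplicative.ofAdd (k : ZMod m) := by
  rw [gen, ← ofAdd_zsmul, zsmul_one]

lemma exists_gen_zpow (g : Cyc m) : ∃ k : ℤ, gen m ^ k = g := by
  obtain ⟨k, hk⟩ := ZMod.intCast_surjective g.toAdd
  exact ⟨k, by rw [gen_zpow, hk]; rfl⟩

lemma exists_gen_pow [NeZero m] (g : Cyc m) : ∃ k : ℕ, gen m ^ k = g := by
  refine ⟨g.toAdd.val, ?_⟩
  have := gen_zpow (m := m) (g.toAdd.val : ℕ)
  rw [zpow_natCast] at this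
  rw [this, Int.cast_natCast, ZMod.natCast_zmod_val]
  rfl

/-- An additive map that commutes with the generator of `C_m` is `ℤ[C_m]`-linear. -/
lemma map_smul_of_gen [NeZero m] {N N' : Type} [AddCommMonoid N] [AddCommMonoid N']
    [Module ℤ[Cyc m] N] [Module ℤ[Cyc m] N'] (f : N →+ N')
    (hf : ∀ x, f (MonoidAlgebra.single (gen m) (1 : ℤ) • x) =
      MonoidAlgebra.single (gen m) (1 : ℤ) • f x) (A : ℤ[Cyc m]) (x : N) : f (A • x) = A • f x := by
  let _ : AddCommGroup N := Module.addCommMonoidToAddCommGroup ℤ[Cyc m]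
  let _ : AddCommGroup N' := Module.addCommMonoidToAddCommGroup ℤ[Cyc m]
  induction A using MonoidAlgebra.induction_on generalizing x with
  | of g =>
    obtain ⟨k, rfl⟩ := exists_gen_pow g
    induction k generalizing x with
    | zero => rw [pow_zero, map_one, one_smul, one_smul]
    | succ k ih =>
      rw [pow_succ, map_mul, mul_smul, mul_smul, ih]
      congr 1
      exact hf x
  | add A B hA hB => rw [add_smul, add_smul, map_add, hA, hB]
  | smul r A hA => rw [smul_assoc, smul_assoc, map_zsmul, hA]

theorem IsQuotientBy.nonempty_linearEquiv [NeZero m] {N N' : Type} [AddCommMonoid N]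
    [AddCommMonoid N'] [Module ℤ[Cyc m] N] [Module ℤ[Cyc m] N'] {θ : Lau}
    (h : IsQuotientBy m N θ) (h' : IsQuotientBy m N' θ) : Nonempty (N ≃ₗ[ℤ[Cyc m]] N') := by
  let _ : AddCommGroup N := Module.addCommMonoidToAddCommGroup ℤ[Cyc m]
  let _ : AddCommGroup N' := Module.addCommMonoidToAddCommGroup ℤ[Cyc m]
  obtain ⟨π, hs, hk, hT⟩ := h
  obtain ⟨π', hs', hk', hT'⟩ := h'
  have hker : π.ker = π'.ker := by
    ext r
    rw [AddMonoidHom.mem_ker, AddMonoidHom.mem_ker, hk, hk']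
  let e : N ≃+ N' := (QuotientAddGroup.quotientKerEquivOfSurjective π hs).symm.trans
    ((QuotientAddGroup.quotientAddEquivOfEq hker).trans
      (QuotientAddGroup.quotientKerEquivOfSurjective π' hs'))
  have he : ∀ r, e (π r) = π' r := fun r => by
    have h1 : (QuotientAddGroup.quotientKerEquivOfSurjective π hs).symm (π r) =
        (r : Lau ⧸ π.ker) := by
      rw [AddEquiv.symm_apply_eq]
      rfl
    change QuotientAddGroup.quotientKerEquivOfSurjective π' hs'
      (QuotientAddGroup.quotientAddEquivOfEq hker
        ((QuotientAddGroup.quotientKerEquivOfSurjective π hs).symm (π r))) = _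
    rw [h1]
    rfl
  refine ⟨e.toLinearEquiv (map_smul_of_gen e.toAddMonoidHom fun x => ?_)⟩
  obtain ⟨r, rfl⟩ := hs x
  change e _ = _ • e _
  rw [← hT, he, he, hT']

/-! ### Permutation modules -/

/-- The basis element of `ℤ[C_m/H]` that belongs to a coset, as an element of the module. -/
def cosetBasis {H : Subgroup (Cyc m)} (c : Cyc m ⧸ H) : PermModule H :=
  (MonoidAlgebra.single c 1 : ℤ[Cyc m ⧸ H])

variable {H L : Subgroup (Cyc m)}

lemma single_smul_cosetBasis (g h : Cyc m) :
    MonoidAlgebra.single g (1 : ℤ) • cosetBasis (QuotientGroup.mk h : Cyc m ⧸ H) =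
      cosetBasis (QuotientGroup.mk (g * h)) := by
  rw [Representation.single_smul, one_smul]
  change Representation.ofMulAction ℤ (Cyc m) (Cyc m ⧸ H) g (MonoidAlgebra.single _ 1) = _
  rw [Representation.ofMulAction_single]
  rfl

lemma permMap_cosetBasis (h : H ≤ L) (g : Cyc m) :
    permMap h (cosetBasis (QuotientGroup.mk g)) = cosetBasis (QuotientGroup.mk g) := by
  change MonoidAlgebra.mapDomain (Subgroup.quotientMapOfLE h)
    (MonoidAlgebra.single (QuotientGroup.mk g : Cyc m ⧸ H) (1 : ℤ)) = _
  rw [MonoidAlgebra.mapDomain_single]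
  rfl

variable (H) in
/-- The map from the Laurent polynomials to `ℤ[C_m/H]` that sends `T ^ k` to the class of the `k`-th
power of the generator. -/
def cosetMap : Lau →ₗ[ℤ] PermModule H := lauMap fun z => cosetBasis (QuotientGroup.mk (gen m ^ z))

lemma cosetMap_T (z : ℤ) : cosetMap H (T z) = cosetBasis (QuotientGroup.mk (gen m ^ z)) :=
  lauMap_T _ z

lemma cosetMap_T_mul (r : Lau) : cosetMap H (T 1 * r) =
    MonoidAlgebra.single (gen m) (1 : ℤ) • cosetMap H r := by
  suffices h : cosetMap H ∘ₗ mulL (T 1) =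
      (DistribSMul.toAddMonoidHom (PermModule H)
        (MonoidAlgebra.single (gen m) (1 : ℤ))).toIntLinearMap ∘ₗ cosetMap H from
    LinearMap.congr_fun h r
  refine lau_hom_ext fun z => ?_
  rw [LinearMap.comp_apply, LinearMap.comp_apply, LinearMap.mulLeft_apply,
    AddMonoidHom.coe_toIntLinearMap, DistribSMul.toAddMonoidHom_apply,
    ← LaurentPolynomial.T_add, cosetMap_T, cosetMap_T, single_smul_cosetBasis, zpow_add, zpow_one]

lemma permMap_cosetMap (h : H ≤ L) (r : Lau) : permMap h (cosetMap H r) = cosetMap L r := by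
  suffices h' : (permMap h).toAddMonoidHom.toIntLinearMap ∘ₗ cosetMap H = cosetMap L from
    LinearMap.congr_fun h' r
  refine lau_hom_ext fun z => ?_
  rw [LinearMap.comp_apply, AddMonoidHom.coe_toIntLinearMap, LinearMap.toAddMonoidHom_coe,
    cosetMap_T, cosetMap_T, permMap_cosetBasis]

lemma exists_gen_coset (c : Cyc m ⧸ H) :
    ∃ k : ℤ, (QuotientGroup.mk (gen m ^ k) : Cyc m ⧸ H) = c := by
  induction c using QuotientGroup.induction_on with
  | H g =>
    obtain ⟨k, rfl⟩ := exists_gen_zpow g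
    exact ⟨k, rfl⟩

lemma cosetMap_surjective : Function.Surjective (cosetMap H) := by
  intro x
  have h : ∀ y : ℤ[Cyc m ⧸ H], ∃ r, cosetMap H r = y := by
    intro y
    induction y using MonoidAlgebra.induction_linear with
    | zero => exact ⟨0, map_zero _⟩
    | add y z hy hz =>
      obtain ⟨r, hr⟩ := hy
      obtain ⟨s, hs⟩ := hz
      exact ⟨r + s, by rw [map_add, hr, hs]; rfl⟩
    | single c n =>
      obtain ⟨k, rfl⟩ := exists_gen_coset c
      refine ⟨n • T k, ?_⟩
      rw [map_smul, cosetMap_T, cosetBasis]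
      change n • (MonoidAlgebra.single _ 1 : ℤ[Cyc m ⧸ H]) = _
      rw [MonoidAlgebra.smul_single, smul_eq_mul, mul_one]
  exact h x

lemma mk_gen_eq_iff [NeZero m] {n : ℕ} (hn : n ∣ m) (z z' : ℤ) :
    (QuotientGroup.mk (gen m ^ z) : Cyc m ⧸ cyc m (m / n)) = QuotientGroup.mk (gen m ^ z') ↔
      (n : ℤ) ∣ z' - z := by
  obtain ⟨c, rfl⟩ := hn
  have hm0 := NeZero.ne (n * c)
  have hn0 : 0 < n := Nat.pos_of_ne_zero (left_ne_zero_of_mul hm0)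
  have hc0 : (c : ℤ) ≠ 0 := by exact_mod_cast right_ne_zero_of_mul hm0
  rw [QuotientGroup.eq, mem_cyc, ← zpow_neg, ← zpow_add, ← zpow_natCast, ← zpow_mul,
    Nat.mul_div_cancel_left c hn0, gen_zpow, ofAdd_eq_one, ZMod.intCast_zmod_eq_zero_iff_dvd,
    neg_add_eq_sub]
  push_cast
  exact mul_dvd_mul_iff_right hc0

lemma cosetMap_eq_zero_iff [NeZero m] {n : ℕ} (hn : n ∣ m) (r : Lau) :
    cosetMap (cyc m (m / n)) r = 0 ↔ (T (n : ℤ) - 1 : Lau) ∣ r := by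
  constructor
  · -- A section of `cosetMap`, well-defined up to multiples of `T ^ n - 1`.
    choose k hk using exists_gen_coset (H := cyc m (m / n))
    let ρ : PermModule (cyc m (m / n)) →ₗ[ℤ] Lau :=
      Finsupp.linearCombination ℤ (fun c => (T (k c) : Lau)) ∘ₗ
        (MonoidAlgebra.coeffLinearEquiv ℤ).toLinearMap
    have hρ : ∀ r, (T (n : ℤ) - 1 : Lau) ∣ r - ρ (cosetMap _ r) := by
      refine lau_mem (N := (Ideal.span {(T (n : ℤ) - 1 : Lau)}).toAddSubgroup.comap
        (LinearMap.id - ρ ∘ₗ cosetMap _).toAddMonoidHom) (fun z => ?_) |> fun h r =>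
          Ideal.mem_span_singleton.1 (h r)
      refine Ideal.mem_span_singleton.2 ?_
      change (T (n : ℤ) - 1 : Lau) ∣ T z - ρ (cosetMap _ (T z))
      have h1 : ρ (cosetMap _ (T z)) = T (k (QuotientGroup.mk (gen m ^ z))) := by
        rw [cosetMap_T, cosetBasis]
        change Finsupp.linearCombination ℤ (fun c => (T (k c) : Lau)) (Finsupp.single _ 1) = _
        rw [Finsupp.linearCombination_single, one_smul]
      obtain ⟨j, hj⟩ := (mk_gen_eq_iff hn _ _).1 (hk (QuotientGroup.mk (gen m ^ z)))
      rw [h1]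
      have h2 := (T_sub_one_dvd n j).mul_left (T (k (QuotientGroup.mk (gen m ^ z))))
      rwa [← hj, mul_sub, mul_one, ← LaurentPolynomial.T_add, add_sub_cancel] at h2
    intro h
    have := hρ r
    rwa [h, map_zero, sub_zero] at this
  · rintro ⟨q, rfl⟩
    suffices h : cosetMap (cyc m (m / n)) ∘ₗ mulL (T (n : ℤ) - 1) = 0 from LinearMap.congr_fun h q
    refine lau_hom_ext fun z => ?_
    rw [LinearMap.comp_apply, LinearMap.mulLeft_apply, LinearMap.zero_apply, sub_mul,
      one_mul, ← LaurentPolynomial.T_add, map_sub, cosetMap_T, cosetMap_T,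
      (mk_gen_eq_iff hn _ _).2 (show (n : ℤ) ∣ z - (n + z) from ⟨-1, by ring⟩), sub_self]

end CyclicModule

section Targets

open LaurentPolynomial (T)

variable {m : ℕ} [NeZero m]

lemma cosetMap_top_eq_zero_iff (r : Lau) : cosetMap (cyc m m) r = 0 ↔ (T 1 - 1 : Lau) ∣ r := by
  have h := cosetMap_eq_zero_iff (one_dvd m) r
  rwa [Nat.div_one, Nat.cast_one] at h

theorem isQuotientBy_permModule : IsQuotientBy m (PermModule (cyc m m)) (T 1 - 1) :=
  ⟨(cosetMap (cyc m m)).toAddMonoidHom, cosetMap_surjective, cosetMap_top_eq_zero_iff,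
    cosetMap_T_mul⟩

/-- The kernel of `ℤ[C_m/C_{m/d}] → ℤ[C_m/C_m]` is generated by the image of `T - 1`. -/
theorem isQuotientBy_permKernel {d : ℕ} (hd : d ∣ m) :
    IsQuotientBy m (permKernel hd) (geom 1 d) := by
  have hmem : ∀ r, cosetMap (cyc m (m / d)) r ∈ permKernel hd ↔ (T 1 - 1 : Lau) ∣ r := fun r => by
    rw [LinearMap.mem_ker, permMap_cosetMap, cosetMap_top_eq_zero_iff]
  let π : Lau →+ permKernel hd :=
    { toFun := fun r => ⟨cosetMap _ ((T 1 - 1) * r), (hmem _).2 (dvd_mul_right _ _)⟩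
      map_zero' := Subtype.ext (by
        change cosetMap _ _ = 0
        rw [mul_zero, map_zero])
      map_add' := fun r s => Subtype.ext (by
        change cosetMap _ _ = cosetMap _ _ + cosetMap _ _
        rw [mul_add, map_add]) }
  have hπ : ∀ r, π r = 0 ↔ cosetMap (cyc m (m / d)) ((T 1 - 1) * r) = 0 :=
    fun r => Submodule.mk_eq_zero _ _
  refine ⟨π, fun ⟨x, hx⟩ => ?_, fun r => ?_, fun r => Subtype.ext ?_⟩
  · obtain ⟨r, rfl⟩ := cosetMap_surjective x
    obtain ⟨q, rfl⟩ := (hmem r).1 hx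
    exact ⟨q, rfl⟩
  · rw [hπ, cosetMap_eq_zero_iff hd,
      sub_one_eq_mul_geom, mul_dvd_mul_iff_left T_one_ne_one]
  · change cosetMap _ _ = MonoidAlgebra.single (gen m) (1 : ℤ) • cosetMap _ _
    rw [mul_left_comm, cosetMap_T_mul]

lemma mem_iteratedKernel {G : Type} [Group G] {H L₁ L₂ M : Subgroup G} (h₁ : H ≤ L₁) (h₂ : H ≤ L₂)
    (h₁' : L₁ ≤ M) (h₂' : L₂ ≤ M) (x : LinearMap.ker (permMap h₁)) :
    x ∈ iteratedKernel h₁ h₂ h₁' h₂' ↔ permMap h₂ x.1 = 0 := by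
  unfold iteratedKernel
  rw [LinearMap.mem_ker]
  exact Submodule.mk_eq_zero _ _

/-- The iterated kernel is generated by the image of the product of `T - 1` with the geometric sums
of lengths `a` and `b`, which is the least common multiple of `T ^ a - 1` and `T ^ b - 1`. -/
theorem isQuotientBy_squareKernel {a b : ℕ} (hab : a.Coprime b) (ha : a ∣ m) (hb : b ∣ m)
    {w : Lau} (hw : geom a b = geom 1 b * w) : IsQuotientBy m (squareKernel hab ha hb) w := by
  have ha0 : a ≠ 0 := fun h => NeZero.ne m (zero_dvd_iff.1 (h ▸ ha))
  have hb0 : b ≠ 0 := fun h => NeZero.ne m (zero_dvd_iff.1 (h ▸ hb))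
  have hd : a * b ∣ m := hab.mul_dvd_of_dvd_of_dvd ha hb
  set g : Lau := (T 1 - 1) * (geom 1 a * geom 1 b) with hg
  have hg0 : g ≠ 0 := mul_ne_zero T_one_ne_one (mul_ne_zero (geom_ne_zero ha0) (geom_ne_zero hb0))
  have hgw : (T ((a * b : ℕ) : ℤ) - 1 : Lau) = g * w := by
    rw [Nat.cast_mul, ← geom_mul, hw, sub_one_eq_mul_geom]
    ring
  have h₁ := cyc_le m (div_mul_dvd_div_left hab ha hb)
  have h₂ := cyc_le m (div_mul_dvd_div_right hab ha hb)
  have hmem₁ : ∀ r, permMap h₁ (cosetMap _ r) = 0 ↔ (T (a : ℤ) - 1 : Lau) ∣ r := fun r => by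
    rw [permMap_cosetMap, cosetMap_eq_zero_iff ha]
  have hmem₂ : ∀ r, permMap h₂ (cosetMap _ r) = 0 ↔ (T (b : ℤ) - 1 : Lau) ∣ r := fun r => by
    rw [permMap_cosetMap, cosetMap_eq_zero_iff hb]
  have hdvd₁ : ∀ r, (T (a : ℤ) - 1 : Lau) ∣ g * r := fun r =>
    ⟨geom 1 b * r, by rw [sub_one_eq_mul_geom, hg]; ring⟩
  have hdvd₂ : ∀ r, (T (b : ℤ) - 1 : Lau) ∣ g * r := fun r =>
    ⟨geom 1 a * r, by rw [sub_one_eq_mul_geom, hg]; ring⟩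
  let π : Lau →+ squareKernel hab ha hb :=
    { toFun := fun r => ⟨⟨cosetMap _ (g * r), (hmem₁ _).2 (hdvd₁ r)⟩,
        (mem_iteratedKernel _ _ _ _ _).2 ((hmem₂ _).2 (hdvd₂ r))⟩
      map_zero' := Subtype.ext (Subtype.ext (by
        change cosetMap _ _ = 0
        rw [mul_zero, map_zero]))
      map_add' := fun r s => Subtype.ext (Subtype.ext (by
        change cosetMap _ _ = cosetMap _ _ + cosetMap _ _
        rw [mul_add, map_add])) }
  have hπ : ∀ r, π r = 0 ↔ cosetMap (cyc m (m / (a * b))) (g * r) = 0 :=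
    fun r => ⟨fun h => congrArg (fun x : squareKernel hab ha hb => x.1.1) h,
      fun h => Subtype.ext (Subtype.ext h)⟩
  refine ⟨π, fun ⟨⟨x, hx⟩, hx'⟩ => ?_, fun r => ?_, fun r => Subtype.ext (Subtype.ext ?_)⟩
  · obtain ⟨r, rfl⟩ := cosetMap_surjective x
    have h1 := (hmem₁ r).1 hx
    have h2 := (hmem₂ r).1 ((mem_iteratedKernel _ _ _ _ _).1 hx')
    rw [sub_one_eq_mul_geom] at h1 h2
    obtain ⟨s, rfl⟩ := (dvd_mul_right _ _).trans h1
    rw [mul_dvd_mul_iff_left T_one_ne_one] at h1 h2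
    obtain ⟨q, rfl⟩ := (isCoprime_geom hab).mul_dvd h1 h2
    refine ⟨q, Subtype.ext (Subtype.ext ?_)⟩
    change cosetMap _ _ = cosetMap _ _
    rw [hg, mul_assoc]
  · rw [hπ, cosetMap_eq_zero_iff hd, hgw, mul_dvd_mul_iff_left hg0]
  · change cosetMap _ _ = MonoidAlgebra.single (gen m) (1 : ℤ) • cosetMap _ _
    rw [mul_left_comm, cosetMap_T_mul]

end Targets

/-! ### Reduced homology in terms of cycles and boundaries -/

section Bridge

open LaurentPolynomial (T)

variable {V : Type} [LinearOrder V] {G : Type} [Group G] [MulAction G V]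
  {K : PreAbstractSimplicialComplex V} (hK : ∀ (g : G), ∀ s ∈ K, g • s ∈ K)

/-- The two boundary maps that determine the homology in degree `p + 1`. -/
def boundaryPair (p : ℤ) : ShortComplex (ModuleCat.{0} ℤ[G]) :=
  ShortComplex.mk (boundaryHom hK (p + 1)) (boundaryHom hK p) (by
    ext x
    exact LinearMap.congr_fun (boundary_boundary (K := K) p) x)

/-- The two boundary maps as a part of the chain complex. -/
def boundaryPairIso (p : ℤ) :
    (augmentedComplex hK).sc' (p + 1 + 1) (p + 1) p ≅ boundaryPair hK p :=
  ShortComplex.isoMk (Iso.refl _) (Iso.refl _) (Iso.refl _)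
    (by
      change 𝟙 _ ≫ boundaryHom hK (p + 1) =
        ChainComplex.of.d (chainModule hK) (boundaryHom hK) (p + 1 + 1) (p + 1) ≫ 𝟙 _
      rw [ChainComplex.of_d, Category.id_comp, Category.comp_id])
    (by
      change 𝟙 _ ≫ boundaryHom hK p =
        ChainComplex.of.d (chainModule hK) (boundaryHom hK) (p + 1) p ≫ 𝟙 _
      rw [ChainComplex.of_d, Category.id_comp, Category.comp_id])

/-- The reduced homology is the homology of the boundary maps. -/
def reducedHomologyIso (p : ℤ) : reducedHomology hK (p + 1) ≅ (boundaryPair hK p).homology :=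
  (augmentedComplex hK).homologyIsoSc' (p + 1 + 1) (p + 1) p (by simp) (by simp) ≪≫
    ShortComplex.homologyMapIso (boundaryPairIso hK p)

theorem subsingleton_reducedHomology {p : ℤ}
    (h : ∀ x, boundary K p x = 0 → ∃ y, boundary K (p + 1) y = x) :
    Subsingleton (reducedHomology hK (p + 1)) := by
  refine ModuleCat.subsingleton_of_isZero (Limits.IsZero.of_iso ?_ (reducedHomologyIso hK p))
  rw [← ShortComplex.exact_iff_isZero_homology, ShortComplex.moduleCat_exact_iff]
  exact h

/-- The reduced homology as the quotient of the cycles by the boundaries. -/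
theorem exists_reducedHomology_equiv (p : ℤ) : ∃ c : LinearMap.ker (boundary K p) →+
    reducedHomology hK (p + 1), Function.Surjective c ∧
      (∀ x, c x = 0 ↔ ∃ y, boundary K (p + 1) y = x.1) ∧
      ∀ (g : G) (x x' : LinearMap.ker (boundary K p)), x'.1 = chainRep hK (p + 1) g x.1 →
        c x' = MonoidAlgebra.single g (1 : ℤ) • c x := by
  let S := boundaryPair hK p
  let e : (LinearMap.ker S.g.hom ⧸ LinearMap.range S.moduleCatToCycles) ≃ₗ[ℤ[G]]
      reducedHomology hK (p + 1) :=
    ((reducedHomologyIso hK p) ≪≫ S.moduleCatHomologyIso).toLinearEquiv.symm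
  let i : LinearMap.ker (boundary K p) →+ LinearMap.ker S.g.hom :=
    { toFun := fun x => ⟨x.1, x.2⟩
      map_zero' := rfl
      map_add' := fun _ _ => rfl }
  let q := (LinearMap.range S.moduleCatToCycles).mkQ
  refine ⟨(e.toAddMonoidHom.comp q.toAddMonoidHom).comp i, ?_, fun x => ?_, fun g x x' h => ?_⟩
  · intro y
    obtain ⟨z, hz⟩ := Submodule.mkQ_surjective _ (e.symm y)
    exact ⟨⟨z.1, z.2⟩, by
      change e (q z) = y
      rw [hz, e.apply_symm_apply]⟩
  · change e (q (i x)) = 0 ↔ _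
    rw [e.map_eq_zero_iff, Submodule.mkQ_apply, Submodule.Quotient.mk_eq_zero]
    exact ⟨fun ⟨y, hy⟩ => ⟨y, congrArg Subtype.val hy⟩, fun ⟨y, hy⟩ => ⟨y, Subtype.ext hy⟩⟩
  · change e (q (i x')) = MonoidAlgebra.single g (1 : ℤ) • e (q (i x))
    rw [← map_smul, ← map_smul]
    congr 2
    refine Subtype.ext ?_
    change x'.1 = MonoidAlgebra.single g (1 : ℤ) • (show (chainRep hK (p + 1)).asModule from x.1)
    rw [h, Representation.single_smul, one_smul]
    rfl

end Bridge

/-! ### The homology of `Σ(a,b,m)` -/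

section Conclusion

open LaurentPolynomial (T)

lemma singleton_mem_SigmaComplex {a b m : ℕ} (hm : IsSum a b m) (r : Fin m) :
    {r} ∈ SigmaComplex a b m := by
  have : IsFace a b m {r} := by
    rw [isFace_iff]
    refine ⟨Finset.singleton_nonempty r, fun u hu v hv _ => ?_⟩
    rw [Finset.mem_singleton.1 hu, Finset.mem_singleton.1 hv, Nat.sub_self, Nat.add_sub_cancel_left]
    exact ⟨IsSum.zero a b, hm⟩
  exact this

variable {a b m : ℕ} [NeZero m] {n : ℕ} {θ : Lau}

theorem isQuotientBy_homologySigma (hm : InS a b m)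
    (h : HasTopHomology finsetBoundary (mapChain (shift 1)) (coverChains a b m) n θ) {p : ℤ}
    (hp : p + 2 = n) : IsQuotientBy m (homologySigma a b m (p + 1)) θ := by
  obtain ⟨e, he, hcyc, hbd, heq⟩ := top_of_hasTopHomology hm h hp
  obtain ⟨c, hc, hc0, hcg⟩ := exists_reducedHomology_equiv (SigmaComplex_invariant a b m) p
  let e' : Lau →ₗ[ℤ] LinearMap.ker (boundary (SigmaComplex a b m) p) := e.codRestrict _ he
  refine ⟨c.comp e'.toAddMonoidHom, fun y => ?_, fun r => (hc0 _).trans (hbd r), fun r => ?_⟩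
  · obtain ⟨x, rfl⟩ := hc y
    obtain ⟨r, y, hy⟩ := hcyc x.1 x.2
    refine ⟨r, ?_⟩
    have h1 : c (x - e' r) = 0 := (hc0 _).2 ⟨y, hy⟩
    rw [map_sub, sub_eq_zero] at h1
    exact h1.symm
  · obtain ⟨y, hy⟩ := heq r
    let x : LinearMap.ker (boundary (SigmaComplex a b m) p) :=
      ⟨chainRep (SigmaComplex_invariant a b m) (p + 1) (gen m) (e r), by
        rw [LinearMap.mem_ker]
        have h2 := congrArg (boundary (SigmaComplex a b m) p) hy
        have h3 := LinearMap.congr_fun (boundary_boundary (K := SigmaComplex a b m) p) y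
        rw [LinearMap.comp_apply, LinearMap.zero_apply] at h3
        rw [h3, map_sub, he, sub_zero] at h2
        exact h2.symm⟩
    have h1 : c (x - e' (T 1 * r)) = 0 := (hc0 _).2 ⟨y, hy⟩
    rw [map_sub, sub_eq_zero] at h1
    exact h1.symm.trans (hcg (gen m) (e' r) x rfl)

/-- The homology of `Σ(a,b,m)` from the homology of the small complex. The degree `n` of a chain of
simplices counts the vertices, and exceeds the dimension by one. -/
theorem homologySigma_of_koszul (ha : 0 < a) (hab : a.Coprime b) (hm : InS a b m)
    {e : Lau →ₗ[ℤ] (KCell →₀ ℤ)} (h : IsTopHomology (KCell.bdry a b) (KCell.kChains a b m) n θ e)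
    (he : ∀ r, KCell.shiftChain (e r) = e (T 1 * r)) {N : Type} [AddCommMonoid N]
    [Module ℤ[Cyc m] N] (hN : IsQuotientBy m N θ) {q₀ : ℤ} (hq₀ : q₀ + 1 = n) :
    Nonempty (homologySigma a b m q₀ ≃ₗ[ℤ[Cyc m]] N) ∧
      ∀ q : ℤ, q ≠ q₀ → Subsingleton (homologySigma a b m q) := by
  have h' := hasTopHomology_coverChains ha hab hm (h.hasTopHomology he)
  constructor
  · obtain ⟨p, rfl⟩ : ∃ p : ℤ, q₀ = p + 1 := ⟨q₀ - 1, by ring⟩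
    exact (isQuotientBy_homologySigma hm h' (by omega)).nonempty_linearEquiv hN
  · intro q hq
    obtain ⟨p, rfl⟩ : ∃ p : ℤ, q = p + 1 := ⟨q - 1, by ring⟩
    exact subsingleton_reducedHomology _
      (exact_of_hasTopHomology (NeZero.pos m) hm h' (by omega))

end Conclusion

end CuspHomology

end

open CuspHomology in
theorem theorem3p2 (a b m : ℕ) [NeZero m] (ha : 2 ≤ a) (hb : 2 ≤ b) (hab : a.Coprime b)
    (hm : IsSum a b m) :
    (SigmaComplex a b m).faces.Nonempty ∧
    (¬ a ∣ m → ¬ b ∣ m →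
      Nonempty (homologySigma a b m (2 * (ell a b m : ℤ) - 1) ≃ₗ[ℤ[Cyc m]]
        PermModule (cyc m m)) ∧
      ∀ q : ℤ, q ≠ 2 * (ell a b m : ℤ) - 1 → Subsingleton (homologySigma a b m q)) ∧
    (∀ h : a ∣ m, ¬ b ∣ m →
      Nonempty (homologySigma a b m (2 * (ell a b m : ℤ)) ≃ₗ[ℤ[Cyc m]] permKernel h) ∧
      ∀ q : ℤ, q ≠ 2 * (ell a b m : ℤ) → Subsingleton (homologySigma a b m q)) ∧
    (¬ a ∣ m → ∀ h : b ∣ m,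
      Nonempty (homologySigma a b m (2 * (ell a b m : ℤ)) ≃ₗ[ℤ[Cyc m]] permKernel h) ∧
      ∀ q : ℤ, q ≠ 2 * (ell a b m : ℤ) → Subsingleton (homologySigma a b m q)) ∧
    (∀ (h : a ∣ m) (h' : b ∣ m),
      Nonempty (homologySigma a b m (2 * (ell a b m : ℤ) + 1) ≃ₗ[ℤ[Cyc m]]
        squareKernel hab h h') ∧
      ∀ q : ℤ, q ≠ 2 * (ell a b m : ℤ) + 1 → Subsingleton (homologySigma a b m q)) := by
  have ha0 : 0 < a := by omega
  have hb0 : 0 < b := by omega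
  have hm' : InS a b m := inS_natCast.2 hm
  obtain ⟨w, hw, hw', hwc⟩ := exists_geom_factor ha0.ne' hb0.ne' hab
  have s : KCell.Setup a b m w := ⟨ha0, hb0.ne', hab, hm', hw, hw', hwc⟩
  refine ⟨⟨_, singleton_mem_SigmaComplex hm ⟨0, NeZero.pos m⟩⟩, fun h h' => ?_, fun h h' => ?_,
    fun h h' => ?_, fun h h' => ?_⟩
  · have hdy := KCell.present_dy_iff_lt_ell ha0 hb0 hab h'
    have hdx := KCell.present_dx_iff_lt_ell ha0 hb0 hab h
    have hpt := fun k => (KCell.present_dx_of_not_dvd h' k).symm.trans (hdx k)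
    have hL : 0 < ell a b m := (hpt 0).1 ((KCell.present_pt 0).2 (by simpa [IsSum] using hm))
    exact homologySigma_of_koszul ha0 hab hm'
      (KCell.isTopHomology_neither s hL hpt hdx hdy (KCell.present_dxy ha0 hb0 hab))
      (KCell.shiftChain_cycEven _) isQuotientBy_permModule (by push_cast; ring)
  · have hpt := KCell.present_pt_of_left_dvd ha0 hb0 hab hm h h'
    exact homologySigma_of_koszul ha0 hab hm'
      (KCell.isTopHomology_left s hpt (fun k => (KCell.present_dx_of_not_dvd h' k).trans (hpt k))
        (KCell.present_dy_iff_lt_ell ha0 hb0 hab h') (KCell.present_dxy ha0 hb0 hab))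
      (KCell.shiftChain_cycOdd _ _) (isQuotientBy_permKernel h) (by push_cast; ring)
  · have hpt := KCell.present_pt_of_right_dvd ha0 hb0 hab hm h h'
    exact homologySigma_of_koszul ha0 hab hm'
      (KCell.isTopHomology_right s hpt (KCell.present_dx_iff_lt_ell ha0 hb0 hab h)
        (fun k => (KCell.present_dy_of_not_dvd h k).trans (hpt k)) (KCell.present_dxy ha0 hb0 hab))
      (KCell.shiftChain_cycOdd _ _) (isQuotientBy_permKernel h') (by push_cast; ring)
  · obtain ⟨n, hn⟩ := hab.mul_dvd_of_dvd_of_dvd h h'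
    have hn0 : 0 < n := Nat.pos_of_ne_zero fun e => NeZero.ne m (by rw [hn, e, mul_zero])
    obtain ⟨hell, hpt, hdx, hdy⟩ :=
      KCell.present_of_both_dvd ha0 hb0 hab hn0 (hn.trans (mul_comm _ _))
    rw [← hell] at hpt hdx hdy
    exact homologySigma_of_koszul ha0 hab hm'
      (KCell.isTopHomology_both s hpt (fun k => (hdx k).trans Nat.lt_succ_iff)
        (fun k => (hdy k).trans Nat.lt_succ_iff) (KCell.present_dxy ha0 hb0 hab))
      (KCell.shiftChain_cycEven _) (isQuotientBy_squareKernel hab h h' hw) (by push_cast; ring)
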